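/- Let $N=2^n$ and let $P$ be a comparison matrix on $N$ players, i.e. $0\le P_{ab}\le 1$ and $P_{ab}+P_{ba}=1$ for $a\ne b$ (diagonal entries are irrelevant); $P$ is deterministic if all its off-diagonal entries are $0$ or $1$. A draw $\sigma$ places the players on the $2^n$ leaves of the balanced binary tree; when the two children of a node are labelled $a$ and $b$, the node is labelled $a$ with probability $P_{ab}$ and $b$ otherwise, independently. Let $\mathrm{wp}(i^*,P,\sigma)$ be the probability that player $i^*$ labels the root. For $\varepsilon>0$ let the drop be $$d_\varepsilon(i^*,P,\sigma)=\mathrm{wp}(i^*,P,\sigma)-\inf_{P'}\mathrm{wp}(i^*,P',\sigma),$$ where $P'$ ranges over the comparison matrices with $|P_{ab}-P'_{ab}|\le\varepsilon$ for all $a\ne b$. **Theorem 1.** For every comparison matrix $P$, player $i^*$ and draw $\sigma$: 1. For all sufficiently small $\varepsilon>0$ the drop $d_\varepsilon(i^*,P,\sigma)$ equals a polynomial in $\varepsilon$ with zero constant term. Let $\widehat d_\varepsilon(i^*,P,\sigma)$ denote the linear term (coefficient times $\varepsilon$) of this polynomial. 2. If $P$ is deterministic and $i^*$ is the winner, then $\widehat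 d_\varepsilon(i^*,P,\sigma)=c\,\varepsilon$ for all $\varepsilon>0$, where $c$ is the number of crucial matches, i.e. of pairs of players such that reversing the outcome of the match between them, and of it only, makes $i^*$ lose. 3. For $a\neq b$ there are constants $\alpha_{ab},\beta_{ab}$ such that, if the match between $a$ and $b$ (and it only) is given the probabilities $(x,1-x)$ with $x\in[0,1]$, the winning probability of $i^*$ is $\alpha_{ab}x+\beta_{ab}$. For all $\varepsilon>0$, $\widehat d_\varepsilon(i^*,P,\sigma)=\varepsilon\sum_{a<b}\delta_{ab}$, where $\delta_{ab}=|\alpha_{ab}|$ if $0<P_{ab}<1$, $\delta_{ab}=\max(-\alpha_{ab},0)$ if $P_{ab}=0$, and $\delta_{ab}=\max(\alpha_{ab},0)$ if $P_{ab}=1$. In particular, if no off-diagonal entry of $P$ is $0$ or $1$, then $\widehat d_\varepsilon(i^*,P,\sigma)=\varepsilon\sum_{a<b}|\alpha_{ab}|$. Moreover, given $P$, $i^*$, $\sigma$ and $\varepsilon>0$, the value $\widehat d_\varepsilon(i^*,P,\sigma)$ can be computed in polynomial time, on a random access machine with indirect addressing, random access to the input, and registers for natural numbers (constants, addition, truncated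 subtraction, halving, comparison) and for numbers (constants, addition, subtraction, multiplication, comparison): 4. One program does so for all deterministic $P$ in $O(N\log N)$ steps (read as $O(1)$ for $N=1$). 5. One program does so for all comparison matrices $P$ in $O(N^4)$ steps, each operation on real numbers counting as one step; when $P$ and $\varepsilon$ are rational, the same program runs in time polynomial in the bit length of $P$ and $\varepsilon$, each operation being charged one step plus the number of binary digits of its operands. -/

import Mathlib

open Filter Topology Polynomial

noncomputable section

namespace Knockout

/-! ### Knockout tournaments with `N = 2 ^ n` players -/

/-- Comparison matrices. The diagonal entries are irrelevant and left unconstrained. -/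
def IsComparison {N : ℕ} (P : Matrix (Fin N) (Fin N) ℝ) : Prop :=
  ∀ a b, a ≠ b → 0 ≤ P a b ∧ P a b ≤ 1 ∧ P a b + P b a = 1

/-- All off-diagonal entries are `0` or `1`. -/
def IsDeterministic {N : ℕ} (P : Matrix (Fin N) (Fin N) ℝ) : Prop :=
  ∀ a b, a ≠ b → P a b = 0 ∨ P a b = 1

/-- The probability that `c` wins a match between `a` and `b`. -/
def matchProb {N : ℕ} (P : Matrix (Fin N) (Fin N) ℝ) (a b c : Fin N) : ℝ :=
  if c = a then P a b else if c = b then 1 - P a b else 0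

/-- A draw is given by the permutation `σ` that lists the labels of the leaves from left to
right. `labelProb P σ k m c` is the probability that player `c` labels the node of height `k`
whose leaves are those at the positions `m, …, m + 2 ^ k - 1`. The two children of a node of
height `k + 1` are labelled independently. -/
def labelProb {n : ℕ} (P : Matrix (Fin (2 ^ n)) (Fin (2 ^ n)) ℝ)
    (σ : Equiv.Perm (Fin (2 ^ n))) : ℕ → ℕ → Fin (2 ^ n) → ℝ
  | 0, m, c => if (σ.symm c : ℕ) = m then 1 else 0
  | k + 1, m, c => ∑ a, ∑ b, labelProb P σ k m a * labelProb P σ k (m + 2 ^ k) b *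
      matchProb P a b c

/-- The probability that player `i` wins the tournament, i.e. labels the root. -/
def winProb {n : ℕ} (i : Fin (2 ^ n)) (P : Matrix (Fin (2 ^ n)) (Fin (2 ^ n)) ℝ)
    (σ : Equiv.Perm (Fin (2 ^ n))) : ℝ :=
  labelProb P σ n 0 i

/-- The `ε`-perturbations of `P`. -/
def perturbations {N : ℕ} (P : Matrix (Fin N) (Fin N) ℝ) (ε : ℝ) :
    Set (Matrix (Fin N) (Fin N) ℝ) :=
  {P' | IsComparison P' ∧ ∀ a b, a ≠ b → |P a b - P' a b| ≤ ε}

/-- The `ε`-guaranteed winning probability. -/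
def guaranteedProb {n : ℕ} (i : Fin (2 ^ n)) (P : Matrix (Fin (2 ^ n)) (Fin (2 ^ n)) ℝ)
    (σ : Equiv.Perm (Fin (2 ^ n))) (ε : ℝ) : ℝ :=
  sInf ((fun P' => winProb i P' σ) '' perturbations P ε)

/-- The `ε`-worst drop. -/
def worstDrop {n : ℕ} (i : Fin (2 ^ n)) (P : Matrix (Fin (2 ^ n)) (Fin (2 ^ n)) ℝ)
    (σ : Equiv.Perm (Fin (2 ^ n))) (ε : ℝ) : ℝ :=
  winProb i P σ - guaranteedProb i P σ ε

/-- The `ε`-worst drop is given by the polynomial `p` for all sufficiently small `ε > 0`.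
There is at most one such `p`. -/
def IsDropPolynomial {n : ℕ} (i : Fin (2 ^ n)) (P : Matrix (Fin (2 ^ n)) (Fin (2 ^ n)) ℝ)
    (σ : Equiv.Perm (Fin (2 ^ n))) (p : ℝ[X]) : Prop :=
  ∀ᶠ ε in 𝓝[>] (0 : ℝ), worstDrop i P σ ε = p.eval ε

open Classical in
/-- The first-order approximation of the `ε`-worst drop: the linear term of the polynomial that
gives the drop for small `ε`. -/
def firstOrderDrop {n : ℕ} (i : Fin (2 ^ n)) (P : Matrix (Fin (2 ^ n)) (Fin (2 ^ n)) ℝ)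
    (σ : Equiv.Perm (Fin (2 ^ n))) (ε : ℝ) : ℝ :=
  if h : ∃ p : ℝ[X], IsDropPolynomial i P σ p then h.choose.coeff 1 * ε else 0

/-- The matrix `P` with the match between `a` and `b` (and it only) replaced by an
`(x, 1 - x)` match. -/
def setMatch {N : ℕ} (P : Matrix (Fin N) (Fin N) ℝ) (a b : Fin N) (x : ℝ) :
    Matrix (Fin N) (Fin N) ℝ :=
  fun c d => if c = a ∧ d = b then x else if c = b ∧ d = a then 1 - x else P c d

/-- The crucial matches: the `(0,1)` matches, each listed as (loser, winner), such that
replacing the match by a `(1,0)` match makes `i` lose. -/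
def crucialMatches {n : ℕ} (i : Fin (2 ^ n)) (P : Matrix (Fin (2 ^ n)) (Fin (2 ^ n)) ℝ)
    (σ : Equiv.Perm (Fin (2 ^ n))) : Set (Fin (2 ^ n) × Fin (2 ^ n)) :=
  {q | q.1 ≠ q.2 ∧ P q.1 q.2 = 0 ∧ winProb i (setMatch P q.1 q.2 1) σ = 0}

/-- The largest first-order loss that perturbing a single entry `p` can cause when the winning
probability has slope `α` in this entry: an entry `0` can only grow and an entry `1` can only
shrink. -/
def matchDrop (p α : ℝ) : ℝ :=
  if p = 0 then max (-α) 0 else if p = 1 then max α 0 else |α|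

/-! ### A random access machine over an ordered ring

The machine has registers and an indirectly addressed memory, both for natural numbers
(indices, counters) and for elements of the ordered ring `F`, and random access to the
read-only input. Control is structured (branching and loops). -/

/-- An instance: distinguished player, matrix, draw, and `ε`. -/
structure Instance (F : Type) where
  n : ℕ
  player : Fin (2 ^ n)
  mat : Matrix (Fin (2 ^ n)) (Fin (2 ^ n)) F
  draw : Equiv.Perm (Fin (2 ^ n))
  eps : F

/-- The matrix entry at a pair of addresses (`0` out of range). -/
def Instance.entry {F : Type} [Zero F] (I : Instance F) (a b : ℕ) : F :=
  if h : a < 2 ^ I.n ∧ b < 2 ^ I.n then I.mat ⟨a, h.1⟩ ⟨b, h.2⟩ else 0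

/-- The player at a leaf (`0` out of range). -/
def Instance.leaf {F : Type} (I : Instance F) (a : ℕ) : ℕ :=
  if h : a < 2 ^ I.n then (I.draw ⟨a, h⟩ : ℕ) else 0

/-- `reg`, `mem`: registers and memory for natural numbers; `num`, `numMem`: registers and
memory for elements of `F`. -/
structure State (F : Type) where
  reg : ℕ → ℕ
  mem : ℕ → ℕ
  num : ℕ → F
  numMem : ℕ → F

/-- Primitive operations; all arguments are register names, except for the literals of `const`
and `numConst`. -/
inductive Op where
  | const (d c : ℕ)
  | add (d a b : ℕ)
  | sub (d a b : ℕ)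
  | half (d a : ℕ)
  | load (d a : ℕ)
  | store (a b : ℕ)
  | readDraw (d a : ℕ)
  | numConst (d : ℕ) (c : ℤ)
  | numAdd (d a b : ℕ)
  | numSub (d a b : ℕ)
  | numMul (d a b : ℕ)
  | numLoad (d a : ℕ)
  | numStore (a b : ℕ)
  | readEntry (d a b : ℕ)

/-- The effect of an operation. Subtraction of natural numbers is truncated, `half` rounds
down. -/
def Op.apply {F : Type} [CommRing F] (I : Instance F) (s : State F) : Op → State F
  | .const d c => { s with reg := Function.update s.reg d c }
  | .add d a b => { s with reg := Function.update s.reg d (s.reg a + s.reg b) }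
  | .sub d a b => { s with reg := Function.update s.reg d (s.reg a - s.reg b) }
  | .half d a => { s with reg := Function.update s.reg d (s.reg a / 2) }
  | .load d a => { s with reg := Function.update s.reg d (s.mem (s.reg a)) }
  | .store a b => { s with mem := Function.update s.mem (s.reg a) (s.reg b) }
  | .readDraw d a => { s with reg := Function.update s.reg d (I.leaf (s.reg a)) }
  | .numConst d c => { s with num := Function.update s.num d (c : F) }
  | .numAdd d a b => { s with num := Function.update s.num d (s.num a + s.num b) }
  | .numSub d a b => { s with num := Function.update s.num d (s.num a - s.num b) }
  | .numMul d a b => { s with num := Function.update s.num d (s.num a * s.num b) }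
  | .numLoad d a => { s with num := Function.update s.num d (s.numMem (s.reg a)) }
  | .numStore a b => { s with numMem := Function.update s.numMem (s.reg a) (s.num b) }
  | .readEntry d a b => { s with num := Function.update s.num d (I.entry (s.reg a) (s.reg b)) }

/-- Tests on two registers. -/
inductive Test where
  | lt (a b : ℕ)
  | eq (a b : ℕ)
  | numLt (a b : ℕ)

/-- The meaning of a test. -/
def Test.Holds {F : Type} [LinearOrder F] (s : State F) : Test → Prop
  | .lt a b => s.reg a < s.reg b
  | .eq a b => s.reg a = s.reg b
  | .numLt a b => s.num a < s.num b

/-- Programs. -/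
inductive Program where
  | op (o : Op)
  | seq (p q : Program)
  | branch (c : Test) (p q : Program)
  | loop (c : Test) (p : Program)

/-- A cost for each operation and test, depending on the instance and the current state. -/
structure CostModel (F : Type) where
  op : Instance F → State F → Op → ℕ
  test : State F → Test → ℕ

/-- `Run κ I p s s' t`: on the instance `I`, the program `p` started in the state `s` halts in
the state `s'`, and the operations and tests executed on the way have total cost `t`. -/
inductive Run {F : Type} [CommRing F] [LinearOrder F] (κ : CostModel F) (I : Instance F) :
    Program → State F → State F → ℕ → Prop
  | op (o : Op) (s : State F) : Run κ I (.op o) s (o.apply I s) (κ.op I s o)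
  | seq {p q : Program} {s s' s'' : State F} {t t' : ℕ} :
      Run κ I p s s' t → Run κ I q s' s'' t' → Run κ I (.seq p q) s s'' (t + t')
  | branchTrue {c : Test} {p q : Program} {s s' : State F} {t : ℕ} :
      c.Holds s → Run κ I p s s' t → Run κ I (.branch c p q) s s' (κ.test s c + t)
  | branchFalse {c : Test} {p q : Program} {s s' : State F} {t : ℕ} :
      ¬ c.Holds s → Run κ I q s s' t → Run κ I (.branch c p q) s s' (κ.test s c + t)
  | loopEnd {c : Test} {p : Program} {s : State F} :
      ¬ c.Holds s → Run κ I (.loop c p) s s (κ.test s c)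
  | loopStep {c : Test} {p : Program} {s s' s'' : State F} {t t' : ℕ} :
      c.Holds s → Run κ I p s s' t → Run κ I (.loop c p) s' s'' t' →
      Run κ I (.loop c p) s s'' (κ.test s c + t + t')

/-- Initially, register `0` holds the number `2 ^ n` of players, register `1` the distinguished
player, number register `0` holds `ε`, and everything else is `0`. -/
def Instance.init {F : Type} [Zero F] (I : Instance F) : State F where
  reg := fun k => if k = 0 then 2 ^ I.n else if k = 1 then (I.player : ℕ) else 0
  mem := fun _ => 0
  num := fun k => if k = 0 then I.eps else 0
  numMem := fun _ => 0

/-- On the instance `I`, the program halts with total cost at most `T` and leaves `v` in number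
register `0`. -/
def Outputs {F : Type} [CommRing F] [LinearOrder F] (κ : CostModel F) (p : Program)
    (I : Instance F) (v : F) (T : ℕ) : Prop :=
  ∃ (s : State F) (t : ℕ), Run κ I p I.init s t ∧ s.num 0 = v ∧ t ≤ T

/-- Uniform cost: each operation and each test is one step. -/
def unitCost (F : Type) : CostModel F where
  op := fun _ _ _ => 1
  test := fun _ _ => 1

/-- The number of binary digits of the numerator and the denominator of a rational number. -/
def ratBits (q : ℚ) : ℕ := q.num.natAbs.size + q.den.size

/-- Logarithmic (bit) cost over the rational numbers: each operation and each test is charged one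
step plus the number of binary digits of all its operands, including the addresses. -/
def bitCost : CostModel ℚ where
  op := fun I s o => match o with
    | .const _ c => 1 + c.size
    | .add _ a b => 1 + (s.reg a).size + (s.reg b).size
    | .sub _ a b => 1 + (s.reg a).size + (s.reg b).size
    | .half _ a => 1 + (s.reg a).size
    | .load _ a => 1 + (s.reg a).size + (s.mem (s.reg a)).size
    | .store a b => 1 + (s.reg a).size + (s.reg b).size
    | .readDraw _ a => 1 + (s.reg a).size + (I.leaf (s.reg a)).size
    | .numConst _ c => 1 + c.natAbs.size
    | .numAdd _ a b => 1 + ratBits (s.num a) + ratBits (s.num b)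
    | .numSub _ a b => 1 + ratBits (s.num a) + ratBits (s.num b)
    | .numMul _ a b => 1 + ratBits (s.num a) + ratBits (s.num b)
    | .numLoad _ a => 1 + (s.reg a).size + ratBits (s.numMem (s.reg a))
    | .numStore a b => 1 + (s.reg a).size + ratBits (s.num b)
    | .readEntry _ a b =>
        1 + (s.reg a).size + (s.reg b).size + ratBits (I.entry (s.reg a) (s.reg b))
  test := fun s c => match c with
    | .lt a b => 1 + (s.reg a).size + (s.reg b).size
    | .eq a b => 1 + (s.reg a).size + (s.reg b).size
    | .numLt a b => 1 + ratBits (s.num a) + ratBits (s.num b)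

/-- The bit length of a rational matrix together with a rational `ε`. -/
def inputBits {N : ℕ} (P : Matrix (Fin N) (Fin N) ℚ) (ε : ℚ) : ℕ :=
  (∑ a, ∑ b, ratBits (P a b)) + ratBits ε

end Knockout

end

/-!
The winning probability is affine in each entry `P a b` separately, because two players can meet
in one match only (`blockValue_replaceMatch_sub`). A multi-affine function takes its minimum over a
box at a vertex (`exists_vertex_le`), and for small `ε` the `ε`-perturbations of `P` form a box
whose vertices `P + ε • s` have rates `s` that do not depend on `ε`: an entry `0` can only grow, an
entry `1` can only shrink, and all others can do both. So the infimum is the minimum of finitely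
many polynomials in `ε`, one of which is the smallest on an interval `(0, δ)`. All of these
polynomials have the constant term `winProb i P σ`. The linear coefficient at the vertex `s` is
`∑ s a b * α a b` with the slopes `α` (`coeff_one_linePoly`), and it is smallest when each entry
moves against its slope as far as it can, which yields the sum of the `matchDrop`s
(`exists_isDropPolynomial`). If `i` wins a deterministic tournament, each `matchDrop` is the
indicator of a crucial match (`matchDrop_of_winProb_eq_one`).

The slope of a match is the difference of the winning probabilities for its two outcomes. The
program `generalProg` evaluates the tournament twice for each of the fewer than `N ^ 2` pairs; an
evaluation adds up, for each player, the possible opponents in all rounds, and so takes `O(N ^ 2)`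
steps. On rational input the numbers on the way are sums of probabilities whose common denominator
divides the `N`-th power of a common denominator of the input. As they are also bounded, their bit
lengths are polynomial (`ratBits_le_of_isBounded`), and the bit cost is at most a constant times
the number of steps times the largest bit length (`Exec.run_bitCost`).

In a deterministic tournament only the `N - 1` matches that take place can be crucial
(`sum_matchDrop_eq_subtreeSum`). The program `deterministicProg` computes the winners of all
subtrees bottom-up and then, for each of these matches, lets the loser climb the tree against the
winners of the sibling subtrees, which takes `O(log N)` steps.
-/

noncomputable section

namespace Knockout

/-! ### Blocks of the tournament -/

/-- The probability that the player at position `p` wins the subtournament of height `k` on the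
positions `m, …, m + 2 ^ k - 1`, when the position `p` beats the position `q` with probability
`Q p q`. Only meant for `p` in this block. It is a polynomial in the entries of `Q` with integer
coefficients, so it makes sense over every commutative ring. -/
def blockWin {R : Type*} [CommRing R] (Q : ℕ → ℕ → R) : ℕ → ℕ → ℕ → R
  | 0, _, _ => 1
  | k + 1, m, p =>
    if p < m + 2 ^ k then
      blockWin Q k m p *
        ∑ q ∈ Finset.Ico (m + 2 ^ k) (m + 2 ^ k + 2 ^ k), blockWin Q k (m + 2 ^ k) q * Q p q
    else
      blockWin Q k (m + 2 ^ k) p * ∑ q ∈ Finset.Ico m (m + 2 ^ k), blockWin Q k m q * Q p q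

/-- The expectation of `W` at the winner of the block of height `k` that starts at `m`. -/
def blockValue {R : Type*} [CommRing R] (Q : ℕ → ℕ → R) (k m : ℕ) (W : ℕ → R) : R :=
  ∑ p ∈ Finset.Ico m (m + 2 ^ k), blockWin Q k m p * W p

/-- `Q` with the match between `a` and `b` replaced by an `(x, 1 - x)` match; this is `setMatch`
for an arbitrary index type and coefficient ring. -/
def replaceMatch {ι R : Type*} [DecidableEq ι] [CommRing R] (Q : ι → ι → R) (a b : ι) (x : R) :
    ι → ι → R :=
  fun c d => if c = a ∧ d = b then x else if c = b ∧ d = a then 1 - x else Q c d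

lemma replaceMatch_swap {ι R : Type*} [DecidableEq ι] [CommRing R] (Q : ι → ι → R) {a b : ι}
    (hab : a ≠ b) (x : R) : replaceMatch Q a b x = replaceMatch Q b a (1 - x) := by
  funext c d
  unfold replaceMatch
  split_ifs <;> simp_all

lemma replaceMatch_of_not {ι R : Type*} [DecidableEq ι] [CommRing R] (Q : ι → ι → R) {a b : ι}
    (x : R) {c d : ι} (h : ¬ (c = a ∧ d = b)) (h' : ¬ (c = b ∧ d = a)) :
    replaceMatch Q a b x c d = Q c d := by
  simp [replaceMatch, h, h']

lemma replaceMatch_left {ι R : Type*} [DecidableEq ι] [CommRing R] (Q : ι → ι → R) (a b : ι)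
    (x : R) : replaceMatch Q a b x a b = x := by
  simp [replaceMatch]

lemma replaceMatch_right {ι R : Type*} [DecidableEq ι] [CommRing R] (Q : ι → ι → R) {a b : ι}
    (hab : a ≠ b) (x : R) : replaceMatch Q a b x b a = 1 - x := by
  simp [replaceMatch, hab.symm]

lemma blockWin_congr {R : Type*} [CommRing R] {Q Q' : ℕ → ℕ → R} (k : ℕ) :
    ∀ m, (∀ p ∈ Finset.Ico m (m + 2 ^ k), ∀ q ∈ Finset.Ico m (m + 2 ^ k), p ≠ q →
      Q p q = Q' p q) → ∀ p ∈ Finset.Ico m (m + 2 ^ k), blockWin Q k m p = blockWin Q' k m p := by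
  induction k with
  | zero => intros; rfl
  | succ k ih =>
    intro m h p hp
    simp only [Finset.mem_Ico, pow_succ, mul_two] at h hp
    have hL := ih m (fun p hp q hq hne => by
      simp only [Finset.mem_Ico] at hp hq
      exact h p (by omega) q (by omega) hne)
    have hR := ih (m + 2 ^ k) (fun p hp q hq hne => by
      simp only [Finset.mem_Ico] at hp hq
      exact h p (by omega) q (by omega) hne)
    simp only [Finset.mem_Ico] at hL hR
    unfold blockWin
    split_ifs with hc
    · rw [hL p (by omega)]
      congr 1
      refine Finset.sum_congr rfl fun q hq => ?_
      simp only [Finset.mem_Ico] at hq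
      rw [hR q hq, h p (by omega) q (by omega) (by omega)]
    · rw [hR p (by omega)]
      congr 1
      refine Finset.sum_congr rfl fun q hq => ?_
      simp only [Finset.mem_Ico] at hq
      rw [hL q hq, h p (by omega) q (by omega) (by omega)]

lemma blockWin_map {R S : Type*} [CommRing R] [CommRing S] (f : R →+* S) (Q : ℕ → ℕ → R)
    (k m p : ℕ) : f (blockWin Q k m p) = blockWin (fun p q => f (Q p q)) k m p := by
  induction k generalizing m p with
  | zero => simp [blockWin]
  | succ k ih =>
    unfold blockWin
    split_ifs <;> simp [ih]

/-- The matches between the left and the right half of a block. -/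
lemma blockValue_succ {R : Type*} [CommRing R] (Q : ℕ → ℕ → R) (k m : ℕ) (W : ℕ → R) :
    blockValue Q (k + 1) m W =
      ∑ p ∈ Finset.Ico m (m + 2 ^ k), ∑ q ∈ Finset.Ico (m + 2 ^ k) (m + 2 ^ k + 2 ^ k),
        blockWin Q k m p * blockWin Q k (m + 2 ^ k) q * (Q p q * W p + Q q p * W q) := by
  unfold blockValue
  rw [pow_succ, mul_two, ← add_assoc,
    ← Finset.sum_Ico_consecutive _ (Nat.le_add_right m (2 ^ k)) (Nat.le_add_right _ (2 ^ k))]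
  have h1 : ∀ p ∈ Finset.Ico m (m + 2 ^ k), blockWin Q (k + 1) m p * W p =
      ∑ q ∈ Finset.Ico (m + 2 ^ k) (m + 2 ^ k + 2 ^ k),
        blockWin Q k m p * blockWin Q k (m + 2 ^ k) q * (Q p q * W p) := by
    intro p hp
    rw [Finset.mem_Ico] at hp
    rw [blockWin, if_pos hp.2, mul_assoc, Finset.sum_mul, Finset.mul_sum]
    exact Finset.sum_congr rfl fun q _ => by ring
  have h2 : ∀ q ∈ Finset.Ico (m + 2 ^ k) (m + 2 ^ k + 2 ^ k), blockWin Q (k + 1) m q * W q =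
      ∑ p ∈ Finset.Ico m (m + 2 ^ k),
        blockWin Q k m p * blockWin Q k (m + 2 ^ k) q * (Q q p * W q) := by
    intro p hp
    rw [Finset.mem_Ico] at hp
    rw [blockWin, if_neg (by omega), mul_assoc, Finset.sum_mul, Finset.mul_sum]
    exact Finset.sum_congr rfl fun q _ => by ring
  rw [Finset.sum_congr rfl h1, Finset.sum_congr rfl h2, Finset.sum_comm (s := Finset.Ico (m + 2 ^ k) _),
    ← Finset.sum_add_distrib]
  refine Finset.sum_congr rfl fun p _ => ?_
  rw [← Finset.sum_add_distrib]
  exact Finset.sum_congr rfl fun q _ => by ring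

/-- The value of a block of height `k + 1` for a winner `p` of its left half. -/
def leftValue {R : Type*} [CommRing R] (Q : ℕ → ℕ → R) (k m : ℕ) (W : ℕ → R) (p : ℕ) : R :=
  ∑ q ∈ Finset.Ico (m + 2 ^ k) (m + 2 ^ k + 2 ^ k),
    blockWin Q k (m + 2 ^ k) q * (Q p q * W p + Q q p * W q)

/-- The value of a block of height `k + 1` for a winner `q` of its right half. -/
def rightValue {R : Type*} [CommRing R] (Q : ℕ → ℕ → R) (k m : ℕ) (W : ℕ → R) (q : ℕ) : R :=
  ∑ p ∈ Finset.Ico m (m + 2 ^ k), blockWin Q k m p * (Q p q * W p + Q q p * W q)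

lemma blockValue_succ_left {R : Type*} [CommRing R] (Q : ℕ → ℕ → R) (k m : ℕ) (W : ℕ → R) :
    blockValue Q (k + 1) m W = blockValue Q k m (leftValue Q k m W) := by
  rw [blockValue_succ, blockValue]
  refine Finset.sum_congr rfl fun p _ => ?_
  rw [leftValue, Finset.mul_sum]
  exact Finset.sum_congr rfl fun q _ => by ring

lemma blockValue_succ_right {R : Type*} [CommRing R] (Q : ℕ → ℕ → R) (k m : ℕ) (W : ℕ → R) :
    blockValue Q (k + 1) m W = blockValue Q k (m + 2 ^ k) (rightValue Q k m W) := by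
  rw [blockValue_succ, blockValue, Finset.sum_comm]
  refine Finset.sum_congr rfl fun p _ => ?_
  rw [rightValue, Finset.mul_sum]
  exact Finset.sum_congr rfl fun q _ => by ring

lemma blockValue_congr {R : Type*} [CommRing R] {Q Q' : ℕ → ℕ → R} {k m : ℕ} {W W' : ℕ → R}
    (h : ∀ p ∈ Finset.Ico m (m + 2 ^ k), ∀ q ∈ Finset.Ico m (m + 2 ^ k), p ≠ q → Q p q = Q' p q)
    (hW : ∀ p ∈ Finset.Ico m (m + 2 ^ k), W p = W' p) :
    blockValue Q k m W = blockValue Q' k m W' :=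
  Finset.sum_congr rfl fun p hp => by rw [blockWin_congr k m h p hp, hW p hp]

/-- A match only matters for a block that contains both of its players. -/
lemma blockWin_replaceMatch_of_not {R : Type*} [CommRing R] (Q : ℕ → ℕ → R) {a b : ℕ} (x : R)
    {k m : ℕ} (h : ¬ (a ∈ Finset.Ico m (m + 2 ^ k) ∧ b ∈ Finset.Ico m (m + 2 ^ k))) {p : ℕ}
    (hp : p ∈ Finset.Ico m (m + 2 ^ k)) :
    blockWin (replaceMatch Q a b x) k m p = blockWin Q k m p := by
  refine blockWin_congr k m (fun p hp q hq _ => replaceMatch_of_not Q x ?_ ?_) p hp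
  · rintro ⟨rfl, rfl⟩; exact h ⟨hp, hq⟩
  · rintro ⟨rfl, rfl⟩; exact h ⟨hq, hp⟩

/-- A match within the left half. -/
lemma blockValue_replaceMatch_left {R : Type*} [CommRing R] (Q : ℕ → ℕ → R) {a b k m : ℕ}
    (ha : a ∈ Finset.Ico m (m + 2 ^ k)) (hb : b ∈ Finset.Ico m (m + 2 ^ k)) (x : R) (W : ℕ → R) :
    blockValue (replaceMatch Q a b x) (k + 1) m W =
      blockValue (replaceMatch Q a b x) k m (leftValue Q k m W) := by
  rw [blockValue_succ_left]
  refine blockValue_congr (fun _ _ _ _ _ => rfl) fun p hp => ?_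
  refine Finset.sum_congr rfl fun q hq => ?_
  simp only [Finset.mem_Ico] at *
  rw [blockWin_replaceMatch_of_not Q x (by simp only [Finset.mem_Ico]; omega)
    (Finset.mem_Ico.2 hq), replaceMatch_of_not, replaceMatch_of_not] <;> omega

/-- A match within the right half. -/
lemma blockValue_replaceMatch_right {R : Type*} [CommRing R] (Q : ℕ → ℕ → R) {a b k m : ℕ}
    (ha : a ∈ Finset.Ico (m + 2 ^ k) (m + 2 ^ k + 2 ^ k))
    (hb : b ∈ Finset.Ico (m + 2 ^ k) (m + 2 ^ k + 2 ^ k)) (x : R) (W : ℕ → R) :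
    blockValue (replaceMatch Q a b x) (k + 1) m W =
      blockValue (replaceMatch Q a b x) k (m + 2 ^ k) (rightValue Q k m W) := by
  rw [blockValue_succ_right]
  refine blockValue_congr (fun _ _ _ _ _ => rfl) fun p hp => ?_
  refine Finset.sum_congr rfl fun q hq => ?_
  simp only [Finset.mem_Ico] at *
  rw [blockWin_replaceMatch_of_not Q x (by simp only [Finset.mem_Ico]; omega)
    (Finset.mem_Ico.2 hq), replaceMatch_of_not, replaceMatch_of_not] <;> omega

/-- A match between the winners of the two halves. -/
lemma blockValue_replaceMatch_cross {R : Type*} [CommRing R] (Q : ℕ → ℕ → R) {a b k m : ℕ}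
    (ha : a ∈ Finset.Ico m (m + 2 ^ k)) (hb : b ∈ Finset.Ico (m + 2 ^ k) (m + 2 ^ k + 2 ^ k))
    (x y : R) (W : ℕ → R) :
    blockValue (replaceMatch Q a b x) (k + 1) m W - blockValue (replaceMatch Q a b y) (k + 1) m W =
      (x - y) * (blockWin Q k m a * blockWin Q k (m + 2 ^ k) b * (W a - W b)) := by
  have hne : a ≠ b := by
    simp only [Finset.mem_Ico] at ha hb; omega
  rw [blockValue_succ, blockValue_succ, ← Finset.sum_sub_distrib, Finset.sum_eq_single_of_mem a ha,
    ← Finset.sum_sub_distrib, Finset.sum_eq_single_of_mem b hb]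
  all_goals simp only [Finset.mem_Ico] at ha hb
  · rw [blockWin_replaceMatch_of_not, blockWin_replaceMatch_of_not, blockWin_replaceMatch_of_not,
      blockWin_replaceMatch_of_not, replaceMatch_left, replaceMatch_left,
      replaceMatch_right Q hne, replaceMatch_right Q hne]
    · ring
    all_goals simp only [Finset.mem_Ico]; omega
  · intro q hq hqb
    simp only [Finset.mem_Ico] at hq
    rw [blockWin_replaceMatch_of_not, blockWin_replaceMatch_of_not, blockWin_replaceMatch_of_not,
      blockWin_replaceMatch_of_not, replaceMatch_of_not, replaceMatch_of_not,
      replaceMatch_of_not, replaceMatch_of_not]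
    · ring
    all_goals (try simp only [Finset.mem_Ico]); omega
  · intro p hp hpa
    simp only [Finset.mem_Ico] at hp
    rw [← Finset.sum_sub_distrib]
    refine Finset.sum_eq_zero fun q hq => ?_
    simp only [Finset.mem_Ico] at hq
    rw [blockWin_replaceMatch_of_not, blockWin_replaceMatch_of_not, blockWin_replaceMatch_of_not,
      blockWin_replaceMatch_of_not, replaceMatch_of_not, replaceMatch_of_not,
      replaceMatch_of_not, replaceMatch_of_not]
    · ring
    all_goals (try simp only [Finset.mem_Ico]); omega

/-- The slope of the value of a block in the probability that `a` beats `b`. -/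
def slope {R : Type*} [CommRing R] (Q : ℕ → ℕ → R) (k m : ℕ) (W : ℕ → R) (a b : ℕ) : R :=
  blockValue (replaceMatch Q a b 1) k m W - blockValue (replaceMatch Q a b 0) k m W

lemma slope_swap {R : Type*} [CommRing R] (Q : ℕ → ℕ → R) (k m : ℕ) (W : ℕ → R) {a b : ℕ}
    (hab : a ≠ b) : slope Q k m W b a = - slope Q k m W a b := by
  rw [slope, slope, replaceMatch_swap Q hab.symm 1, replaceMatch_swap Q hab.symm 0]
  simp

lemma slope_left {R : Type*} [CommRing R] (Q : ℕ → ℕ → R) {a b k m : ℕ}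
    (ha : a ∈ Finset.Ico m (m + 2 ^ k)) (hb : b ∈ Finset.Ico m (m + 2 ^ k)) (W : ℕ → R) :
    slope Q (k + 1) m W a b = slope Q k m (leftValue Q k m W) a b := by
  rw [slope, slope, blockValue_replaceMatch_left Q ha hb, blockValue_replaceMatch_left Q ha hb]

lemma slope_right {R : Type*} [CommRing R] (Q : ℕ → ℕ → R) {a b k m : ℕ}
    (ha : a ∈ Finset.Ico (m + 2 ^ k) (m + 2 ^ k + 2 ^ k))
    (hb : b ∈ Finset.Ico (m + 2 ^ k) (m + 2 ^ k + 2 ^ k)) (W : ℕ → R) :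
    slope Q (k + 1) m W a b = slope Q k (m + 2 ^ k) (rightValue Q k m W) a b := by
  rw [slope, slope, blockValue_replaceMatch_right Q ha hb, blockValue_replaceMatch_right Q ha hb]

lemma slope_cross {R : Type*} [CommRing R] (Q : ℕ → ℕ → R) {a b k m : ℕ}
    (ha : a ∈ Finset.Ico m (m + 2 ^ k)) (hb : b ∈ Finset.Ico (m + 2 ^ k) (m + 2 ^ k + 2 ^ k))
    (W : ℕ → R) :
    slope Q (k + 1) m W a b = blockWin Q k m a * blockWin Q k (m + 2 ^ k) b * (W a - W b) := by
  rw [slope, blockValue_replaceMatch_cross Q ha hb]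
  ring

/-- Two players can meet in one match only, so the value of a block is affine in each match. -/
lemma blockValue_replaceMatch_sub {R : Type*} [CommRing R] (Q : ℕ → ℕ → R) {a b : ℕ}
    (hab : a ≠ b) (x y : R) (k : ℕ) : ∀ (m : ℕ) (W : ℕ → R),
    blockValue (replaceMatch Q a b x) k m W - blockValue (replaceMatch Q a b y) k m W =
      (x - y) * slope Q k m W a b := by
  induction k with
  | zero => intro m W; simp [blockValue, slope, blockWin]
  | succ k ih =>
    intro m W
    by_cases hboth : a ∈ Finset.Ico m (m + 2 ^ (k + 1)) ∧ b ∈ Finset.Ico m (m + 2 ^ (k + 1))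
    · have hsplit : ∀ c, c ∈ Finset.Ico m (m + 2 ^ (k + 1)) → c ∈ Finset.Ico m (m + 2 ^ k) ∨
          c ∈ Finset.Ico (m + 2 ^ k) (m + 2 ^ k + 2 ^ k) := by
        intro c hc
        simp only [Finset.mem_Ico, pow_succ, mul_two] at *
        omega
      obtain ha | ha := hsplit a hboth.1 <;> obtain hb | hb := hsplit b hboth.2
      · rw [blockValue_replaceMatch_left Q ha hb, blockValue_replaceMatch_left Q ha hb,
          slope_left Q ha hb, ih]
      · rw [blockValue_replaceMatch_cross Q ha hb, slope_cross Q ha hb]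
      · rw [replaceMatch_swap Q hab x, replaceMatch_swap Q hab y,
          blockValue_replaceMatch_cross Q hb ha, slope_swap Q _ _ _ hab.symm,
          slope_cross Q hb ha]
        ring
      · rw [blockValue_replaceMatch_right Q ha hb, blockValue_replaceMatch_right Q ha hb,
          slope_right Q ha hb, ih]
    · have hc : ∀ z, blockValue (replaceMatch Q a b z) (k + 1) m W = blockValue Q (k + 1) m W :=
        fun z => Finset.sum_congr rfl fun p hp => by
          rw [blockWin_replaceMatch_of_not Q z hboth hp]
      rw [slope, hc, hc, hc, hc]
      ring

/-! ### The winning probability as a block value -/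

/-- The comparison matrix indexed by the positions of the draw instead of the players. Positions
are read modulo `2 ^ n`, only those below `2 ^ n` matter. -/
def byPosition {R : Type*} {n : ℕ} (P : Matrix (Fin (2 ^ n)) (Fin (2 ^ n)) R)
    (σ : Equiv.Perm (Fin (2 ^ n))) (p q : ℕ) : R :=
  P (σ (Fin.ofNat (2 ^ n) p)) (σ (Fin.ofNat (2 ^ n) q))

/-- The indicator function of a position. -/
def pointMass (R : Type*) [CommRing R] (i p : ℕ) : R := if p = i then 1 else 0

lemma blockValue_pointMass {R : Type*} [CommRing R] (Q : ℕ → ℕ → R) (k m i : ℕ) :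
    blockValue Q k m (pointMass R i) =
      if i ∈ Finset.Ico m (m + 2 ^ k) then blockWin Q k m i else 0 := by
  simp only [blockValue, pointMass, mul_ite, mul_one, mul_zero, Finset.sum_ite_eq']

lemma ofNat_val {n : ℕ} (x : Fin (2 ^ n)) : Fin.ofNat (2 ^ n) (x : ℕ) = x := by
  ext; simp

lemma val_ofNat {n p : ℕ} (hp : p < 2 ^ n) : ((Fin.ofNat (2 ^ n) p : Fin (2 ^ n)) : ℕ) = p := by
  simp [Nat.mod_eq_of_lt hp]

lemma byPosition_symm {R : Type*} {n : ℕ} (P : Matrix (Fin (2 ^ n)) (Fin (2 ^ n)) R)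
    (σ : Equiv.Perm (Fin (2 ^ n))) (a b : Fin (2 ^ n)) :
    byPosition P σ (σ.symm a) (σ.symm b) = P a b := by
  simp [byPosition]

lemma sum_players_eq_sum_positions {n : ℕ} (σ : Equiv.Perm (Fin (2 ^ n))) (f : ℕ → ℝ)
    (g : Fin (2 ^ n) → ℝ) {u v : ℕ} (hv : v ≤ 2 ^ n) :
    ∑ a, (if (σ.symm a : ℕ) ∈ Finset.Ico u v then f (σ.symm a) else 0) * g a =
      ∑ p ∈ Finset.Ico u v, f p * g (σ (Fin.ofNat (2 ^ n) p)) := by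
  rw [← Equiv.sum_comp σ]
  have h1 : ∀ x : Fin (2 ^ n), (if (σ.symm (σ x) : ℕ) ∈ Finset.Ico u v then f (σ.symm (σ x))
      else 0) * g (σ x) = (fun p : ℕ => if p ∈ Finset.Ico u v then
        f p * g (σ (Fin.ofNat (2 ^ n) p)) else 0) (x : ℕ) := by
    intro x
    simp only [Equiv.symm_apply_apply, ofNat_val, ite_mul, zero_mul]
  rw [Finset.sum_congr rfl fun x _ => h1 x, Fin.sum_univ_eq_sum_range (fun p : ℕ =>
    if p ∈ Finset.Ico u v then f p * g (σ (Fin.ofNat (2 ^ n) p)) else 0), ← Finset.sum_filter]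
  refine Finset.sum_congr ?_ fun _ _ => rfl
  ext p
  simp only [Finset.mem_filter, Finset.mem_range, Finset.mem_Ico]
  omega

lemma labelProb_eq_blockValue {n : ℕ} {P : Matrix (Fin (2 ^ n)) (Fin (2 ^ n)) ℝ}
    (hP : IsComparison P) (σ : Equiv.Perm (Fin (2 ^ n))) (k : ℕ) :
    ∀ m, m + 2 ^ k ≤ 2 ^ n → ∀ c, labelProb P σ k m c =
      blockValue (byPosition P σ) k m (pointMass ℝ (σ.symm c)) := by
  induction k with
  | zero =>
    intro m _ c
    simp [labelProb, blockValue, blockWin, pointMass, eq_comm]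
  | succ k ih =>
    intro m hm c
    rw [pow_succ, mul_two] at hm
    have hk := Nat.two_pow_pos k
    have hL : ∀ a, labelProb P σ k m a = _ := fun a =>
      (ih m (by omega) a).trans (blockValue_pointMass _ _ _ _)
    have hR : ∀ a, labelProb P σ k (m + 2 ^ k) a = _ := fun a =>
      (ih (m + 2 ^ k) (by omega) a).trans (blockValue_pointMass _ _ _ _)
    rw [labelProb, blockValue_succ]
    simp only [hL, hR, mul_assoc, ← Finset.mul_sum]
    rw [sum_players_eq_sum_positions σ (blockWin (byPosition P σ) k m) _ (by omega)]
    refine Finset.sum_congr rfl fun p hp => ?_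
    rw [sum_players_eq_sum_positions σ (blockWin (byPosition P σ) k (m + 2 ^ k)) _ (by omega)]
    congr 1
    refine Finset.sum_congr rfl fun q hq => ?_
    rw [Finset.mem_Ico] at hp hq
    obtain ⟨i, rfl⟩ := σ.surjective c
    congr 1
    have hpq : Fin.ofNat (2 ^ n) p ≠ Fin.ofNat (2 ^ n) q := fun h => by
      have := congrArg Fin.val h
      rw [val_ofNat (by omega), val_ofNat (by omega)] at this
      omega
    have hi : ∀ r < 2 ^ n, (Fin.ofNat (2 ^ n) r = i ↔ r = (i : ℕ)) := by
      intro r hr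
      rw [Fin.ext_iff, val_ofNat hr]
    have hs := (hP _ _ (σ.injective.ne hpq)).2.2
    simp only [matchProb, pointMass, byPosition, Equiv.symm_apply_apply, σ.injective.eq_iff,
      eq_comm (a := i), hi p (by omega), hi q (by omega)]
    split_ifs
    · omega
    · ring
    · linarith
    · ring

lemma winProb_eq_blockValue {n : ℕ} {P : Matrix (Fin (2 ^ n)) (Fin (2 ^ n)) ℝ}
    (hP : IsComparison P) (σ : Equiv.Perm (Fin (2 ^ n))) (i : Fin (2 ^ n)) :
    winProb i P σ = blockValue (byPosition P σ) n 0 (pointMass ℝ (σ.symm i)) :=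
  labelProb_eq_blockValue hP σ n 0 (by omega) i

lemma isComparison_setMatch {N : ℕ} {P : Matrix (Fin N) (Fin N) ℝ} (hP : IsComparison P)
    {a b : Fin N} (hab : a ≠ b) {x : ℝ} (h0 : 0 ≤ x) (h1 : x ≤ 1) :
    IsComparison (setMatch P a b x) := by
  intro c d hcd
  have := hP c d hcd
  by_cases h : c = a ∧ d = b
  · obtain ⟨rfl, rfl⟩ := h
    simp [setMatch, hcd.symm, h0, h1]
  by_cases h' : c = b ∧ d = a
  · obtain ⟨rfl, rfl⟩ := h'
    simp [setMatch, hcd, h0, h1]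
  · have e1 : setMatch P a b x c d = P c d := replaceMatch_of_not P x h h'
    have e2 : setMatch P a b x d c = P d c :=
      replaceMatch_of_not P x (fun e => h' e.symm) (fun e => h e.symm)
    rwa [e1, e2]

lemma byPosition_replaceMatch {R : Type*} [CommRing R] {n : ℕ}
    (P : Matrix (Fin (2 ^ n)) (Fin (2 ^ n)) R)
    (σ : Equiv.Perm (Fin (2 ^ n))) (a b : Fin (2 ^ n)) (x : R) {p q : ℕ} (hp : p < 2 ^ n)
    (hq : q < 2 ^ n) : byPosition (replaceMatch P a b x) σ p q =
      replaceMatch (byPosition P σ) (σ.symm a) (σ.symm b) x p q := by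
  have h : ∀ r < 2 ^ n, ∀ a, (σ (Fin.ofNat (2 ^ n) r) = a ↔ r = (σ.symm a : ℕ)) := by
    intro r hr a
    rw [← Equiv.eq_symm_apply, Fin.ext_iff, val_ofNat hr]
  simp only [byPosition, replaceMatch, h p hp, h q hq]

lemma winProb_setMatch {n : ℕ} {P : Matrix (Fin (2 ^ n)) (Fin (2 ^ n)) ℝ}
    (hP : IsComparison P) (σ : Equiv.Perm (Fin (2 ^ n))) (i : Fin (2 ^ n)) {a b : Fin (2 ^ n)}
    (hab : a ≠ b) {x : ℝ} (h0 : 0 ≤ x) (h1 : x ≤ 1) :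
    winProb i (setMatch P a b x) σ =
      blockValue (replaceMatch (byPosition P σ) (σ.symm a) (σ.symm b) x) n 0
        (pointMass ℝ (σ.symm i)) := by
  rw [winProb_eq_blockValue (isComparison_setMatch hP hab h0 h1)]
  refine blockValue_congr (fun p hp q hq _ => ?_) fun _ _ => rfl
  simp only [Finset.mem_Ico] at hp hq
  exact byPosition_replaceMatch P σ a b x (by omega) (by omega)

/-! ### Polynomials near zero -/

lemma eventually_eval_le_total (p q : ℝ[X]) :
    (∀ᶠ ε in 𝓝[>] (0 : ℝ), p.eval ε ≤ q.eval ε) ∨ ∀ᶠ ε in 𝓝[>] (0 : ℝ), q.eval ε ≤ p.eval ε := by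
  by_cases h : q - p = 0
  · left
    rw [sub_eq_zero.1 h]
    exact Eventually.of_forall fun _ => le_rfl
  obtain ⟨g, hg, hd⟩ := Polynomial.exists_eq_pow_rootMultiplicity_mul_and_not_dvd _ h 0
  set k := rootMultiplicity 0 (q - p)
  have hev : ∀ ε, q.eval ε - p.eval ε = ε ^ k * g.eval ε := by
    intro ε
    rw [← eval_sub, hg]
    simp
  rw [Polynomial.dvd_iff_isRoot, IsRoot.def] at hd
  have hc : Tendsto (fun ε => g.eval ε) (𝓝[>] 0) (𝓝 (g.eval 0)) :=
    (g.continuous.tendsto 0).mono_left nhdsWithin_le_nhds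
  rcases lt_or_gt_of_ne hd with hneg | hpos
  · right
    filter_upwards [hc.eventually (gt_mem_nhds hneg), self_mem_nhdsWithin] with ε h1 h2
    have := mul_nonpos_of_nonneg_of_nonpos (pow_nonneg (le_of_lt h2) k) h1.le
    linarith [hev ε]
  · left
    filter_upwards [hc.eventually (lt_mem_nhds hpos), self_mem_nhdsWithin] with ε h1 h2
    have := mul_nonneg (pow_nonneg (le_of_lt h2) k) h1.le
    linarith [hev ε]

/-- Among finitely many polynomials one is the smallest on an interval `(0, δ)`. -/
lemma exists_eventually_eval_le {ι : Type*} (s : Finset ι) (hs : s.Nonempty) (q : ι → ℝ[X]) :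
    ∃ j ∈ s, ∀ l ∈ s, ∀ᶠ ε in 𝓝[>] (0 : ℝ), (q j).eval ε ≤ (q l).eval ε := by
  classical
  induction hs using Finset.Nonempty.cons_induction with
  | singleton a => exact ⟨a, by simp, by simp⟩
  | cons a s ha hs ih =>
    obtain ⟨j, hj, hmin⟩ := ih
    rcases eventually_eval_le_total (q j) (q a) with h | h
    · refine ⟨j, by simp [hj], fun l hl => ?_⟩
      rcases Finset.mem_cons.1 hl with rfl | hl
      exacts [h, hmin l hl]
    · refine ⟨a, by simp, fun l hl => ?_⟩
      rcases Finset.mem_cons.1 hl with rfl | hl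
      · simp
      · filter_upwards [h, hmin l hl] with ε h1 h2 using h1.trans h2

lemma coeff_one_le_of_eventually_eval_le {p q : ℝ[X]} (h0 : p.coeff 0 = q.coeff 0)
    (h : ∀ᶠ ε in 𝓝[>] (0 : ℝ), p.eval ε ≤ q.eval ε) : p.coeff 1 ≤ q.coeff 1 := by
  have hc : Tendsto (fun ε => (divX (q - p)).eval ε) (𝓝[>] 0) (𝓝 ((divX (q - p)).eval 0)) :=
    ((divX (q - p)).continuous.tendsto 0).mono_left nhdsWithin_le_nhds
  have hnn : 0 ≤ (divX (q - p)).eval 0 := by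
    refine ge_of_tendsto hc ?_
    filter_upwards [h, self_mem_nhdsWithin] with ε h1 h2
    have h3 := congrArg (eval ε) (divX_mul_X_add (q - p))
    simp only [coeff_sub, h0, sub_self, map_zero, add_zero, eval_mul, eval_X, eval_sub] at h3
    exact nonneg_of_mul_nonneg_left (by rw [h3]; linarith) (Set.mem_Ioi.1 h2)
  rw [← coeff_zero_eq_eval_zero, coeff_divX] at hnn
  simpa using hnn

lemma eq_of_eventually_eval_eq {p q : ℝ[X]}
    (h : ∀ᶠ ε in 𝓝[>] (0 : ℝ), p.eval ε = q.eval ε) : p = q := by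
  refine Polynomial.eq_of_infinite_eval_eq p q ?_
  obtain ⟨δ, hδ, hsub⟩ := mem_nhdsGT_iff_exists_Ioo_subset.1 h
  exact (Set.Ioo_infinite hδ).mono hsub

lemma firstOrderDrop_eq_of_isDropPolynomial {n : ℕ} {i : Fin (2 ^ n)}
    {P : Matrix (Fin (2 ^ n)) (Fin (2 ^ n)) ℝ} {σ : Equiv.Perm (Fin (2 ^ n))} {p : ℝ[X]}
    (hp : IsDropPolynomial i P σ p) (ε : ℝ) : firstOrderDrop i P σ ε = p.coeff 1 * ε := by
  have h : ∃ p : ℝ[X], IsDropPolynomial i P σ p := ⟨p, hp⟩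
  rw [firstOrderDrop, dif_pos h]
  have : h.choose = p := eq_of_eventually_eval_eq
    ((h.choose_spec.and hp).mono fun ε hε => hε.1.symm.trans hε.2)
  rw [this]

/-! ### Multi-affine functions on boxes -/

/-- A function that is affine in each coordinate takes its minimum over a box at a vertex: the
coordinates can be moved to an end of their interval one after the other. -/
lemma exists_vertex_le {ι : Type*} [DecidableEq ι] (f : (ι → ℝ) → ℝ) (l u : ι → ℝ) (s : Finset ι)
    (hf : ∀ j ∈ s, ∀ x, ∃ c, ∀ t t', f (Function.update x j t) - f (Function.update x j t') =
      (t - t') * c)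
    (x : ι → ℝ) (hl : ∀ j ∈ s, l j ≤ x j) (hu : ∀ j ∈ s, x j ≤ u j) :
    ∃ S ⊆ s, f (fun j => if j ∈ s then (if j ∈ S then u j else l j) else x j) ≤ f x := by
  induction s using Finset.induction_on with
  | empty => exact ⟨∅, by simp⟩
  | insert a s ha ih =>
    obtain ⟨S, hS, hle⟩ := ih (fun j hj => hf j (Finset.mem_insert_of_mem hj))
      (fun j hj => hl j (Finset.mem_insert_of_mem hj))
      (fun j hj => hu j (Finset.mem_insert_of_mem hj))
    set y : ι → ℝ := fun j => if j ∈ s then (if j ∈ S then u j else l j) else x j with hy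
    obtain ⟨c, hc⟩ := hf a (Finset.mem_insert_self a s) y
    have hya : Function.update y a (x a) = y := by
      rw [Function.update_eq_self_iff]; simp [hy, ha]
    have haS : a ∉ S := fun h => ha (hS h)
    have hla := hl a (Finset.mem_insert_self a s)
    have hua := hu a (Finset.mem_insert_self a s)
    rcases le_total c 0 with h | h
    · refine ⟨insert a S, Finset.insert_subset_insert a hS, le_trans ?_ hle⟩
      have h1 := hc (u a) (x a)
      rw [hya] at h1
      have h2 : (fun j => if j ∈ insert a s then (if j ∈ insert a S then u j else l j) else x j) =
          Function.update y a (u a) := by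
        funext j
        by_cases hj : j = a
        · subst hj; simp
        · simp [hy, hj]
      rw [h2]
      have := mul_nonpos_of_nonneg_of_nonpos (sub_nonneg.2 hua) h
      linarith
    · refine ⟨S, hS.trans (Finset.subset_insert a s), le_trans ?_ hle⟩
      have h1 := hc (l a) (x a)
      rw [hya] at h1
      have h2 : (fun j => if j ∈ insert a s then (if j ∈ S then u j else l j) else x j) =
          Function.update y a (l a) := by
        funext j
        by_cases hj : j = a
        · subst hj; simp [haS]
        · simp [hy, hj]
      rw [h2]
      have := mul_nonpos_of_nonpos_of_nonneg (sub_nonpos.2 hla) h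
      linarith

/-- The comparison matrix with the entries `x (p, q)` for `p < q`. -/
def ofUpper {R : Type*} [CommRing R] (x : ℕ × ℕ → R) (p q : ℕ) : R :=
  if p < q then x (p, q) else 1 - x (q, p)

lemma ofUpper_update {R : Type*} [CommRing R] (x : ℕ × ℕ → R) {a b : ℕ} (hab : a < b) (t : R) :
    ofUpper (Function.update x (a, b) t) = replaceMatch (ofUpper x) a b t := by
  funext p q
  simp only [ofUpper, replaceMatch, Function.update_apply, Prod.mk.injEq]
  split_ifs <;> first | rfl | omega

lemma blockValue_ofUpper_update_sub {R : Type*} [CommRing R] (x : ℕ × ℕ → R) {a b : ℕ}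
    (hab : a < b) (t t' : R) (k m : ℕ) (W : ℕ → R) :
    blockValue (ofUpper (Function.update x (a, b) t)) k m W -
      blockValue (ofUpper (Function.update x (a, b) t')) k m W =
      (t - t') * slope (ofUpper x) k m W a b := by
  rw [ofUpper_update x hab, ofUpper_update x hab, blockValue_replaceMatch_sub _ hab.ne]

lemma blockValue_map {R S : Type*} [CommRing R] [CommRing S] (f : R →+* S) (Q : ℕ → ℕ → R)
    (k m : ℕ) (W : ℕ → R) :
    f (blockValue Q k m W) = blockValue (fun p q => f (Q p q)) k m (fun p => f (W p)) := by
  simp [blockValue, blockWin_map]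

lemma slope_map {R S : Type*} [CommRing R] [CommRing S] (f : R →+* S) (Q : ℕ → ℕ → R)
    (k m : ℕ) (W : ℕ → R) (a b : ℕ) :
    f (slope Q k m W a b) = slope (fun p q => f (Q p q)) k m (fun p => f (W p)) a b := by
  have h : ∀ x : R, (fun p q => f (replaceMatch Q a b x p q)) =
      replaceMatch (fun p q => f (Q p q)) a b (f x) := by
    intro x
    funext p q
    simp only [replaceMatch, apply_ite f, map_sub, map_one]
  rw [slope, slope, map_sub, blockValue_map, blockValue_map, h, h, map_one, map_zero]

lemma map_ofUpper {R S : Type*} [CommRing R] [CommRing S] (f : R →+* S) (x : ℕ × ℕ → R) :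
    (fun p q => f (ofUpper x p q)) = ofUpper (fun j => f (x j)) := by
  funext p q
  simp only [ofUpper, apply_ite f, map_sub, map_one]

/-- The value of a block along the line through `x` in the direction `s` restricted to `T`. -/
def linePoly (x s : ℕ × ℕ → ℝ) (k m : ℕ) (W : ℕ → ℝ) (T : Finset (ℕ × ℕ)) : ℝ[X] :=
  blockValue (ofUpper fun j => C (x j) + if j ∈ T then X * C (s j) else 0) k m (fun p => C (W p))

lemma eval_linePoly (x s : ℕ × ℕ → ℝ) (k m : ℕ) (W : ℕ → ℝ) (T : Finset (ℕ × ℕ)) (ε : ℝ) :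
    (linePoly x s k m W T).eval ε =
      blockValue (ofUpper fun j => x j + if j ∈ T then ε * s j else 0) k m W := by
  rw [linePoly, ← coe_evalRingHom, blockValue_map, map_ofUpper]
  simp only [coe_evalRingHom, eval_add, eval_C, apply_ite (eval ε), eval_mul, eval_X, eval_zero]

/-- The derivative along a line is the sum of the partial derivatives: change the coordinates one
after the other. -/
lemma coeff_one_linePoly (x s : ℕ × ℕ → ℝ) (k m : ℕ) (W : ℕ → ℝ) (T : Finset (ℕ × ℕ))
    (hT : ∀ j ∈ T, j.1 < j.2) :
    (linePoly x s k m W T).coeff 1 = ∑ j ∈ T, s j * slope (ofUpper x) k m W j.1 j.2 := by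
  induction T using Finset.induction_on with
  | empty =>
    have : linePoly x s k m W ∅ = C (blockValue (ofUpper x) k m W) := by
      rw [linePoly, blockValue_map, map_ofUpper]
      simp
    simp [this]
  | insert j T hj ih =>
    set y : ℕ × ℕ → ℝ[X] := fun j => C (x j) + if j ∈ T then X * C (s j) else 0 with hy
    have h1 : (fun l => C (x l) + if l ∈ insert j T then X * C (s l) else 0) =
        Function.update y j (C (x j) + X * C (s j)) := by
      funext l
      by_cases hl : l = j
      · subst hl; simp
      · simp [hy, hl]
    have h2 : Function.update y j (C (x j)) = y := by
      rw [Function.update_eq_self_iff]; simp [hy, hj]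
    have h3 := blockValue_ofUpper_update_sub y (hT j (Finset.mem_insert_self j T))
      (C (x j) + X * C (s j)) (C (x j)) k m (fun p => C (W p))
    rw [Prod.mk.eta, ← h1, h2, add_sub_cancel_left] at h3
    have h4 : (slope (ofUpper y) k m (fun p => C (W p)) j.1 j.2).coeff 0 =
        slope (ofUpper x) k m W j.1 j.2 := by
      rw [coeff_zero_eq_eval_zero, ← coe_evalRingHom, slope_map, map_ofUpper]
      simp [hy, apply_ite (eval (0 : ℝ))]
    have h5 : linePoly x s k m W (insert j T) = linePoly x s k m W T +
        X * (C (s j) * slope (ofUpper y) k m (fun p => C (W p)) j.1 j.2) := by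
      rw [← mul_assoc, ← h3, linePoly, linePoly]
      ring
    rw [h5, coeff_add, ih fun l hl => hT l (Finset.mem_insert_of_mem hl), Finset.sum_insert hj,
      coeff_X_mul, coeff_C_mul, h4]
    ring

/-! ### The drop for small perturbations -/

/-- The pairs `p < q` of positions below `N`. -/
def pairsBelow (N : ℕ) : Finset (ℕ × ℕ) :=
  (Finset.range N ×ˢ Finset.range N).filter fun j => j.1 < j.2

lemma mem_pairsBelow {N : ℕ} {j : ℕ × ℕ} : j ∈ pairsBelow N ↔ j.1 < j.2 ∧ j.2 < N := by
  simp only [pairsBelow, Finset.mem_filter, Finset.mem_product, Finset.mem_range]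
  omega

/-- How fast an entry `p` can shrink under an `ε`-perturbation. -/
def downRate (p : ℝ) : ℝ := if p = 0 then 0 else 1

/-- How fast an entry `p` can grow under an `ε`-perturbation. -/
def upRate (p : ℝ) : ℝ := if p = 1 then 0 else 1

lemma neg_matchDrop_le (p α : ℝ) :
    -matchDrop p α ≤ upRate p * α ∧ -matchDrop p α ≤ -downRate p * α := by
  unfold matchDrop upRate downRate
  split_ifs with h h' h'
  · norm_num [h] at h'
  · constructor
    · linarith [le_max_left (-α) 0]
    · linarith [le_max_right (-α) 0]
  · constructor
    · linarith [le_max_right α 0]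
    · linarith [le_max_left α 0]
  · constructor
    · linarith [neg_abs_le α]
    · linarith [le_abs_self α]

lemma neg_matchDrop_eq (p α : ℝ) :
    -matchDrop p α = if α < 0 then upRate p * α else -downRate p * α := by
  unfold matchDrop upRate downRate
  rcases lt_or_ge α 0 with h | h
  · rw [max_eq_left (show 0 ≤ -α by linarith), max_eq_right h.le, abs_of_neg h, if_pos h]
    split_ifs <;> linarith
  · rw [max_eq_right (show -α ≤ 0 by linarith), max_eq_left h, abs_of_nonneg h, if_neg h.not_gt]
    split_ifs <;> linarith

lemma winProb_eq_blockValue_ofUpper {n : ℕ} {P : Matrix (Fin (2 ^ n)) (Fin (2 ^ n)) ℝ}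
    (hP : IsComparison P) (σ : Equiv.Perm (Fin (2 ^ n))) (i : Fin (2 ^ n)) {x : ℕ × ℕ → ℝ}
    (hx : ∀ j ∈ pairsBelow (2 ^ n), x j = byPosition P σ j.1 j.2) :
    winProb i P σ = blockValue (ofUpper x) n 0 (pointMass ℝ (σ.symm i)) := by
  rw [winProb_eq_blockValue hP]
  refine blockValue_congr (fun p hp q hq hpq => ?_) fun _ _ => rfl
  simp only [Finset.mem_Ico, zero_add] at hp hq
  unfold ofUpper
  split_ifs with h
  · rw [hx (p, q) (mem_pairsBelow.2 ⟨h, hq.2⟩)]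
  · rw [hx (q, p) (mem_pairsBelow.2 ⟨by dsimp only; omega, hp.2⟩)]
    have hne : σ (Fin.ofNat (2 ^ n) p) ≠ σ (Fin.ofNat (2 ^ n) q) := by
      rw [σ.injective.ne_iff, Ne, Fin.ext_iff, val_ofNat hp.2, val_ofNat hq.2]
      exact hpq
    exact eq_sub_of_add_eq (hP _ _ hne).2.2

/-- A vertex of the box of perturbations: the entries in `S` grow and the other ones shrink, as
fast as possible. -/
def vertexRate (Q : ℕ → ℕ → ℝ) (S : Finset (ℕ × ℕ)) (j : ℕ × ℕ) : ℝ :=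
  if j ∈ S then upRate (Q j.1 j.2) else -downRate (Q j.1 j.2)

/-- The winning probability at a vertex of the box, as a polynomial in `ε`. -/
def vertexPoly {n : ℕ} (i : Fin (2 ^ n)) (P : Matrix (Fin (2 ^ n)) (Fin (2 ^ n)) ℝ)
    (σ : Equiv.Perm (Fin (2 ^ n))) (S : Finset (ℕ × ℕ)) : ℝ[X] :=
  linePoly (fun j => byPosition P σ j.1 j.2) (vertexRate (byPosition P σ) S) n 0
    (pointMass ℝ (σ.symm i)) (pairsBelow (2 ^ n))

lemma slope_ofUpper_byPosition {n : ℕ} {P : Matrix (Fin (2 ^ n)) (Fin (2 ^ n)) ℝ}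
    (hP : IsComparison P) (σ : Equiv.Perm (Fin (2 ^ n))) (W : ℕ → ℝ) (a b : ℕ) :
    slope (ofUpper fun j => byPosition P σ j.1 j.2) n 0 W a b =
      slope (byPosition P σ) n 0 W a b := by
  have h : ∀ p ∈ Finset.Ico 0 (0 + 2 ^ n), ∀ q ∈ Finset.Ico 0 (0 + 2 ^ n), p ≠ q →
      ofUpper (fun j => byPosition P σ j.1 j.2) p q = byPosition P σ p q := by
    intro p hp q hq hpq
    simp only [Finset.mem_Ico, zero_add] at hp hq
    unfold ofUpper
    split_ifs with h
    · rfl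
    · have hne : σ (Fin.ofNat (2 ^ n) p) ≠ σ (Fin.ofNat (2 ^ n) q) := by
        rw [σ.injective.ne_iff, Ne, Fin.ext_iff, val_ofNat hp.2, val_ofNat hq.2]
        exact hpq
      exact (eq_sub_of_add_eq (hP _ _ hne).2.2).symm
  have h' : ∀ x, blockValue (replaceMatch (ofUpper fun j => byPosition P σ j.1 j.2) a b x) n 0 W =
      blockValue (replaceMatch (byPosition P σ) a b x) n 0 W := by
    intro x
    refine blockValue_congr (fun p hp q hq hpq => ?_) fun _ _ => rfl
    simp only [replaceMatch, h p hp q hq hpq]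
  rw [slope, slope, h', h']

lemma coeff_one_vertexPoly {n : ℕ} {P : Matrix (Fin (2 ^ n)) (Fin (2 ^ n)) ℝ}
    (hP : IsComparison P) (σ : Equiv.Perm (Fin (2 ^ n))) (i : Fin (2 ^ n))
    (S : Finset (ℕ × ℕ)) :
    (vertexPoly i P σ S).coeff 1 = ∑ j ∈ pairsBelow (2 ^ n), vertexRate (byPosition P σ) S j *
      slope (byPosition P σ) n 0 (pointMass ℝ (σ.symm i)) j.1 j.2 := by
  rw [vertexPoly, coeff_one_linePoly _ _ _ _ _ _ fun j hj => (mem_pairsBelow.1 hj).1]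
  simp only [slope_ofUpper_byPosition hP]

lemma coeff_zero_vertexPoly {n : ℕ} {P : Matrix (Fin (2 ^ n)) (Fin (2 ^ n)) ℝ}
    (hP : IsComparison P) (σ : Equiv.Perm (Fin (2 ^ n))) (i : Fin (2 ^ n))
    (S : Finset (ℕ × ℕ)) : (vertexPoly i P σ S).coeff 0 = winProb i P σ := by
  rw [coeff_zero_eq_eval_zero, vertexPoly, eval_linePoly,
    winProb_eq_blockValue_ofUpper hP σ i (x := fun j => byPosition P σ j.1 j.2) fun _ _ => rfl]
  simp

lemma byPosition_mem {n : ℕ} {P : Matrix (Fin (2 ^ n)) (Fin (2 ^ n)) ℝ}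
    (hP : IsComparison P) (σ : Equiv.Perm (Fin (2 ^ n))) {p q : ℕ} (hp : p < 2 ^ n)
    (hq : q < 2 ^ n) (hpq : p ≠ q) :
    0 ≤ byPosition P σ p q ∧ byPosition P σ p q ≤ 1 ∧
      byPosition P σ p q + byPosition P σ q p = 1 := by
  refine hP _ _ ?_
  rw [σ.injective.ne_iff, Ne, Fin.ext_iff, val_ofNat hp, val_ofNat hq]
  exact hpq

/-- The vertices of the box are perturbations, as long as `ε` does not exceed the positive
entries. -/
lemma eval_vertexPoly_mem {n : ℕ} {P : Matrix (Fin (2 ^ n)) (Fin (2 ^ n)) ℝ}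
    (hP : IsComparison P) (σ : Equiv.Perm (Fin (2 ^ n))) (i : Fin (2 ^ n))
    (S : Finset (ℕ × ℕ)) {ε : ℝ} (hε : 0 < ε)
    (hlow : ∀ j ∈ pairsBelow (2 ^ n), byPosition P σ j.1 j.2 ≠ 0 → ε ≤ byPosition P σ j.1 j.2)
    (hupp : ∀ j ∈ pairsBelow (2 ^ n), byPosition P σ j.1 j.2 ≠ 1 →
      byPosition P σ j.1 j.2 + ε ≤ 1) :
    (vertexPoly i P σ S).eval ε ∈ (fun P' => winProb i P' σ) '' perturbations P ε := by
  set Q := byPosition P σ with hQ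
  set x : ℕ × ℕ → ℝ := fun j => Q j.1 j.2 +
    if j ∈ pairsBelow (2 ^ n) then ε * vertexRate Q S j else 0 with hx
  have hxj : ∀ j ∈ pairsBelow (2 ^ n), 0 ≤ x j ∧ x j ≤ 1 ∧ |Q j.1 j.2 - x j| ≤ ε := by
    intro j hj
    have hj' := mem_pairsBelow.1 hj
    have h := byPosition_mem hP σ (hj'.1.trans hj'.2) hj'.2 hj'.1.ne
    have h1 := hlow j hj
    have h2 := hupp j hj
    rw [← hQ] at h
    have hxe : x j = Q j.1 j.2 + ε * vertexRate Q S j := by rw [hx]; simp only [if_pos hj]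
    rw [hxe]
    unfold vertexRate upRate downRate
    split_ifs with c1 c2 c2
    · refine ⟨by linarith, by linarith, by simpa using hε.le⟩
    · refine ⟨by linarith, by linarith [h2 c2], ?_⟩
      rw [abs_le]; constructor <;> linarith
    · refine ⟨by linarith, by linarith, by simpa using hε.le⟩
    · refine ⟨by linarith [h1 c2], by linarith, ?_⟩
      rw [abs_le]; constructor <;> linarith
  let P' : Matrix (Fin (2 ^ n)) (Fin (2 ^ n)) ℝ := fun a b => ofUpper x (σ.symm a) (σ.symm b)
  have hP' : IsComparison P' := by
    intro a b hab
    have hne : (σ.symm a : ℕ) ≠ σ.symm b := by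
      rwa [Ne, ← Fin.ext_iff, σ.symm.injective.eq_iff]
    simp only [P', ofUpper]
    rcases lt_or_gt_of_ne hne with h | h
    · have := hxj (σ.symm a, σ.symm b) (mem_pairsBelow.2 ⟨h, (σ.symm b).2⟩)
      rw [if_pos h, if_neg (by omega)]
      refine ⟨this.1, this.2.1, by ring⟩
    · have := hxj (σ.symm b, σ.symm a) (mem_pairsBelow.2 ⟨h, (σ.symm a).2⟩)
      rw [if_pos h, if_neg (by omega)]
      refine ⟨by linarith, by linarith, by ring⟩
  refine ⟨P', ⟨hP', fun a b hab => ?_⟩, ?_⟩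
  · have hne : (σ.symm a : ℕ) ≠ σ.symm b := by
      rwa [Ne, ← Fin.ext_iff, σ.symm.injective.eq_iff]
    simp only [P', ofUpper]
    split_ifs with h
    · have := hxj (σ.symm a, σ.symm b) (mem_pairsBelow.2 ⟨h, (σ.symm b).2⟩)
      rw [← byPosition_symm P σ a b]
      exact this.2.2
    · have := hxj (σ.symm b, σ.symm a)
        (mem_pairsBelow.2 ⟨by dsimp only; omega, (σ.symm a).2⟩)
      have h3 : P a b = 1 - Q (σ.symm b) (σ.symm a) := by
        rw [hQ, byPosition_symm]; linarith [(hP a b hab).2.2]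
      rw [h3, abs_sub_comm, show ∀ u v : ℝ, 1 - u - (1 - v) = v - u by intros; ring]
      exact this.2.2
  · dsimp only
    rw [vertexPoly, eval_linePoly, winProb_eq_blockValue_ofUpper hP' σ i]
    intro j hj
    have hj' := mem_pairsBelow.1 hj
    simp only [byPosition, P', Equiv.symm_apply_apply]
    rw [val_ofNat (hj'.1.trans hj'.2), val_ofNat hj'.2, ofUpper, if_pos hj'.1]
    rfl

/-- Every perturbation wins at least as often as some vertex of the box. -/
lemma exists_eval_vertexPoly_le {n : ℕ} {P P' : Matrix (Fin (2 ^ n)) (Fin (2 ^ n)) ℝ}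
    (σ : Equiv.Perm (Fin (2 ^ n))) (i : Fin (2 ^ n))
    {ε : ℝ} (hP' : P' ∈ perturbations P ε) :
    ∃ S ⊆ pairsBelow (2 ^ n), (vertexPoly i P σ S).eval ε ≤ winProb i P' σ := by
  set Q := byPosition P σ with hQ
  set x : ℕ × ℕ → ℝ := fun j => byPosition P' σ j.1 j.2 with hx
  have hbd : ∀ j ∈ pairsBelow (2 ^ n), 0 ≤ x j ∧ x j ≤ 1 ∧ |Q j.1 j.2 - x j| ≤ ε := by
    intro j hj
    have hj' := mem_pairsBelow.1 hj
    have h := byPosition_mem hP'.1 σ (hj'.1.trans hj'.2) hj'.2 hj'.1.ne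
    refine ⟨h.1, h.2.1, hP'.2 _ _ ?_⟩
    rw [σ.injective.ne_iff, Ne, Fin.ext_iff, val_ofNat (hj'.1.trans hj'.2), val_ofNat hj'.2]
    exact hj'.1.ne
  obtain ⟨S, hS, hle⟩ := exists_vertex_le
    (fun x => blockValue (ofUpper x) n 0 (pointMass ℝ (σ.symm i)))
    (fun j => Q j.1 j.2 + ε * -downRate (Q j.1 j.2)) (fun j => Q j.1 j.2 + ε * upRate (Q j.1 j.2))
    (pairsBelow (2 ^ n))
    (fun j hj x => ⟨_, fun t t' =>
      blockValue_ofUpper_update_sub x (mem_pairsBelow.1 hj).1 t t' n 0 _⟩) x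
    (by
      intro j hj
      have h := hbd j hj
      have h2 := abs_le.1 h.2.2
      unfold downRate
      split_ifs with c
      · linarith
      · linarith)
    (by
      intro j hj
      have h := hbd j hj
      have h2 := abs_le.1 h.2.2
      unfold upRate
      split_ifs with c
      · linarith
      · linarith)
  refine ⟨S, hS, ?_⟩
  rw [winProb_eq_blockValue_ofUpper hP'.1 σ i (x := x) fun _ _ => rfl, vertexPoly, eval_linePoly]
  refine le_trans (le_of_eq ?_) hle
  refine blockValue_congr (fun p hp q hq hpq => ?_) fun _ _ => rfl
  simp only [Finset.mem_Ico, zero_add] at hp hq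
  simp only [ofUpper, vertexRate]
  by_cases h : p < q
  · have hm : (p, q) ∈ pairsBelow (2 ^ n) := mem_pairsBelow.2 ⟨h, hq.2⟩
    simp only [if_pos h, if_pos hm]
    split_ifs <;> rfl
  · have hm : (q, p) ∈ pairsBelow (2 ^ n) := mem_pairsBelow.2 ⟨by dsimp only; omega, hp.2⟩
    simp only [if_neg h, if_pos hm]
    split_ifs <;> rfl

/-- The drop is a polynomial for small `ε`, and its linear coefficient is the sum of the largest
first-order losses of the single matches. -/
lemma exists_isDropPolynomial {n : ℕ} {P : Matrix (Fin (2 ^ n)) (Fin (2 ^ n)) ℝ}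
    (hP : IsComparison P) (σ : Equiv.Perm (Fin (2 ^ n))) (i : Fin (2 ^ n)) :
    ∃ p : ℝ[X], IsDropPolynomial i P σ p ∧ p.coeff 0 = 0 ∧
      p.coeff 1 = ∑ j ∈ pairsBelow (2 ^ n), matchDrop (byPosition P σ j.1 j.2)
        (slope (byPosition P σ) n 0 (pointMass ℝ (σ.symm i)) j.1 j.2) := by
  classical
  set Q := byPosition P σ with hQ
  set α : ℕ × ℕ → ℝ := fun j => slope Q n 0 (pointMass ℝ (σ.symm i)) j.1 j.2 with hα
  obtain ⟨S, hS, hmin⟩ := exists_eventually_eval_le (pairsBelow (2 ^ n)).powerset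
    ⟨∅, by simp⟩ (vertexPoly i P σ)
  have hlow : ∀ᶠ ε in 𝓝[>] (0 : ℝ), ∀ j ∈ pairsBelow (2 ^ n), Q j.1 j.2 ≠ 0 → ε ≤ Q j.1 j.2 := by
    rw [eventually_all_finset]
    intro j hj
    have hj' := mem_pairsBelow.1 hj
    have h := byPosition_mem hP σ (hj'.1.trans hj'.2) hj'.2 hj'.1.ne
    rw [← hQ] at h
    by_cases hz : Q j.1 j.2 = 0
    · simp [hz]
    · have : 0 < Q j.1 j.2 := lt_of_le_of_ne h.1 (Ne.symm hz)
      filter_upwards [nhdsWithin_le_nhds (gt_mem_nhds this)] with ε hε _ using le_of_lt hε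
  have hupp : ∀ᶠ ε in 𝓝[>] (0 : ℝ), ∀ j ∈ pairsBelow (2 ^ n), Q j.1 j.2 ≠ 1 →
      Q j.1 j.2 + ε ≤ 1 := by
    rw [eventually_all_finset]
    intro j hj
    have hj' := mem_pairsBelow.1 hj
    have h := byPosition_mem hP σ (hj'.1.trans hj'.2) hj'.2 hj'.1.ne
    rw [← hQ] at h
    by_cases hz : Q j.1 j.2 = 1
    · simp [hz]
    · have : 0 < 1 - Q j.1 j.2 := sub_pos.2 (lt_of_le_of_ne h.2.1 hz)
      filter_upwards [nhdsWithin_le_nhds (gt_mem_nhds this)] with ε hε _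
      linarith
  have hmin' : ∀ᶠ ε in 𝓝[>] (0 : ℝ), ∀ T ∈ (pairsBelow (2 ^ n)).powerset,
      (vertexPoly i P σ S).eval ε ≤ (vertexPoly i P σ T).eval ε := by
    rw [eventually_all_finset]; exact hmin
  refine ⟨C (winProb i P σ) - vertexPoly i P σ S, ?_, ?_, ?_⟩
  · filter_upwards [hlow, hupp, hmin', self_mem_nhdsWithin] with ε h1 h2 h3 h4
    have hleast : IsLeast ((fun P' => winProb i P' σ) '' perturbations P ε)
        ((vertexPoly i P σ S).eval ε) := by
      refine ⟨eval_vertexPoly_mem hP σ i S h4 h1 h2, ?_⟩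
      rintro _ ⟨P', hP', rfl⟩
      obtain ⟨T, hT, hle⟩ := exists_eval_vertexPoly_le σ i hP'
      exact (h3 T (Finset.mem_powerset.2 hT)).trans hle
    rw [worstDrop, guaranteedProb, hleast.csInf_eq, eval_sub, eval_C]
  · rw [coeff_sub, coeff_C_zero, coeff_zero_vertexPoly hP, sub_self]
  · -- The vertex with the smallest derivative moves each entry against its slope.
    have hge : ∀ T, -(∑ j ∈ pairsBelow (2 ^ n), matchDrop (Q j.1 j.2) (α j)) ≤
        (vertexPoly i P σ T).coeff 1 := by
      intro T
      rw [coeff_one_vertexPoly hP, ← Finset.sum_neg_distrib]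
      refine Finset.sum_le_sum fun j _ => ?_
      unfold vertexRate
      split_ifs
      exacts [(neg_matchDrop_le _ _).1, (neg_matchDrop_le _ _).2]
    have heq : (vertexPoly i P σ ((pairsBelow (2 ^ n)).filter fun j => α j < 0)).coeff 1 =
        -(∑ j ∈ pairsBelow (2 ^ n), matchDrop (Q j.1 j.2) (α j)) := by
      rw [coeff_one_vertexPoly hP, ← Finset.sum_neg_distrib]
      refine Finset.sum_congr rfl fun j hj => ?_
      rw [neg_matchDrop_eq, vertexRate]
      simp only [Finset.mem_filter, hj, true_and]
      split_ifs <;> rfl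
    have hle := coeff_one_le_of_eventually_eval_le (by
      rw [coeff_zero_vertexPoly hP, coeff_zero_vertexPoly hP])
      (hmin ((pairsBelow (2 ^ n)).filter fun j => α j < 0)
        (Finset.mem_powerset.2 (Finset.filter_subset _ _)))
    have := hge S
    rw [coeff_sub, coeff_C_succ]
    linarith

lemma matchDrop_symm {p q α : ℝ} (h : p + q = 1) : matchDrop q (-α) = matchDrop p α := by
  obtain rfl : q = 1 - p := by linarith
  unfold matchDrop
  by_cases h0 : p = 0
  · simp [h0]
  · by_cases h1 : p = 1
    · simp [h1]
    · have h3 : 1 - p ≠ 0 := fun h => h1 (by linarith)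
      have h4 : 1 - p ≠ 1 := fun h => h0 (by linarith)
      simp [h0, h1, h3, h4]

lemma sum_pairs_eq_sum_pairsBelow {N : ℕ} (g : ℕ → ℕ → ℝ) :
    ∑ a : Fin N, ∑ b ∈ Finset.univ.filter (fun b => a < b), g a b =
      ∑ j ∈ pairsBelow N, g j.1 j.2 := by
  rw [pairsBelow, Finset.sum_filter, Finset.sum_product,
    ← Fin.sum_univ_eq_sum_range (fun p => ∑ q ∈ Finset.range N, if p < q then g p q else 0)]
  refine Finset.sum_congr rfl fun a _ => ?_
  rw [← Fin.sum_univ_eq_sum_range (fun q => if (a : ℕ) < q then g a q else 0), Finset.sum_filter]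
  simp only [Fin.lt_def]

/-- Sums of a symmetric function over pairs do not depend on the order. -/
lemma sum_pairs_perm {N : ℕ} (σ : Equiv.Perm (Fin N)) (g : Fin N → Fin N → ℝ)
    (hg : ∀ a b, a ≠ b → g a b = g b a) :
    ∑ a, ∑ b ∈ Finset.univ.filter (fun b => a < b), g (σ a) (σ b) =
      ∑ a, ∑ b ∈ Finset.univ.filter (fun b => a < b), g a b := by
  have key : ∀ f : Fin N → Fin N → ℝ, (∀ a b, a ≠ b → f a b = f b a) →
      (∑ a, ∑ b ∈ Finset.univ.filter (fun b => a < b), f a b) * 2 =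
        ∑ a, ∑ b, if a = b then 0 else f a b := by
    intro f hf
    simp only [Finset.sum_filter]
    rw [mul_two]
    nth_rewrite 2 [Finset.sum_comm]
    rw [← Finset.sum_add_distrib]
    refine Finset.sum_congr rfl fun a _ => ?_
    rw [← Finset.sum_add_distrib]
    refine Finset.sum_congr rfl fun b _ => ?_
    rcases lt_trichotomy a b with h | h | h
    · simp [h, h.not_gt, h.ne]
    · simp [h]
    · simp [h, h.not_gt, h.ne', hf a b h.ne']
  have h1 := key g hg
  have h2 := key (fun a b => g (σ a) (σ b)) fun a b hab => hg _ _ (σ.injective.ne hab)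
  have h3 : (∑ a, ∑ b, if a = b then 0 else g (σ a) (σ b)) =
      ∑ a, ∑ b, if a = b then 0 else g a b := by
    rw [← Equiv.sum_comp σ fun a => ∑ b, if a = b then 0 else g a b]
    refine Finset.sum_congr rfl fun a _ => ?_
    rw [← Equiv.sum_comp σ fun b => if σ a = b then 0 else g (σ a) b]
    simp only [σ.injective.eq_iff]
  rw [h3] at h2
  linarith

/-- The slope of the winning probability of `i` in the match between the players `a` and `b`. -/
def playerSlope {R : Type*} [CommRing R] {n : ℕ} (i : Fin (2 ^ n))
    (P : Matrix (Fin (2 ^ n)) (Fin (2 ^ n)) R) (σ : Equiv.Perm (Fin (2 ^ n)))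
    (a b : Fin (2 ^ n)) : R :=
  slope (byPosition P σ) n 0 (pointMass R (σ.symm i)) (σ.symm a) (σ.symm b)

lemma firstOrderDrop_eq_sum_pairsBelow {n : ℕ} {P : Matrix (Fin (2 ^ n)) (Fin (2 ^ n)) ℝ}
    (hP : IsComparison P) (σ : Equiv.Perm (Fin (2 ^ n))) (i : Fin (2 ^ n)) (ε : ℝ) :
    firstOrderDrop i P σ ε = (∑ j ∈ pairsBelow (2 ^ n), matchDrop (byPosition P σ j.1 j.2)
        (slope (byPosition P σ) n 0 (pointMass ℝ (σ.symm i)) j.1 j.2)) * ε := by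
  obtain ⟨p, hp, -, h1⟩ := exists_isDropPolynomial hP σ i
  rw [firstOrderDrop_eq_of_isDropPolynomial hp, h1]

lemma firstOrderDrop_eq_sum {n : ℕ} {P : Matrix (Fin (2 ^ n)) (Fin (2 ^ n)) ℝ}
    (hP : IsComparison P) (σ : Equiv.Perm (Fin (2 ^ n))) (i : Fin (2 ^ n)) (ε : ℝ) :
    firstOrderDrop i P σ ε = (∑ a, ∑ b ∈ Finset.univ.filter (fun b => a < b),
      matchDrop (P a b) (playerSlope i P σ a b)) * ε := by
  rw [firstOrderDrop_eq_sum_pairsBelow hP]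
  congr 1
  rw [← sum_pairs_perm σ, ← sum_pairs_eq_sum_pairsBelow (fun p q =>
    matchDrop (byPosition P σ p q) (slope (byPosition P σ) n 0 (pointMass ℝ (σ.symm i)) p q))]
  · refine Finset.sum_congr rfl fun a _ => Finset.sum_congr rfl fun b _ => ?_
    rw [playerSlope, ← byPosition_symm P σ (σ a) (σ b), Equiv.symm_apply_apply,
      Equiv.symm_apply_apply]
  · intro a b hab
    have hne : (σ.symm a : ℕ) ≠ σ.symm b := by
      rwa [Ne, ← Fin.ext_iff, σ.symm.injective.eq_iff]
    rw [playerSlope, playerSlope, slope_swap _ _ _ _ hne, matchDrop_symm (hP a b hab).2.2]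

lemma winProb_setMatch_eq {n : ℕ} {P : Matrix (Fin (2 ^ n)) (Fin (2 ^ n)) ℝ}
    (hP : IsComparison P) (σ : Equiv.Perm (Fin (2 ^ n))) (i : Fin (2 ^ n)) {a b : Fin (2 ^ n)}
    (hab : a ≠ b) {x : ℝ} (h0 : 0 ≤ x) (h1 : x ≤ 1) :
    winProb i (setMatch P a b x) σ =
      playerSlope i P σ a b * x + winProb i (setMatch P a b 0) σ := by
  have hne : (σ.symm a : ℕ) ≠ σ.symm b := by
    rwa [Ne, ← Fin.ext_iff, σ.symm.injective.eq_iff]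
  rw [winProb_setMatch hP σ i hab h0 h1, winProb_setMatch hP σ i hab le_rfl zero_le_one,
    playerSlope]
  linear_combination blockValue_replaceMatch_sub (byPosition P σ) hne x 0 n 0
    (pointMass ℝ (σ.symm i))

/-! ### Deterministic matrices -/

/-- The winner of a match with a certain outcome. -/
def matchWinner (Q : ℕ → ℕ → ℝ) (p q : ℕ) : ℕ := if 0 < Q p q then p else q

/-- The winner of the block of height `k` that starts at `m`, in a deterministic tournament. -/
def blockWinner (Q : ℕ → ℕ → ℝ) : ℕ → ℕ → ℕ
  | 0, m => m
  | k + 1, m => matchWinner Q (blockWinner Q k m) (blockWinner Q k (m + 2 ^ k))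

lemma blockWinner_mem (Q : ℕ → ℕ → ℝ) (k : ℕ) :
    ∀ m, blockWinner Q k m ∈ Finset.Ico m (m + 2 ^ k) := by
  induction k with
  | zero => simp [blockWinner]
  | succ k ih =>
    intro m
    have h1 := Finset.mem_Ico.1 (ih m)
    have h2 := Finset.mem_Ico.1 (ih (m + 2 ^ k))
    rw [blockWinner, matchWinner, Finset.mem_Ico, pow_succ]
    split_ifs <;> omega

lemma blockWin_eq_pointMass {Q : ℕ → ℕ → ℝ} (k : ℕ) : ∀ m,
    (∀ p ∈ Finset.Ico m (m + 2 ^ k), ∀ q ∈ Finset.Ico m (m + 2 ^ k), p ≠ q →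
      (Q p q = 0 ∧ Q q p = 1) ∨ (Q p q = 1 ∧ Q q p = 0)) →
    ∀ p ∈ Finset.Ico m (m + 2 ^ k), blockWin Q k m p = pointMass ℝ (blockWinner Q k m) p := by
  induction k with
  | zero =>
    intro m _ p hp
    simp only [pow_zero, Finset.mem_Ico] at hp
    obtain rfl : p = m := by omega
    simp [blockWin, blockWinner, pointMass]
  | succ k ih =>
    intro m h
    simp only [Finset.mem_Ico, pow_succ, mul_two] at h
    have hu' := ih m fun p hp q hq => by
      simp only [Finset.mem_Ico] at hp hq
      exact h p (by omega) q (by omega)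
    have hv' := ih (m + 2 ^ k) fun p hp q hq => by
      simp only [Finset.mem_Ico] at hp hq
      exact h p (by omega) q (by omega)
    have hu := blockWinner_mem Q k m
    have hv := blockWinner_mem Q k (m + 2 ^ k)
    rw [blockWinner]
    set u := blockWinner Q k m
    set v := blockWinner Q k (m + 2 ^ k)
    have hsumL : ∀ p, ∑ q ∈ Finset.Ico m (m + 2 ^ k), blockWin Q k m q * Q p q = Q p u := by
      intro p
      rw [Finset.sum_eq_single_of_mem u hu fun q hq hne => by
        rw [hu' q hq, pointMass, if_neg hne, zero_mul], hu' u hu, pointMass, if_pos rfl, one_mul]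
    have hsumR : ∀ p, ∑ q ∈ Finset.Ico (m + 2 ^ k) (m + 2 ^ k + 2 ^ k),
        blockWin Q k (m + 2 ^ k) q * Q p q = Q p v := by
      intro p
      rw [Finset.sum_eq_single_of_mem v hv fun q hq hne => by
        rw [hv' q hq, pointMass, if_neg hne, zero_mul], hv' v hv, pointMass, if_pos rfl, one_mul]
    simp only [Finset.mem_Ico] at hu hv hu' hv'
    have hformula : ∀ p ∈ Finset.Ico m (m + 2 ^ (k + 1)), blockWin Q (k + 1) m p =
        pointMass ℝ u p * Q u v + pointMass ℝ v p * Q v u := by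
      intro p hp
      simp only [Finset.mem_Ico, pow_succ, mul_two] at hp
      rw [blockWin, hsumL, hsumR]
      split_ifs with hc
      · rw [hu' p (by omega)]
        simp only [pointMass, if_neg (show p ≠ v by omega)]
        split_ifs with e
        · rw [e]; ring
        · ring
      · rw [hv' p (by omega)]
        simp only [pointMass, if_neg (show p ≠ u by omega)]
        split_ifs with e
        · rw [e]; ring
        · ring
    intro p hp
    rw [hformula p hp, matchWinner]
    rcases h u (by omega) v (by omega) (by omega) with ⟨h1, h2⟩ | ⟨h1, h2⟩ <;> simp [h1, h2]

lemma IsDeterministic.setMatch {N : ℕ} {P : Matrix (Fin N) (Fin N) ℝ} (hd : IsDeterministic P)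
    {a b : Fin N} {x : ℝ} (hx : x = 0 ∨ x = 1) :
    IsDeterministic (setMatch P a b x) := by
  intro c d hcd
  unfold Knockout.setMatch
  split_ifs
  · exact hx
  · rcases hx with rfl | rfl <;> simp
  · exact hd c d hcd

lemma byPosition_deterministic {n : ℕ} {P : Matrix (Fin (2 ^ n)) (Fin (2 ^ n)) ℝ}
    (hP : IsComparison P) (hd : IsDeterministic P) (σ : Equiv.Perm (Fin (2 ^ n))) {p q : ℕ}
    (hp : p < 2 ^ n) (hq : q < 2 ^ n) (hpq : p ≠ q) :
    (byPosition P σ p q = 0 ∧ byPosition P σ q p = 1) ∨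
      (byPosition P σ p q = 1 ∧ byPosition P σ q p = 0) := by
  have h1 := (byPosition_mem hP σ hp hq hpq).2.2
  have h2 : byPosition P σ p q = 0 ∨ byPosition P σ p q = 1 := hd _ _ (by
    rw [σ.injective.ne_iff, Ne, Fin.ext_iff, val_ofNat hp, val_ofNat hq]
    exact hpq)
  rcases h2 with h | h
  · left; exact ⟨h, by linarith⟩
  · right; exact ⟨h, by linarith⟩

lemma winProb_deterministic {n : ℕ} {P : Matrix (Fin (2 ^ n)) (Fin (2 ^ n)) ℝ}
    (hP : IsComparison P) (hd : IsDeterministic P) (σ : Equiv.Perm (Fin (2 ^ n)))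
    (i : Fin (2 ^ n)) : winProb i P σ = 0 ∨ winProb i P σ = 1 := by
  have hi : (σ.symm i : ℕ) ∈ Finset.Ico 0 (0 + 2 ^ n) := by simp
  have hw := blockWin_eq_pointMass (Q := byPosition P σ) n 0
    fun p hp q hq hpq => by
      simp only [Finset.mem_Ico] at hp hq
      exact byPosition_deterministic hP hd σ (by omega) (by omega) hpq
  rw [winProb_eq_blockValue hP, blockValue_pointMass, if_pos hi, hw _ hi, pointMass]
  split_ifs <;> simp

lemma setMatch_self {N : ℕ} {P : Matrix (Fin N) (Fin N) ℝ} (hP : IsComparison P) {a b : Fin N}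
    (hab : a ≠ b) : setMatch P a b (P a b) = P := by
  funext c d
  unfold setMatch
  split_ifs with h1 h2
  · rw [h1.1, h1.2]
  · rw [h2.1, h2.2]; linarith [(hP a b hab).2.2]
  · rfl

/-- If `i` wins a deterministic tournament, a match contributes `1` if it is crucial and `0`
otherwise. -/
lemma matchDrop_of_winProb_eq_one {n : ℕ} {P : Matrix (Fin (2 ^ n)) (Fin (2 ^ n)) ℝ}
    (hP : IsComparison P) (hd : IsDeterministic P) (σ : Equiv.Perm (Fin (2 ^ n)))
    (i : Fin (2 ^ n)) (hw : winProb i P σ = 1) {a b : Fin (2 ^ n)} (hab : a ≠ b) :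
    matchDrop (P a b) (playerSlope i P σ a b) = Set.indicator (crucialMatches i P σ) 1 (a, b) +
      Set.indicator (crucialMatches i P σ) (1 : Fin (2 ^ n) × Fin (2 ^ n) → ℝ) (b, a) := by
  classical
  have key : ∀ a b : Fin (2 ^ n), a ≠ b → P a b = 0 →
      matchDrop (P a b) (playerSlope i P σ a b) =
        Set.indicator (crucialMatches i P σ) 1 (a, b) +
          Set.indicator (crucialMatches i P σ) (1 : Fin (2 ^ n) × Fin (2 ^ n) → ℝ) (b, a) := by
    intro a b hab h0
    have h1 := winProb_setMatch_eq hP σ i hab zero_le_one le_rfl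
    have hself := setMatch_self hP hab
    rw [h0] at hself
    rw [hself, hw] at h1
    have hba : (b, a) ∉ crucialMatches i P σ := by
      rintro ⟨-, hz, -⟩
      have := (hP a b hab).2.2
      dsimp only at hz
      rw [h0, hz] at this
      norm_num at this
    rw [Set.indicator_of_notMem hba, add_zero, matchDrop, if_pos h0]
    rcases winProb_deterministic (isComparison_setMatch hP hab zero_le_one le_rfl)
      (hd.setMatch (Or.inr rfl)) σ i with h | h
    · have hmem : (a, b) ∈ crucialMatches i P σ := ⟨hab, h0, h⟩
      rw [Set.indicator_of_mem hmem, max_eq_left] <;> simp <;> linarith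
    · have hmem : (a, b) ∉ crucialMatches i P σ := by
        rintro ⟨-, -, h'⟩
        dsimp only at h'
        rw [h'] at h; norm_num at h
      rw [Set.indicator_of_notMem hmem, max_eq_right]
      linarith
  rcases hd a b hab with h | h
  · exact key a b hab h
  · have h0 : P b a = 0 := by linarith [(hP a b hab).2.2]
    have hne : (σ.symm a : ℕ) ≠ σ.symm b := by
      rwa [Ne, ← Fin.ext_iff, σ.symm.injective.eq_iff]
    rw [add_comm, ← key b a hab.symm h0, playerSlope, playerSlope, slope_swap _ _ _ _ hne,
      matchDrop_symm (hP a b hab).2.2]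

lemma firstOrderDrop_of_winProb_eq_one {n : ℕ} {P : Matrix (Fin (2 ^ n)) (Fin (2 ^ n)) ℝ}
    (hP : IsComparison P) (hd : IsDeterministic P) (σ : Equiv.Perm (Fin (2 ^ n)))
    (i : Fin (2 ^ n)) (hw : winProb i P σ = 1) (ε : ℝ) :
    firstOrderDrop i P σ ε = ((crucialMatches i P σ).ncard : ℝ) * ε := by
  classical
  rw [firstOrderDrop_eq_sum hP]
  congr 1
  set I : Fin (2 ^ n) × Fin (2 ^ n) → ℝ := Set.indicator (crucialMatches i P σ) 1 with hI
  have hdiag : ∀ a, I (a, a) = 0 := fun a => Set.indicator_of_notMem (fun h => h.1 rfl) _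
  have h1 : ((crucialMatches i P σ).ncard : ℝ) = ∑ a, ∑ b, I (a, b) := by
    rw [Set.ncard_eq_toFinset_card', Finset.card_eq_sum_ones, Nat.cast_sum,
      ← Finset.sum_product', hI, Finset.univ_product_univ, Finset.sum_indicator_eq_sum_filter]
    refine Finset.sum_congr (by ext; simp) fun _ _ => by simp
  rw [h1]
  have h2 : ∀ a b : Fin (2 ^ n), I (a, b) =
      (if a < b then I (a, b) else 0) + if b < a then I (a, b) else 0 := by
    intro a b
    rcases lt_trichotomy a b with h | h | h
    · simp [h, h.not_gt]
    · simp [h, hdiag]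
    · simp [h, h.not_gt]
  rw [Finset.sum_congr rfl fun a _ => Finset.sum_congr rfl fun b _ => h2 a b]
  simp only [Finset.sum_add_distrib]
  rw [Finset.sum_comm (f := fun a b => if b < a then I (a, b) else 0), ← Finset.sum_add_distrib]
  refine Finset.sum_congr rfl fun a _ => ?_
  rw [Finset.sum_filter, ← Finset.sum_add_distrib]
  refine Finset.sum_congr rfl fun b _ => ?_
  split_ifs with h
  · exact matchDrop_of_winProb_eq_one hP hd σ i hw h.ne
  · simp

/-! ### Reasoning about programs -/

/-- The number computed by an arithmetic operation satisfies `good`. -/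
def Op.Fine {F : Type} [CommRing F] (good : F → Prop) (s : State F) : Op → Prop
  | .numConst _ c => good (c : F)
  | .numAdd _ a b => good (s.num a + s.num b)
  | .numSub _ a b => good (s.num a - s.num b)
  | .numMul _ a b => good (s.num a * s.num b)
  | _ => True

/-- Runs that take `t` steps and compute only numbers that satisfy `good`. From such a run, both
the unit cost and the bit cost can be read off. -/
inductive Exec {F : Type} [CommRing F] [LinearOrder F] (good : F → Prop) (I : Instance F) :
    Program → State F → State F → ℕ → Prop
  | op (o : Op) (s : State F) : o.Fine good s → Exec good I (.op o) s (o.apply I s) 1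
  | seq {p q : Program} {s s' s'' : State F} {t t' : ℕ} :
      Exec good I p s s' t → Exec good I q s' s'' t' → Exec good I (.seq p q) s s'' (t + t')
  | branchTrue {c : Test} {p q : Program} {s s' : State F} {t : ℕ} :
      c.Holds s → Exec good I p s s' t → Exec good I (.branch c p q) s s' (1 + t)
  | branchFalse {c : Test} {p q : Program} {s s' : State F} {t : ℕ} :
      ¬ c.Holds s → Exec good I q s s' t → Exec good I (.branch c p q) s s' (1 + t)
  | loopEnd {c : Test} {p : Program} {s : State F} :
      ¬ c.Holds s → Exec good I (.loop c p) s s 1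
  | loopStep {c : Test} {p : Program} {s s' s'' : State F} {t t' : ℕ} :
      c.Holds s → Exec good I p s s' t → Exec good I (.loop c p) s' s'' t' →
      Exec good I (.loop c p) s s'' (1 + t + t')

lemma Exec.run {F : Type} [CommRing F] [LinearOrder F] {good : F → Prop} {I : Instance F}
    {p : Program} {s s' : State F} {t : ℕ} (h : Exec good I p s s' t) :
    Run (unitCost F) I p s s' t := by
  induction h with
  | op o s _ => exact Run.op o s
  | seq _ _ ih ih' => exact Run.seq ih ih'
  | branchTrue hc _ ih => exact Run.branchTrue hc ih
  | branchFalse hc _ ih => exact Run.branchFalse hc ih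
  | loopEnd hc => exact Run.loopEnd hc
  | loopStep hc _ _ ih ih' => exact Run.loopStep hc ih ih'

/-- The operation writes the register `k`. -/
def Op.setsReg (k : ℕ) : Op → Bool
  | .const d _ => d == k
  | .add d _ _ => d == k
  | .sub d _ _ => d == k
  | .half d _ => d == k
  | .load d _ => d == k
  | .readDraw d _ => d == k
  | _ => false

/-- The operation writes the number register `k`. -/
def Op.setsNum (k : ℕ) : Op → Bool
  | .numConst d _ => d == k
  | .numAdd d _ _ => d == k
  | .numSub d _ _ => d == k
  | .numMul d _ _ => d == k
  | .numLoad d _ => d == k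
  | .readEntry d _ _ => d == k
  | _ => false

/-- The operation writes the memory for natural numbers. -/
def Op.setsMem : Op → Bool
  | .store _ _ => true
  | _ => false

/-- The operation writes the memory for numbers. -/
def Op.setsNumMem : Op → Bool
  | .numStore _ _ => true
  | _ => false

/-- Some operation of the program satisfies `f`. -/
def Program.any (f : Op → Bool) : Program → Bool
  | .op o => f o
  | .seq p q => p.any f || q.any f
  | .branch _ p q => p.any f || q.any f
  | .loop _ p => p.any f

/-- What the program `p` does not write is the same in the states `s` and `s'`. -/
structure Frame {F : Type} (p : Program) (s s' : State F) : Prop where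
  reg : ∀ k, p.any (Op.setsReg k) = false → s'.reg k = s.reg k
  num : ∀ k, p.any (Op.setsNum k) = false → s'.num k = s.num k
  mem : p.any Op.setsMem = false → s'.mem = s.mem
  numMem : p.any Op.setsNumMem = false → s'.numMem = s.numMem

lemma Frame.refl {F : Type} (p : Program) (s : State F) : Frame p s s :=
  ⟨fun _ _ => rfl, fun _ _ => rfl, fun _ => rfl, fun _ => rfl⟩

lemma Frame.trans {F : Type} {p : Program} {s s' s'' : State F} (h : Frame p s s')
    (h' : Frame p s' s'') : Frame p s s'' :=
  ⟨fun k hk => (h'.reg k hk).trans (h.reg k hk), fun k hk => (h'.num k hk).trans (h.num k hk),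
    fun hk => (h'.mem hk).trans (h.mem hk), fun hk => (h'.numMem hk).trans (h.numMem hk)⟩

lemma Frame.of_any {F : Type} {p q : Program} {s s' : State F} (h : Frame p s s')
    (hpq : ∀ f : Op → Bool, q.any f = false → p.any f = false) : Frame q s s' :=
  ⟨fun k hk => h.reg k (hpq _ hk), fun k hk => h.num k (hpq _ hk), fun hk => h.mem (hpq _ hk),
    fun hk => h.numMem (hpq _ hk)⟩

lemma Frame.seq {F : Type} {p q : Program} {s s' s'' : State F} (h : Frame p s s')
    (h' : Frame q s' s'') : Frame (.seq p q) s s'' := by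
  have h1 : ∀ f, (Program.seq p q).any f = false → p.any f = false ∧ q.any f = false :=
    fun f hf => Bool.or_eq_false_iff.1 hf
  exact (h.of_any fun f hf => (h1 f hf).1).trans (h'.of_any fun f hf => (h1 f hf).2)

lemma frame_op {F : Type} [CommRing F] (I : Instance F) (o : Op) (s : State F) :
    Frame (.op o) s (o.apply I s) := by
  constructor
  · intro k hk
    have hk' : o.setsReg k = false := hk
    cases o <;> first
      | rfl
      | exact Function.update_of_ne (by rintro rfl; simp [Op.setsReg] at hk') _ _
  · intro k hk
    have hk' : o.setsNum k = false := hk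
    cases o <;> first
      | rfl
      | exact Function.update_of_ne (by rintro rfl; simp [Op.setsNum] at hk') _ _
  · intro hk
    have hk' : o.setsMem = false := hk
    cases o <;> first | rfl | simp [Op.setsMem] at hk'
  · intro hk
    have hk' : o.setsNumMem = false := hk
    cases o <;> first | rfl | simp [Op.setsNumMem] at hk'

lemma Exec.frame {F : Type} [CommRing F] [LinearOrder F] {good : F → Prop} {I : Instance F}
    {p : Program} {s s' : State F} {t : ℕ} (h : Exec good I p s s' t) : Frame p s s' := by
  induction h with
  | op o s _ => exact frame_op I o s
  | seq _ _ ih ih' => exact ih.seq ih'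
  | @branchTrue c p q _ _ _ _ _ ih =>
    have h1 : ∀ f, (Program.branch c p q).any f = false → p.any f = false ∧ q.any f = false :=
      fun f hf => Bool.or_eq_false_iff.1 hf
    exact ih.of_any fun f hf => (h1 f hf).1
  | @branchFalse c p q _ _ _ _ _ ih =>
    have h1 : ∀ f, (Program.branch c p q).any f = false → p.any f = false ∧ q.any f = false :=
      fun f hf => Bool.or_eq_false_iff.1 hf
    exact ih.of_any fun f hf => (h1 f hf).2
  | loopEnd _ => exact Frame.refl _ _
  | @loopStep c p _ _ _ _ _ _ _ _ ih ih' =>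
    exact Frame.trans (ih.of_any (q := Program.loop c p) fun f hf => hf) ih'

/-- From the state `s`, the program `p` halts within `T` steps in a state that satisfies `Q`, and
computes only good numbers on the way. -/
def Reach {F : Type} [CommRing F] [LinearOrder F] (good : F → Prop) (I : Instance F)
    (p : Program) (s : State F) (T : ℕ) (Q : State F → Prop) : Prop :=
  ∃ s' t, Exec good I p s s' t ∧ t ≤ T ∧ Q s'

section Reach

variable {F : Type} [CommRing F] [LinearOrder F] {good : F → Prop} {I : Instance F}

lemma Reach.mono {p : Program} {s : State F} {T T' : ℕ} {Q Q' : State F → Prop}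
    (h : Reach good I p s T Q) (hT : T ≤ T') (hQ : ∀ s', Frame p s s' → Q s' → Q' s') :
    Reach good I p s T' Q' := by
  obtain ⟨s', t, he, ht, hq⟩ := h
  exact ⟨s', t, he, ht.trans hT, hQ s' he.frame hq⟩

lemma reach_op {o : Op} {s : State F} {T : ℕ} {Q : State F → Prop} (hf : o.Fine good s)
    (hT : 1 ≤ T) (hQ : Q (o.apply I s)) : Reach good I (.op o) s T Q :=
  ⟨_, _, Exec.op o s hf, hT, hQ⟩

lemma Reach.seq {p q : Program} {s : State F} {T T₁ T₂ : ℕ} {Q₁ Q : State F → Prop}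
    (h : Reach good I p s T₁ Q₁)
    (h' : ∀ s₁, Frame p s s₁ → Q₁ s₁ → Reach good I q s₁ T₂ Q) (hT : T₁ + T₂ ≤ T) :
    Reach good I (.seq p q) s T Q := by
  obtain ⟨s₁, t₁, he, ht, hq⟩ := h
  obtain ⟨s₂, t₂, he', ht', hq'⟩ := h' s₁ he.frame hq
  exact ⟨s₂, t₁ + t₂, he.seq he', by omega, hq'⟩

lemma reach_cons {o : Op} {q : Program} {s : State F} {T : ℕ} {Q : State F → Prop}
    (hf : o.Fine good s) (h : Reach good I q (o.apply I s) T Q) :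
    Reach good I (.seq (.op o) q) s (T + 1) Q := by
  obtain ⟨s₂, t₂, he, ht, hq⟩ := h
  exact ⟨s₂, 1 + t₂, (Exec.op o s hf).seq he, by omega, hq⟩

lemma reach_branch {c : Test} {p q : Program} {s : State F} {T : ℕ} {Q : State F → Prop}
    (h : c.Holds s → Reach good I p s T Q) (h' : ¬ c.Holds s → Reach good I q s T Q) :
    Reach good I (.branch c p q) s (T + 1) Q := by
  by_cases hc : c.Holds s
  · obtain ⟨s', t, he, ht, hq⟩ := h hc
    exact ⟨s', 1 + t, Exec.branchTrue hc he, by omega, hq⟩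
  · obtain ⟨s', t, he, ht, hq⟩ := h' hc
    exact ⟨s', 1 + t, Exec.branchFalse hc he, by omega, hq⟩

/-- A loop whose body is executed exactly `r` times, the `j`-th time with cost at most `c j`. -/
lemma reach_loop {test : Test} {p : Program} {s : State F} (Inv : ℕ → State F → Prop) (r : ℕ)
    (c : ℕ → ℕ) (h0 : Inv 0 s)
    (hstep : ∀ j < r, ∀ s₁, Frame p s s₁ → Inv j s₁ →
      test.Holds s₁ ∧ Reach good I p s₁ (c j) (Inv (j + 1)))
    (hend : ∀ s₁, Frame p s s₁ → Inv r s₁ → ¬ test.Holds s₁) :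
    Reach good I (.loop test p) s (∑ j ∈ Finset.range r, (c j + 1) + 1) (Inv r) := by
  have key : ∀ d j, d + j = r → ∀ s₁, Frame p s s₁ → Inv j s₁ →
      Reach good I (.loop test p) s₁ (∑ i ∈ Finset.Ico j r, (c i + 1) + 1) (Inv r) := by
    intro d
    induction d with
    | zero =>
      intro j hj s₁ hf hi
      obtain rfl : j = r := by omega
      exact ⟨s₁, 1, Exec.loopEnd (hend s₁ hf hi), by omega, hi⟩
    | succ d ih =>
      intro j hj s₁ hf hi
      obtain ⟨hc, s₂, t₂, he, ht, hq⟩ := hstep j (by omega) s₁ hf hi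
      obtain ⟨s₃, t₃, he', ht', hq'⟩ := ih (j + 1) (by omega) s₂ (hf.trans he.frame) hq
      refine ⟨s₃, 1 + t₂ + t₃, Exec.loopStep hc he he', ?_, hq'⟩
      rw [Finset.sum_eq_sum_Ico_succ_bot (by omega : j < r)]
      omega
  have := key r 0 rfl s (Frame.refl p s) h0
  rwa [← Finset.range_eq_Ico] at this

/-- A loop whose body is executed exactly `r` times, each time with cost at most `c`. -/
lemma reach_loop_const {test : Test} {p : Program} {s : State F} (Inv : ℕ → State F → Prop)
    (r c : ℕ) (h0 : Inv 0 s)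
    (hstep : ∀ j < r, ∀ s₁, Frame p s s₁ → Inv j s₁ →
      test.Holds s₁ ∧ Reach good I p s₁ c (Inv (j + 1)))
    (hend : ∀ s₁, Frame p s s₁ → Inv r s₁ → ¬ test.Holds s₁) :
    Reach good I (.loop test p) s (r * (c + 1) + 1) (Inv r) := by
  have := reach_loop Inv r (fun _ => c) h0 hstep hend
  simpa using this

end Reach

/-- Sequential composition. -/
infixr:60 " ;; " => Program.seq

/-- A step without any effect on registers below `31`. -/
def skip : Program := .op (.const 31 0)

lemma reach_skip {F : Type} [CommRing F] [LinearOrder F] {good : F → Prop} {I : Instance F}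
    {s : State F} {Q : State F → Prop}
    (hQ : Q (Op.apply I s (.const 31 0))) : Reach good I skip s 1 Q :=
  reach_op trivial le_rfl hQ

/-! ### Evaluating a tournament -/

/-- The probability that the position `p` wins its block of height `k`. -/
def positionWin {R : Type*} [CommRing R] (Q : ℕ → ℕ → R) (k p : ℕ) : R :=
  blockWin Q k (p / 2 ^ k * 2 ^ k) p

lemma positionWin_of_mem {R : Type*} [CommRing R] (Q : ℕ → ℕ → R) {k t p : ℕ}
    (hp : p ∈ Finset.Ico (t * 2 ^ k) (t * 2 ^ k + 2 ^ k)) :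
    positionWin Q k p = blockWin Q k (t * 2 ^ k) p := by
  rw [Finset.mem_Ico] at hp
  rw [positionWin, Nat.div_eq_of_lt_le hp.1 (by rw [add_mul, one_mul]; exact hp.2)]

lemma positionWin_succ_left {R : Type*} [CommRing R] (Q : ℕ → ℕ → R) {k t p : ℕ}
    (hp : p ∈ Finset.Ico (t * (2 ^ k + 2 ^ k)) (t * (2 ^ k + 2 ^ k) + 2 ^ k)) :
    positionWin Q (k + 1) p = positionWin Q k p *
      ∑ q ∈ Finset.Ico (t * (2 ^ k + 2 ^ k) + 2 ^ k) (t * (2 ^ k + 2 ^ k) + 2 ^ k + 2 ^ k),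
        positionWin Q k q * Q p q := by
  rw [Finset.mem_Ico] at hp
  have e0 : t * 2 ^ (k + 1) = t * (2 ^ k + 2 ^ k) := by rw [pow_succ, mul_two]
  have e1 : t * (2 ^ k + 2 ^ k) = (t + t) * 2 ^ k := by ring
  have e2 : t * (2 ^ k + 2 ^ k) + 2 ^ k = (t + t + 1) * 2 ^ k := by ring
  rw [positionWin_of_mem Q (t := t) (by rw [e0, Finset.mem_Ico, pow_succ]; omega), e0, blockWin,
    if_pos hp.2, e1, positionWin_of_mem Q (t := t + t) (by rw [← e1, Finset.mem_Ico]; omega)]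
  congr 1
  refine Finset.sum_congr rfl fun q hq => ?_
  rw [← e1, e2] at hq ⊢
  rw [positionWin_of_mem Q hq]

lemma positionWin_succ_right {R : Type*} [CommRing R] (Q : ℕ → ℕ → R) {k t p : ℕ}
    (hp : p ∈ Finset.Ico (t * (2 ^ k + 2 ^ k) + 2 ^ k) (t * (2 ^ k + 2 ^ k) + 2 ^ k + 2 ^ k)) :
    positionWin Q (k + 1) p = positionWin Q k p *
      ∑ q ∈ Finset.Ico (t * (2 ^ k + 2 ^ k)) (t * (2 ^ k + 2 ^ k) + 2 ^ k),
        positionWin Q k q * Q p q := by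
  have hp' := Finset.mem_Ico.1 hp
  have e0 : t * 2 ^ (k + 1) = t * (2 ^ k + 2 ^ k) := by rw [pow_succ, mul_two]
  have e1 : t * (2 ^ k + 2 ^ k) = (t + t) * 2 ^ k := by ring
  have e2 : t * (2 ^ k + 2 ^ k) + 2 ^ k = (t + t + 1) * 2 ^ k := by ring
  rw [positionWin_of_mem Q (t := t) (by rw [e0, Finset.mem_Ico, pow_succ]; omega), e0, blockWin,
    if_neg (by omega)]
  rw [e2] at hp ⊢
  rw [positionWin_of_mem Q hp]
  congr 1
  refine Finset.sum_congr rfl fun q hq => ?_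
  rw [← e2, e1] at hq
  rw [e1, positionWin_of_mem Q hq]

section Evaluation

variable {F : Type} [CommRing F] {I : Instance F}

/-- The entries of the instance `I`, indexed by positions, after replacing the match between the
players `a` and `b`. -/
def modifiedEntry (I : Instance F) (a b : ℕ) (x : F) (p q : ℕ) : F :=
  replaceMatch I.entry a b x (I.leaf p) (I.leaf q)

/-- The registers on which the evaluation of a tournament depends: the matrix is modified by an
`(x, 1 - x)` match between `a` and `b`. -/
structure EvalContext (I : Instance F) (a b : ℕ) (x : F) (s : State F) : Prop where
  size : s.reg 0 = 2 ^ I.n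
  one : s.reg 2 = 1
  fst : s.reg 4 = a
  snd : s.reg 5 = b
  zero : s.reg 18 = 0
  prob : s.num 2 = x
  compl : s.num 3 = 1 - x
  numZero : s.num 8 = 0
  numOne : s.num 9 = 1

/-- The program writes none of the registers of the evaluation context. -/
def Program.keepsContext (p : Program) : Bool :=
  [0, 2, 4, 5, 18].all (fun k => !p.any (Op.setsReg k)) &&
    [2, 3, 8, 9].all (fun k => !p.any (Op.setsNum k))

lemma EvalContext.of_frame {a b : ℕ} {x : F} {s s' : State F} {p : Program}
    (h : EvalContext I a b x s) (hf : Frame p s s') (hp : p.keepsContext = true) :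
    EvalContext I a b x s' := by
  simp only [Program.keepsContext, List.all_cons, List.all_nil, Bool.and_true, Bool.and_eq_true,
    Bool.not_eq_true'] at hp
  obtain ⟨⟨h0, h2, h4, h5, h18⟩, g2, g3, g8, g9⟩ := hp
  exact ⟨(hf.reg _ h0).trans h.size, (hf.reg _ h2).trans h.one, (hf.reg _ h4).trans h.fst,
    (hf.reg _ h5).trans h.snd, (hf.reg _ h18).trans h.zero, (hf.num _ g2).trans h.prob,
    (hf.num _ g3).trans h.compl, (hf.num _ g8).trans h.numZero, (hf.num _ g9).trans h.numOne⟩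

variable [LinearOrder F] {good : F → Prop}

/-- The numbers that come up in the evaluation of the tournament with entries `Q` are good. -/
structure GoodEval {F : Type} [CommRing F] (good : F → Prop) (n : ℕ) (Q : ℕ → ℕ → F) : Prop where
  zero : good 0
  term : ∀ k < n, ∀ p < 2 ^ n, ∀ q < 2 ^ n, p ≠ q → good (positionWin Q k q * Q p q)
  sum : ∀ k < n, ∀ p < 2 ^ n, ∀ u v, v ≤ 2 ^ n → p ∉ Finset.Ico u v →
    good (∑ q ∈ Finset.Ico u v, positionWin Q k q * Q p q)
  win : ∀ k ≤ n, ∀ p < 2 ^ n, good (positionWin Q k p)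

/-- Number register 5 becomes the modified entry at the player in register 15 and the player at
the position in register 13. -/
def entryProg : Program :=
  .op (.readDraw 16 13) ;; .op (.readEntry 5 15 16) ;;
  .branch (.eq 15 4) (.branch (.eq 16 5) (.op (.numAdd 5 2 8)) skip) skip ;;
  .branch (.eq 15 5) (.branch (.eq 16 4) (.op (.numAdd 5 3 8)) skip) skip

lemma reach_entryProg {a b : ℕ} {x : F} (hab : a ≠ b) (hx : good x) (hx' : good (1 - x))
    {s : State F} (hc : EvalContext I a b x s) {p q : ℕ} (hp : s.reg 15 = I.leaf p)
    (hq : s.reg 13 = q) :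
    Reach good I entryProg s 8 (fun s' => s'.num 5 = modifiedEntry I a b x p q) := by
  have h4 := hc.fst
  have h5 := hc.snd
  have g2 := hc.prob
  have g3 := hc.compl
  have g8 := hc.numZero
  refine reach_cons trivial (reach_cons trivial ?_)
  refine Reach.seq (T₁ := 3) (T₂ := 3) (Q₁ := fun s' => s'.num 5 =
    if I.leaf p = a ∧ I.leaf q = b then x else I.entry (I.leaf p) (I.leaf q)) ?_ ?_ (by norm_num)
  · refine reach_branch (fun h => reach_branch (fun h' => reach_op ?_ le_rfl ?_)
      fun h' => reach_skip ?_) fun h => (reach_skip ?_).mono (by norm_num) fun _ _ h => h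
    all_goals simp_all [Test.Holds, Op.apply, Op.Fine]
  · intro s₁ hf hs
    have e15 : s₁.reg 15 = I.leaf p := by rw [hf.reg 15 rfl]; simp [Op.apply, hp]
    have e16 : s₁.reg 16 = I.leaf q := by rw [hf.reg 16 rfl]; simp [Op.apply, hq]
    have e4 : s₁.reg 4 = a := by rw [hf.reg 4 rfl]; simp [Op.apply, h4]
    have e5 : s₁.reg 5 = b := by rw [hf.reg 5 rfl]; simp [Op.apply, h5]
    have f3 : s₁.num 3 = 1 - x := by rw [hf.num 3 rfl]; simp [Op.apply, g3]
    have f8 : s₁.num 8 = 0 := by rw [hf.num 8 rfl]; simp [Op.apply, g8]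
    unfold modifiedEntry replaceMatch
    refine reach_branch (fun h => reach_branch (fun h' => reach_op ?_ le_rfl ?_)
      fun h' => reach_skip ?_) fun h => (reach_skip ?_).mono (by norm_num) fun _ _ h => h
    all_goals simp only [Test.Holds, e15, e16, e4, e5] at *
    · simpa [Op.Fine, f3, f8] using hx'
    · rw [if_neg (by omega), if_pos ⟨h, h'⟩]
      simp [Op.apply, f3, f8]
    · simp only [Op.apply, hs]
      rw [if_neg (show ¬ (I.leaf p = b ∧ I.leaf q = a) by omega)]
    · simp only [Op.apply, hs]
      rw [if_neg (show ¬ (I.leaf p = b ∧ I.leaf q = a) by omega)]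

/-- Number register 4 becomes the probability that the player in register 15 beats the winner
of the positions from register 13 up to register 14. The probabilities of these positions to win
their block are stored in the memory from the address in register 7 on. -/
def sumProg : Program :=
  .loop (.lt 13 14) (entryProg ;; .op (.add 17 7 13) ;; .op (.numLoad 6 17) ;;
    .op (.numMul 5 6 5) ;; .op (.numAdd 4 4 5) ;; .op (.add 13 13 2))

lemma reach_sumProg {a b : ℕ} {x : F} (hab : a ≠ b) (hx : good x) (hx' : good (1 - x))
    (hg : GoodEval good I.n (modifiedEntry I a b x)) {k : ℕ} (hk : k < I.n)
    {s : State F} (hc : EvalContext I a b x s) {p u len base : ℕ} (hN : p < 2 ^ I.n)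
    (hv : u + len ≤ 2 ^ I.n) (hpu : p ∉ Finset.Ico u (u + len))
    (hp : s.reg 15 = I.leaf p) (h13 : s.reg 13 = u) (h14 : s.reg 14 = u + len)
    (h7 : s.reg 7 = base) (h4 : s.num 4 = 0)
    (hcur : ∀ q < 2 ^ I.n, s.numMem (base + q) = positionWin (modifiedEntry I a b x) k q) :
    Reach good I sumProg s (14 * len + 1) (fun s' => s'.num 4 =
      ∑ q ∈ Finset.Ico u (u + len), positionWin (modifiedEntry I a b x) k q *
        modifiedEntry I a b x p q) := by
  set Q := modifiedEntry I a b x with hQ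
  refine (reach_loop_const (fun j s' => s'.reg 13 = u + j ∧ s'.num 4 =
    ∑ q ∈ Finset.Ico u (u + j), positionWin Q k q * Q p q) len 13 ⟨by simp [h13], by simp [h4]⟩
    ?_ ?_).mono (by omega) fun _ _ h => h.2
  · rintro j hj s₁ hf ⟨e13, e4⟩
    have e14 : s₁.reg 14 = u + len := (hf.reg 14 rfl).trans h14
    have hc₁ := hc.of_frame hf rfl
    refine ⟨by simp only [Test.Holds, e13, e14]; omega, ?_⟩
    refine Reach.seq (T₁ := 8) (T₂ := 5)
      (reach_entryProg hab hx hx' hc₁ ((hf.reg 15 rfl).trans hp) e13) ?_ le_rfl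
    intro s₂ hf₂ h5
    rw [← hQ] at h5
    have f13 : s₂.reg 13 = u + j := (hf₂.reg 13 rfl).trans e13
    have f7 : s₂.reg 7 = base := (hf₂.reg 7 rfl).trans ((hf.reg 7 rfl).trans h7)
    have f2 : s₂.reg 2 = 1 := (hf₂.reg 2 rfl).trans hc₁.one
    have f4 : s₂.num 4 = _ := (hf₂.num 4 rfl).trans e4
    have fm : s₂.numMem (base + (u + j)) = positionWin Q k (u + j) := by
      rw [hf₂.numMem rfl, hf.numMem rfl, hcur _ (by omega)]
    rw [Finset.mem_Ico] at hpu
    have hterm := hg.term k hk p hN (u + j) (by omega) (by omega)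
    have hsum := hg.sum k hk p hN u (u + (j + 1)) (by omega)
      (by rw [Finset.mem_Ico]; omega)
    rw [← add_assoc, Finset.sum_Ico_succ_top (by omega)] at hsum
    refine reach_cons trivial (reach_cons trivial (reach_cons ?_ (reach_cons ?_
      (reach_op trivial le_rfl ?_))))
    · simpa [Op.Fine, Op.apply, f7, f13, fm, h5] using hterm
    · simpa [Op.Fine, Op.apply, f7, f13, fm, h5, f4] using hsum
    · refine ⟨by simp [Op.apply, f13, f2, add_assoc], ?_⟩
      rw [← add_assoc, Finset.sum_Ico_succ_top (by omega)]
      simp [Op.apply, f7, f13, fm, h5, f4]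
  · rintro s₁ hf ⟨e13, -⟩
    have e14 : s₁.reg 14 = u + len := (hf.reg 14 rfl).trans h14
    simp only [Test.Holds, e13, e14]
    omega

/-- The probability of the position in register 12 to win the block from register 9 up to
register 11, with the middle in register 10. It is stored relative to the address in register 8,
and register 12 is increased by one. -/
def positionProg : Program :=
  .op (.readDraw 15 12) ;;
  .branch (.lt 12 10) (.op (.add 13 10 18) ;; .op (.add 14 11 18))
    (.op (.add 13 9 18) ;; .op (.add 14 10 18)) ;;
  .op (.numConst 4 0) ;; sumProg ;; .op (.add 17 7 12) ;; .op (.numLoad 6 17) ;;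
  .op (.numMul 4 6 4) ;; .op (.add 17 8 12) ;; .op (.numStore 17 4) ;; .op (.add 12 12 2)

lemma reach_positionProg {a b : ℕ} {x : F} (hab : a ≠ b) (hx : good x) (hx' : good (1 - x))
    (hg : GoodEval good I.n (modifiedEntry I a b x)) {k : ℕ} (hk : k < I.n)
    {s : State F} (hc : EvalContext I a b x s) {p t base : ℕ}
    (hp : p ∈ Finset.Ico (t * (2 ^ k + 2 ^ k)) (t * (2 ^ k + 2 ^ k) + 2 ^ k + 2 ^ k))
    (ht : t * (2 ^ k + 2 ^ k) + 2 ^ k + 2 ^ k ≤ 2 ^ I.n)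
    (h7 : s.reg 7 = base) (h8 : s.reg 8 = base + 2 ^ I.n) (h9 : s.reg 9 = t * (2 ^ k + 2 ^ k))
    (h10 : s.reg 10 = t * (2 ^ k + 2 ^ k) + 2 ^ k)
    (h11 : s.reg 11 = t * (2 ^ k + 2 ^ k) + 2 ^ k + 2 ^ k) (h12 : s.reg 12 = p)
    (hcur : ∀ q < 2 ^ I.n, s.numMem (base + q) = positionWin (modifiedEntry I a b x) k q) :
    Reach good I positionProg s (14 * 2 ^ k + 12) (fun s' => s'.reg 12 = p + 1 ∧
      s'.numMem = Function.update s.numMem (base + 2 ^ I.n + p)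
        (positionWin (modifiedEntry I a b x) (k + 1) p)) := by
  set Q := modifiedEntry I a b x with hQ
  rw [Finset.mem_Ico] at hp
  set m := t * (2 ^ k + 2 ^ k) with hm
  -- The opponents are the positions of the sibling block, which starts at `u`.
  obtain ⟨u, hu, hpu, hnext, hcase⟩ : ∃ u, u + 2 ^ k ≤ 2 ^ I.n ∧ p ∉ Finset.Ico u (u + 2 ^ k) ∧
      positionWin Q (k + 1) p = positionWin Q k p *
        ∑ q ∈ Finset.Ico u (u + 2 ^ k), positionWin Q k q * Q p q ∧
      (p < m + 2 ^ k ∧ u = m + 2 ^ k ∨ ¬ p < m + 2 ^ k ∧ u = m) := by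
    by_cases h : p < m + 2 ^ k
    · exact ⟨m + 2 ^ k, ht, by rw [Finset.mem_Ico]; omega,
        positionWin_succ_left Q (Finset.mem_Ico.2 ⟨hp.1, h⟩), by omega⟩
    · exact ⟨m, by omega, by rw [Finset.mem_Ico]; omega,
        positionWin_succ_right Q (Finset.mem_Ico.2 ⟨by omega, hp.2⟩), by omega⟩
  have hz := hc.zero
  refine reach_cons (T := 14 * 2 ^ k + 11) trivial ?_
  refine Reach.seq (T₁ := 3) (T₂ := 14 * 2 ^ k + 8)
    (Q₁ := fun s' => s'.reg 13 = u ∧ s'.reg 14 = u + 2 ^ k) ?_ ?_ (by omega)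
  · refine reach_branch (fun h => reach_cons trivial (reach_op trivial le_rfl ?_))
      fun h => reach_cons trivial (reach_op trivial le_rfl ?_)
    all_goals
      simp only [Test.Holds, Op.apply] at h
      simp [h12, h10] at h
      simp [Op.apply, hz, h9, h10, h11]
      omega
  rintro s₁ hf₁ ⟨h13, h14⟩
  have e15 : s₁.reg 15 = I.leaf p := by rw [hf₁.reg 15 rfl]; simp [Op.apply, h12]
  have e7 : s₁.reg 7 = base := by rw [hf₁.reg 7 rfl]; simp [Op.apply, h7]
  have e8 : s₁.reg 8 = base + 2 ^ I.n := by rw [hf₁.reg 8 rfl]; simp [Op.apply, h8]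
  have e12 : s₁.reg 12 = p := by rw [hf₁.reg 12 rfl]; simp [Op.apply, h12]
  have em : s₁.numMem = s.numMem := hf₁.numMem rfl
  have hc₁ : EvalContext I a b x s₁ := by
    refine EvalContext.of_frame (p := .op (.readDraw 15 12) ;; .branch (.lt 12 10)
      (.op (.add 13 10 18) ;; .op (.add 14 11 18)) (.op (.add 13 9 18) ;; .op (.add 14 10 18)))
      hc ((frame_op I _ s).seq hf₁) rfl
  have hc₂ : EvalContext I a b x (Op.apply I s₁ (.numConst 4 0)) :=
    hc₁.of_frame (frame_op I _ s₁) rfl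
  refine reach_cons (T := 14 * 2 ^ k + 7) (by simpa [Op.Fine] using hg.zero) ?_
  refine Reach.seq (T₂ := 6) (reach_sumProg (p := p) (u := u) (len := 2 ^ k) (base := base)
    hab hx hx' hg hk hc₂ (by omega) hu hpu (by simp [Op.apply, e15]) (by simp [Op.apply, h13])
    (by simp [Op.apply, h14]) (by simp [Op.apply, e7]) (by simp [Op.apply])
    (by simpa [Op.apply, em] using hcur)) ?_ (by omega)
  intro s₂ hf₂ h4
  rw [← hQ] at h4
  have f7 : s₂.reg 7 = base := by rw [hf₂.reg 7 rfl]; simp [Op.apply, e7]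
  have f8 : s₂.reg 8 = base + 2 ^ I.n := by rw [hf₂.reg 8 rfl]; simp [Op.apply, e8]
  have f12 : s₂.reg 12 = p := by rw [hf₂.reg 12 rfl]; simp [Op.apply, e12]
  have f2 : s₂.reg 2 = 1 := by rw [hf₂.reg 2 rfl]; exact hc₂.one
  have fm : s₂.numMem = s.numMem := by rw [hf₂.numMem rfl]; simp [Op.apply, em]
  have hgn := hg.win (k + 1) hk p (by omega)
  have hcp := hcur p (by omega)
  refine reach_cons trivial (reach_cons trivial (reach_cons ?_ (reach_cons trivial
    (reach_cons trivial (reach_op trivial le_rfl ?_)))))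
  · rw [hnext] at hgn
    simpa [Op.Fine, Op.apply, f7, f12, fm, hcp, h4] using hgn
  · simp [Op.apply, f7, f8, f12, f2, fm, hcp, h4, hnext]

/-- The probabilities of all positions to win the block that starts at the position in register 9
and is made up of two blocks of the size in register 6. Register 9 moves on to the next block. -/
def blockProg : Program :=
  .op (.add 10 9 6) ;; .op (.add 11 10 6) ;; .op (.add 12 9 18) ;;
  .loop (.lt 12 11) positionProg ;; .op (.add 9 11 18)

lemma reach_blockProg {a b : ℕ} {x : F} (hab : a ≠ b) (hx : good x) (hx' : good (1 - x))
    (hg : GoodEval good I.n (modifiedEntry I a b x)) {k : ℕ} (hk : k < I.n)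
    {s : State F} (hc : EvalContext I a b x s) {t base : ℕ}
    (ht : (t + 1) * (2 ^ k + 2 ^ k) ≤ 2 ^ I.n) (h6 : s.reg 6 = 2 ^ k)
    (h7 : s.reg 7 = base) (h8 : s.reg 8 = base + 2 ^ I.n) (h9 : s.reg 9 = t * (2 ^ k + 2 ^ k))
    (hcur : ∀ q < 2 ^ I.n, s.numMem (base + q) = positionWin (modifiedEntry I a b x) k q)
    (hnext : ∀ q < t * (2 ^ k + 2 ^ k), s.numMem (base + 2 ^ I.n + q) =
      positionWin (modifiedEntry I a b x) (k + 1) q) :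
    Reach good I blockProg s ((2 ^ k + 2 ^ k) * (14 * 2 ^ k + 13) + 5) (fun s' =>
      s'.reg 9 = (t + 1) * (2 ^ k + 2 ^ k) ∧
      (∀ q < 2 ^ I.n, s'.numMem (base + q) = positionWin (modifiedEntry I a b x) k q) ∧
      ∀ q < (t + 1) * (2 ^ k + 2 ^ k), s'.numMem (base + 2 ^ I.n + q) =
        positionWin (modifiedEntry I a b x) (k + 1) q) := by
  set Q := modifiedEntry I a b x with hQ
  rw [show (t + 1) * (2 ^ k + 2 ^ k) = t * (2 ^ k + 2 ^ k) + (2 ^ k + 2 ^ k) by ring] at ht ⊢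
  set m := t * (2 ^ k + 2 ^ k) with hm
  have hz := hc.zero
  refine reach_cons (T := (2 ^ k + 2 ^ k) * (14 * 2 ^ k + 13) + 4) trivial
    (reach_cons (T := (2 ^ k + 2 ^ k) * (14 * 2 ^ k + 13) + 3) trivial
      (reach_cons (T := (2 ^ k + 2 ^ k) * (14 * 2 ^ k + 13) + 2) trivial ?_))
  set s₀ := Op.apply I (Op.apply I (Op.apply I s (.add 10 9 6)) (.add 11 10 6)) (.add 12 9 18)
    with hs₀
  have hf₀ : Frame (.op (.add 10 9 6) ;; .op (.add 11 10 6) ;; .op (.add 12 9 18)) s s₀ :=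
    (frame_op I _ _).seq ((frame_op I _ _).seq (frame_op I _ _))
  have hc₀ : EvalContext I a b x s₀ := hc.of_frame hf₀ rfl
  have e10 : s₀.reg 10 = m + 2 ^ k := by simp [hs₀, Op.apply, h9, h6]
  have e11 : s₀.reg 11 = m + 2 ^ k + 2 ^ k := by simp [hs₀, Op.apply, h9, h6]
  have e12 : s₀.reg 12 = m := by simp [hs₀, Op.apply, h9, hz]
  have e7 : s₀.reg 7 = base := (hf₀.reg 7 rfl).trans h7
  have e8 : s₀.reg 8 = base + 2 ^ I.n := (hf₀.reg 8 rfl).trans h8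
  have e9 : s₀.reg 9 = m := (hf₀.reg 9 rfl).trans h9
  have em : s₀.numMem = s.numMem := hf₀.numMem rfl
  clear_value s₀
  refine Reach.seq (T₁ := (2 ^ k + 2 ^ k) * (14 * 2 ^ k + 13) + 1) (T₂ := 1)
    (reach_loop_const (fun j s' => s'.reg 12 = m + j ∧
      (∀ q < 2 ^ I.n, s'.numMem (base + q) = positionWin Q k q) ∧
      ∀ q < m + j, s'.numMem (base + 2 ^ I.n + q) = positionWin Q (k + 1) q)
      (2 ^ k + 2 ^ k) (14 * 2 ^ k + 12) ⟨by simp [e12], by simpa [em] using hcur,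
        by simpa [em] using hnext⟩ ?_ ?_) ?_ (by omega)
  · rintro j hj s₁ hf ⟨f12, fcur, fnext⟩
    have f11 : s₁.reg 11 = m + 2 ^ k + 2 ^ k := (hf.reg 11 rfl).trans e11
    refine ⟨by simp only [Test.Holds, f12, f11]; omega, ?_⟩
    refine (reach_positionProg (p := m + j) (t := t) (base := base) hab hx hx' hg hk
      (hc₀.of_frame hf rfl) (by rw [← hm, Finset.mem_Ico]; omega) (by omega)
      ((hf.reg 7 rfl).trans e7) ((hf.reg 8 rfl).trans e8) ((hf.reg 9 rfl).trans e9)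
      ((hf.reg 10 rfl).trans e10) f11 f12 fcur).mono le_rfl ?_
    rintro s₂ - ⟨g12, gm⟩
    refine ⟨by rw [g12, add_assoc], fun q hq => ?_, fun q hq => ?_⟩
    · rw [gm, Function.update_of_ne (by omega), fcur q hq]
    · rw [gm]
      by_cases hqj : q = m + j
      · rw [hqj, Function.update_self]
      · rw [Function.update_of_ne (by omega), fnext q (by omega)]
  · rintro s₁ hf ⟨f12, -⟩
    have f11 : s₁.reg 11 = m + 2 ^ k + 2 ^ k := (hf.reg 11 rfl).trans e11
    simp only [Test.Holds, f12, f11]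
    omega
  · rintro s₁ hf ⟨f12, fcur, fnext⟩
    have f11 : s₁.reg 11 = m + 2 ^ k + 2 ^ k := (hf.reg 11 rfl).trans e11
    have f18 : s₁.reg 18 = 0 := (hf.reg 18 rfl).trans hc₀.zero
    refine reach_op trivial le_rfl ⟨?_, fcur, fnext⟩
    simp [Op.apply, f11, f18, add_assoc]

/-- The passage from the blocks of the size in register 6 to the blocks of twice this size. The
probabilities are stored from the address in register 7 on; those of the next level follow. -/
def levelProg : Program :=
  .op (.add 8 7 0) ;; .op (.const 9 0) ;; .loop (.lt 9 0) blockProg ;;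
  .op (.add 7 8 18) ;; .op (.add 6 6 6)

lemma reach_levelProg {a b : ℕ} {x : F} (hab : a ≠ b) (hx : good x) (hx' : good (1 - x))
    (hg : GoodEval good I.n (modifiedEntry I a b x)) {k : ℕ} (hk : k < I.n)
    {s : State F} (hc : EvalContext I a b x s) {base : ℕ} (h6 : s.reg 6 = 2 ^ k)
    (h7 : s.reg 7 = base)
    (hcur : ∀ q < 2 ^ I.n, s.numMem (base + q) = positionWin (modifiedEntry I a b x) k q) :
    Reach good I levelProg s (38 * 2 ^ I.n * 2 ^ k) (fun s' =>
      s'.reg 6 = 2 ^ (k + 1) ∧ s'.reg 7 = base + 2 ^ I.n ∧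
      ∀ q < 2 ^ I.n, s'.numMem (base + 2 ^ I.n + q) =
        positionWin (modifiedEntry I a b x) (k + 1) q) := by
  set Q := modifiedEntry I a b x with hQ
  obtain ⟨r, hr⟩ : ∃ r, r * (2 ^ k + 2 ^ k) = 2 ^ I.n := by
    refine ⟨2 ^ (I.n - (k + 1)), ?_⟩
    rw [← mul_two, ← pow_succ, ← pow_add]
    congr 1; omega
  have hk1 := Nat.one_le_two_pow (n := k)
  have hrN : r ≤ 2 ^ I.n := by nlinarith
  have hN1 := Nat.one_le_two_pow (n := I.n)
  have hz := hc.zero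
  have h0 := hc.size
  set c := (2 ^ k + 2 ^ k) * (14 * 2 ^ k + 13) + 5 with hcdef
  have hcost : r * (c + 1) + 5 ≤ 38 * 2 ^ I.n * 2 ^ k := by
    have : r * (c + 1) = 2 ^ I.n * (14 * 2 ^ k + 13) + 6 * r := by rw [← hr, hcdef]; ring
    rw [this]
    nlinarith
  refine Reach.mono ?_ hcost fun _ _ h => h
  refine reach_cons (T := r * (c + 1) + 4) trivial (reach_cons (T := r * (c + 1) + 3)
    trivial ?_)
  set s₀ := Op.apply I (Op.apply I s (.add 8 7 0)) (.const 9 0) with hs₀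
  have hf₀ : Frame (.op (.add 8 7 0) ;; .op (.const 9 0)) s s₀ :=
    (frame_op I _ _).seq (frame_op I _ _)
  have hc₀ : EvalContext I a b x s₀ := hc.of_frame hf₀ rfl
  have e6 : s₀.reg 6 = 2 ^ k := (hf₀.reg 6 rfl).trans h6
  have e7 : s₀.reg 7 = base := (hf₀.reg 7 rfl).trans h7
  have e8 : s₀.reg 8 = base + 2 ^ I.n := by simp [hs₀, Op.apply, h7, h0]
  have e9 : s₀.reg 9 = 0 := by simp [hs₀, Op.apply]
  have em : s₀.numMem = s.numMem := hf₀.numMem rfl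
  clear_value s₀
  refine Reach.seq (T₁ := r * (c + 1) + 1) (T₂ := 2)
    (reach_loop_const (fun t s' => s'.reg 9 = t * (2 ^ k + 2 ^ k) ∧
      (∀ q < 2 ^ I.n, s'.numMem (base + q) = positionWin Q k q) ∧
      ∀ q < t * (2 ^ k + 2 ^ k), s'.numMem (base + 2 ^ I.n + q) = positionWin Q (k + 1) q)
      r c ⟨by simp [e9], by simpa [em] using hcur, by simp⟩ ?_ ?_) ?_ (by omega)
  · rintro t ht s₁ hf ⟨f9, fcur, fnext⟩
    have hle : (t + 1) * (2 ^ k + 2 ^ k) ≤ 2 ^ I.n := by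
      rw [← hr]; exact Nat.mul_le_mul_right _ ht
    have f0 : s₁.reg 0 = 2 ^ I.n := (hf.reg 0 rfl).trans hc₀.size
    refine ⟨?_, reach_blockProg hab hx hx' hg hk (hc₀.of_frame hf rfl) hle
      ((hf.reg 6 rfl).trans e6) ((hf.reg 7 rfl).trans e7) ((hf.reg 8 rfl).trans e8) f9
      fcur fnext⟩
    simp only [Test.Holds, f9, f0]
    rw [add_mul] at hle
    omega
  · rintro s₁ hf ⟨f9, -⟩
    have f0 : s₁.reg 0 = 2 ^ I.n := (hf.reg 0 rfl).trans hc₀.size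
    simp only [Test.Holds, f9, f0, hr]
    omega
  · rintro s₁ hf ⟨f9, fcur, fnext⟩
    rw [hr] at fnext
    have f6 : s₁.reg 6 = 2 ^ k := (hf.reg 6 rfl).trans e6
    have f8 : s₁.reg 8 = base + 2 ^ I.n := (hf.reg 8 rfl).trans e8
    have f18 : s₁.reg 18 = 0 := (hf.reg 18 rfl).trans hc₀.zero
    refine reach_cons trivial (reach_op trivial le_rfl ⟨?_, ?_, fnext⟩)
    · simp [Op.apply, f6, pow_succ, mul_two]
    · simp [Op.apply, f8, f18]

/-- Number register 4 becomes the winning probability of the position in register 3. There are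
`N / 2 ^ k` blocks of height `k`, and `N * 2 ^ k` terms to add up at the level `k + 1`, which makes
`O(N ^ 2)` terms in total. -/
def evalProg : Program :=
  .op (.const 12 0) ;; .loop (.lt 12 0) (.op (.numStore 12 9) ;; .op (.add 12 12 2)) ;;
  .op (.const 6 1) ;; .op (.const 7 0) ;; .loop (.lt 6 0) levelProg ;;
  .op (.add 17 7 3) ;; .op (.numLoad 4 17)

lemma reach_evalProg {a b : ℕ} {x : F} (hab : a ≠ b) (hx : good x) (hx' : good (1 - x))
    (hg : GoodEval good I.n (modifiedEntry I a b x))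
    {s : State F} (hc : EvalContext I a b x s) {pos : ℕ} (hpos : pos < 2 ^ I.n)
    (h3 : s.reg 3 = pos) :
    Reach good I evalProg s (49 * (2 ^ I.n) ^ 2) (fun s' =>
      s'.num 4 = positionWin (modifiedEntry I a b x) I.n pos) := by
  set Q := modifiedEntry I a b x with hQ
  have hN1 := Nat.one_le_two_pow (n := I.n)
  set N := 2 ^ I.n with hN
  refine Reach.mono (T := 39 * N ^ 2 + 3 * N + 7) ?_ (by nlinarith) fun _ _ h => h
  refine reach_cons trivial ?_
  have hc₀ : EvalContext I a b x (Op.apply I s (.const 12 0)) := hc.of_frame (frame_op I _ s) rfl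
  refine Reach.seq (T₁ := N * 3 + 1) (T₂ := 39 * N ^ 2 + 5)
    (reach_loop_const (fun j s' => s'.reg 12 = j ∧ ∀ q < j, s'.numMem q = 1) N 2
      ⟨by simp [Op.apply], by simp⟩ ?_ ?_) ?_ (by omega)
  · rintro j hj s₁ hf ⟨f12, fm⟩
    have hc₁ := hc₀.of_frame hf rfl
    refine ⟨by simp only [Test.Holds, f12, hc₁.size]; omega,
      reach_cons trivial (reach_op trivial le_rfl ⟨?_, fun q hq => ?_⟩)⟩
    · simp [Op.apply, f12, hc₁.one]
    · simp only [Op.apply, f12, hc₁.numOne]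
      by_cases hqj : q = j
      · rw [hqj, Function.update_self]
      · rw [Function.update_of_ne hqj, fm q (by omega)]
  · rintro s₁ hf ⟨f12, -⟩
    simp only [Test.Holds, f12, (hc₀.of_frame hf rfl).size]
    omega
  rintro s₁ hf₁ ⟨-, hm₁⟩
  have hc₁ := hc₀.of_frame hf₁ rfl
  have e3 : s₁.reg 3 = pos := by rw [hf₁.reg 3 rfl]; simp [Op.apply, h3]
  refine reach_cons (T := 39 * N ^ 2 + 4) trivial (reach_cons (T := 39 * N ^ 2 + 3) trivial ?_)
  set s₂ := Op.apply I (Op.apply I s₁ (.const 6 1)) (.const 7 0) with hs₂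
  have hf₂ : Frame (.op (.const 6 1) ;; .op (.const 7 0)) s₁ s₂ :=
    (frame_op I _ _).seq (frame_op I _ _)
  have hc₂ : EvalContext I a b x s₂ := hc₁.of_frame hf₂ rfl
  have e3 : s₂.reg 3 = pos := (hf₂.reg 3 rfl).trans e3
  have e6 : s₂.reg 6 = 1 := by simp [hs₂, Op.apply]
  have e7 : s₂.reg 7 = 0 := by simp [hs₂, Op.apply]
  have em : s₂.numMem = s₁.numMem := hf₂.numMem rfl
  clear_value s₂
  refine Reach.seq (T₁ := ∑ k ∈ Finset.range I.n, (38 * N * 2 ^ k + 1) + 1) (T₂ := 2)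
    (reach_loop (fun k s' => s'.reg 6 = 2 ^ k ∧ s'.reg 7 = k * N ∧
      ∀ q < N, s'.numMem (k * N + q) = positionWin Q k q) I.n (fun k => 38 * N * 2 ^ k)
      ⟨by simp [e6], by simp [e7], fun q hq => ?_⟩ ?_ ?_) ?_ ?_
  · rw [em, zero_mul, zero_add, hm₁ q hq]
    rfl
  · rintro k hk s₃ hf ⟨f6, f7, fm⟩
    have hc₃ := hc₂.of_frame hf rfl
    refine ⟨?_, (reach_levelProg hab hx hx' hg hk hc₃ f6 f7 fm).mono le_rfl ?_⟩
    · simp only [Test.Holds, f6, hc₃.size]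
      exact Nat.pow_lt_pow_right (by norm_num) hk
    · rintro s₄ - ⟨g6, g7, gm⟩
      rw [add_mul, one_mul]
      exact ⟨g6, g7, gm⟩
  · rintro s₃ hf ⟨f6, -⟩
    simp only [Test.Holds, f6, (hc₂.of_frame hf rfl).size]
    omega
  · rintro s₃ hf ⟨f6, f7, fm⟩
    have f3 : s₃.reg 3 = pos := (hf.reg 3 rfl).trans e3
    refine reach_cons trivial (reach_op trivial le_rfl ?_)
    simp [Op.apply, f7, f3, fm pos hpos]
  · -- The cost of the levels is a geometric sum.
    have hsum : ∀ r, ∑ k ∈ Finset.range r, (38 * N * 2 ^ k + 1) + 38 * N = 38 * N * 2 ^ r + r := by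
      intro r
      induction r with
      | zero => simp
      | succ r ih => rw [Finset.sum_range_succ, pow_succ]; linarith
    have h1 := hsum I.n
    have h2 : I.n < N := Nat.lt_two_pow_self
    rw [← hN] at h1
    nlinarith

lemma positionWin_top {R : Type*} [CommRing R] (Q : ℕ → ℕ → R) {n p : ℕ} (hp : p < 2 ^ n) :
    positionWin Q n p = blockWin Q n 0 p := by
  rw [positionWin, Nat.div_eq_of_lt hp, zero_mul]

end Evaluation

/-! ### The program for arbitrary comparison matrices -/

section General

variable {F : Type} [CommRing F] [LinearOrder F]

/-- A division-free form of `matchDrop` for entries `0 ≤ p ≤ 1`. -/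
def gain (p α : F) : F :=
  if 0 < α then (if 0 < p then α else 0) else (if p < 1 then -α else 0)

/-- The slope of the winning probability of the position `pos` in the match between the players
`a` and `b`, obtained by evaluating the tournament for both outcomes. -/
def instanceSlope (I : Instance F) (pos a b : ℕ) : F :=
  positionWin (modifiedEntry I a b 1) I.n pos - positionWin (modifiedEntry I a b 0) I.n pos

/-- The total of the pairs that precede the pair `(a, e)` in the lexicographic order. -/
def partialGain (I : Instance F) (pos a e : ℕ) : F :=
  ∑ c ∈ Finset.range a, ∑ b ∈ Finset.Ico (c + 1) (2 ^ I.n),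
      gain (I.entry c b) (instanceSlope I pos c b) +
    ∑ b ∈ Finset.Ico (a + 1) e, gain (I.entry a b) (instanceSlope I pos a b)

/-- The numbers computed by `generalProg` are good. -/
structure GoodDrop (good : F → Prop) (I : Instance F) (pos : ℕ) : Prop where
  zero : good 0
  one : good 1
  eval : ∀ a b, a < b → b < 2 ^ I.n → ∀ x, x = 0 ∨ x = 1 →
    GoodEval good I.n (modifiedEntry I a b x)
  slope : ∀ a b, a < b → b < 2 ^ I.n → good (instanceSlope I pos a b)
  sum : ∀ a < 2 ^ I.n, ∀ e ≤ 2 ^ I.n, good (partialGain I pos a e)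
  result : good (I.eps * partialGain I pos (2 ^ I.n) 0)

/-- The contribution of the pair of players in the registers 4 and 5 is added to number
register 1, and register 5 is increased by one. -/
def pairProg : Program :=
  .op (.numAdd 2 9 8) ;; .op (.numAdd 3 8 8) ;; evalProg ;; .op (.numAdd 7 4 8) ;;
  .op (.numAdd 2 8 8) ;; .op (.numAdd 3 9 8) ;; evalProg ;; .op (.numSub 7 7 4) ;;
  .op (.readEntry 5 4 5) ;;
  .branch (.numLt 8 7) (.branch (.numLt 8 5) (.op (.numAdd 1 1 7)) skip)
    (.branch (.numLt 5 9) (.op (.numSub 1 1 7)) skip) ;;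
  .op (.add 5 5 2)

variable {good : F → Prop} {I : Instance F}

/-- The registers that hold constants during the run of `generalProg`. -/
structure MainContext (I : Instance F) (pos : ℕ) (s : State F) : Prop where
  size : s.reg 0 = 2 ^ I.n
  one : s.reg 2 = 1
  pos : s.reg 3 = pos
  zero : s.reg 18 = 0
  eps : s.num 0 = I.eps
  numZero : s.num 8 = 0
  numOne : s.num 9 = 1

lemma reach_pairProg {pos : ℕ} (hpos : pos < 2 ^ I.n) (hg : GoodDrop good I pos)
    {s : State F} (hc : MainContext I pos s) {a b : ℕ} (hab : a < b) (hb : b < 2 ^ I.n)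
    (h4 : s.reg 4 = a) (h5 : s.reg 5 = b) (h1 : s.num 1 = partialGain I pos a b) :
    Reach good I pairProg s (98 * (2 ^ I.n) ^ 2 + 11) (fun s' => s'.reg 5 = b + 1 ∧
      s'.num 1 = partialGain I pos a (b + 1)) := by
  set N := 2 ^ I.n with hN
  have z8 := hc.numZero
  have o9 := hc.numOne
  have hE1 := hg.eval a b hab hb 1 (Or.inr rfl)
  have hE0 := hg.eval a b hab hb 0 (Or.inl rfl)
  refine reach_cons (T := 98 * N ^ 2 + 10) (by simpa [Op.Fine, z8, o9] using hg.one)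
    (reach_cons (T := 98 * N ^ 2 + 9) (by simpa [Op.Fine, Op.apply, z8] using hg.zero) ?_)
  have hc₀ : EvalContext I a b 1 (Op.apply I (Op.apply I s (.numAdd 2 9 8)) (.numAdd 3 8 8)) := by
    constructor <;> simp [Op.apply, hc.size, hc.one, h4, h5, hc.zero, z8, o9]
  refine Reach.seq (T₁ := 49 * N ^ 2) (T₂ := 49 * N ^ 2 + 9) (reach_evalProg (pos := pos) hab.ne hg.one
    (by simpa using hg.zero) hE1 hc₀ hpos (by simp [Op.apply, hc.pos])) ?_ (by omega)
  intro s₁ hf₁ v1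
  have hc₁ := hc₀.of_frame hf₁ rfl
  have e3 : s₁.reg 3 = pos := by rw [hf₁.reg 3 rfl]; simp [Op.apply, hc.pos]
  have e1 : s₁.num 1 = _ := (hf₁.num 1 rfl).trans (by simpa [Op.apply] using h1)
  have z8 := hc₁.numZero
  have o9 := hc₁.numOne
  refine reach_cons (T := 49 * N ^ 2 + 8)
    (by simpa [Op.Fine, v1, z8] using hE1.win I.n le_rfl pos hpos)
    (reach_cons (T := 49 * N ^ 2 + 7) (by simpa [Op.Fine, Op.apply, z8] using hg.zero)
    (reach_cons (T := 49 * N ^ 2 + 6) (by simpa [Op.Fine, Op.apply, z8, o9] using hg.one) ?_))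
  set s₂ := Op.apply I (Op.apply I (Op.apply I s₁ (.numAdd 7 4 8)) (.numAdd 2 8 8)) (.numAdd 3 9 8)
    with hs₂
  have hf₂ : Frame (.op (.numAdd 7 4 8) ;; .op (.numAdd 2 8 8) ;; .op (.numAdd 3 9 8)) s₁ s₂ :=
    (frame_op I _ _).seq ((frame_op I _ _).seq (frame_op I _ _))
  have hc₂ : EvalContext I a b 0 s₂ := by
    constructor <;> simp [hs₂, Op.apply, hc₁.size, hc₁.one, hc₁.fst, hc₁.snd, hc₁.zero, z8, o9]
  have e3 : s₂.reg 3 = pos := (hf₂.reg 3 rfl).trans e3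
  have e1 : s₂.num 1 = _ := (hf₂.num 1 rfl).trans e1
  have e7 : s₂.num 7 = positionWin (modifiedEntry I a b 1) I.n pos := by
    simp [hs₂, Op.apply, v1, z8]
  clear_value s₂
  refine Reach.seq (T₁ := 49 * N ^ 2) (T₂ := 6) (reach_evalProg (pos := pos) hab.ne hg.zero
    (by simpa using hg.one) hE0 hc₂ hpos e3) ?_ (by omega)
  intro s₃ hf₃ v0
  have hc₃ := hc₂.of_frame hf₃ rfl
  have e7 : s₃.num 7 = _ := (hf₃.num 7 rfl).trans e7
  have e1 : s₃.num 1 = _ := (hf₃.num 1 rfl).trans e1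
  refine reach_cons (T := 5)
    (by simpa [Op.Fine, e7, v0, instanceSlope] using hg.slope a b hab hb)
    (reach_cons (T := 4) trivial ?_)
  have hstep : partialGain I pos a (b + 1) = partialGain I pos a b +
      gain (I.entry a b) (instanceSlope I pos a b) := by
    rw [partialGain, partialGain, Finset.sum_Ico_succ_top (by omega), add_assoc]
  have hgs := hg.sum a (by omega) (b + 1) hb
  rw [hstep] at hgs ⊢
  set s₄ := Op.apply I (Op.apply I s₃ (.numSub 7 7 4)) (.readEntry 5 4 5) with hs₄
  have g7 : s₄.num 7 = instanceSlope I pos a b := by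
    simp [hs₄, Op.apply, e7, v0, instanceSlope]
  have g5 : s₄.num 5 = I.entry a b := by simp [hs₄, Op.apply, hc₃.fst, hc₃.snd]
  have g1 : s₄.num 1 = partialGain I pos a b := by simp [hs₄, Op.apply, e1]
  have g8 : s₄.num 8 = 0 := by simp [hs₄, Op.apply, hc₃.numZero]
  have g9 : s₄.num 9 = 1 := by simp [hs₄, Op.apply, hc₃.numOne]
  have r5 : s₄.reg 5 = b := by simp [hs₄, Op.apply, hc₃.snd]
  have r2 : s₄.reg 2 = 1 := by simp [hs₄, Op.apply, hc₃.one]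
  clear_value s₄
  refine Reach.seq (T₁ := 3) (T₂ := 1) (Q₁ := fun s' => s'.num 1 = partialGain I pos a b +
      gain (I.entry a b) (instanceSlope I pos a b)) ?_ ?_ le_rfl
  · unfold gain at hgs ⊢
    refine reach_branch (fun h => reach_branch (fun h' => reach_op ?_ le_rfl ?_)
      fun h' => reach_skip ?_) fun h => reach_branch (fun h' => reach_op ?_ le_rfl ?_)
      fun h' => reach_skip ?_
    all_goals
      simp only [Test.Holds, g5, g7, g8, g9] at h h'
      simp only [h, h', if_true, if_false] at hgs ⊢
      first
        | simp [Op.apply, g1, g7, sub_eq_add_neg]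
        | simpa [Op.Fine, g1, g7, sub_eq_add_neg] using hgs
  · intro s₅ hf₅ hv
    refine reach_op trivial le_rfl ⟨?_, hv⟩
    simp [Op.apply, hf₅.reg 5 rfl, hf₅.reg 2 rfl, r5, r2]

/-- The program for arbitrary comparison matrices: it finds the position of the distinguished
player, adds up the contributions of all pairs of players, and multiplies the total by `ε`. -/
def generalProg : Program :=
  .op (.const 2 1) ;; .op (.numConst 9 1) ;;
  .loop (.lt 12 0) (.op (.readDraw 15 12) ;; .branch (.eq 15 1) (.op (.add 3 12 18)) skip ;;
    .op (.add 12 12 2)) ;;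
  .loop (.lt 4 0) (.op (.add 5 4 2) ;; .loop (.lt 5 0) pairProg ;; .op (.add 4 4 2)) ;;
  .op (.numMul 0 0 1)

lemma leaf_eq_iff {F : Type} (I : Instance F) {p : ℕ} (hp : p < 2 ^ I.n) (c : Fin (2 ^ I.n)) :
    I.leaf p = c ↔ p = I.draw.symm c := by
  rw [Instance.leaf, dif_pos hp, ← Fin.ext_iff, ← Equiv.eq_symm_apply, Fin.ext_iff]

lemma reach_generalProg (hg : GoodDrop good I (I.draw.symm I.player)) :
    Reach good I generalProg I.init (200 * (2 ^ I.n) ^ 4) (fun s' =>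
      s'.num 0 = I.eps * partialGain I (I.draw.symm I.player) (2 ^ I.n) 0) := by
  set pos : ℕ := ((I.draw.symm I.player : Fin (2 ^ I.n)) : ℕ) with hposdef
  have hpos : pos < 2 ^ I.n := (I.draw.symm I.player).2
  have hN1 := Nat.one_le_two_pow (n := I.n)
  set N := 2 ^ I.n with hN
  refine Reach.mono (T := N * 6 + 1 + (N * (N * (98 * N ^ 2 + 12) + 4) + 2) + 2) ?_ ?_
    fun _ _ h => h
  swap
  · have h2 : N ≤ N ^ 2 := by nlinarith
    have h3 : N ^ 2 ≤ N ^ 4 := Nat.pow_le_pow_right hN1 (by norm_num)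
    have h4 : N * (N * (98 * N ^ 2 + 12) + 4) = 98 * N ^ 4 + 12 * N ^ 2 + 4 * N := by ring
    rw [h4]
    omega
  refine reach_cons (T := N * 6 + 1 + (N * (N * (98 * N ^ 2 + 12) + 4) + 2) + 1) trivial
    (reach_cons (T := N * 6 + 1 + (N * (N * (98 * N ^ 2 + 12) + 4) + 2))
      (by simpa [Op.Fine] using hg.one) ?_)
  set s₀ := Op.apply I (Op.apply I I.init (.const 2 1)) (.numConst 9 1) with hs₀
  have e0 : s₀.reg 0 = N := by simp [hs₀, Op.apply, Instance.init, hN]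
  have e1 : s₀.reg 1 = I.player := by simp [hs₀, Op.apply, Instance.init]
  have e2 : s₀.reg 2 = 1 := by simp [hs₀, Op.apply]
  have e4 : s₀.reg 4 = 0 := by simp [hs₀, Op.apply, Instance.init]
  have e12 : s₀.reg 12 = 0 := by simp [hs₀, Op.apply, Instance.init]
  have e18 : s₀.reg 18 = 0 := by simp [hs₀, Op.apply, Instance.init]
  have g0 : s₀.num 0 = I.eps := by simp [hs₀, Op.apply, Instance.init]
  have g1 : s₀.num 1 = 0 := by simp [hs₀, Op.apply, Instance.init]
  have g8 : s₀.num 8 = 0 := by simp [hs₀, Op.apply, Instance.init]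
  have g9 : s₀.num 9 = 1 := by simp [hs₀, Op.apply]
  clear_value s₀
  refine Reach.seq (T₁ := N * 6 + 1) (T₂ := N * (N * (98 * N ^ 2 + 12) + 4) + 2)
    (reach_loop_const (fun j s' => s'.reg 12 = j ∧ (pos < j → s'.reg 3 = pos)) N 5
      ⟨e12, by simp⟩ ?_ ?_) ?_ le_rfl
  · rintro j hj s₁ hf ⟨f12, f3⟩
    have f0 : s₁.reg 0 = N := (hf.reg 0 rfl).trans e0
    have f1 : s₁.reg 1 = I.player := (hf.reg 1 rfl).trans e1
    have f2 : s₁.reg 2 = 1 := (hf.reg 2 rfl).trans e2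
    have f18 : s₁.reg 18 = 0 := (hf.reg 18 rfl).trans e18
    refine ⟨by simp only [Test.Holds, f12, f0]; omega, ?_⟩
    have hleaf := leaf_eq_iff I (p := j) hj I.player
    rw [← hposdef] at hleaf
    refine reach_cons trivial (Reach.seq (T₁ := 2) (T₂ := 1)
      (Q₁ := fun s' => pos < j + 1 → s'.reg 3 = pos)
      (reach_branch (fun h => reach_op trivial le_rfl fun hlt => ?_)
        fun h => reach_skip fun hlt => ?_) ?_ (by norm_num))
    · simp only [Test.Holds, Op.apply] at h
      simp [f12, f1, hleaf] at h
      simp [Op.apply, f12, f18, h]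
    · simp only [Test.Holds, Op.apply] at h
      simp [f12, f1, hleaf] at h
      simpa [Op.apply] using f3 (by omega)
    · intro s₂ hf₂ h3
      refine reach_op trivial le_rfl ⟨?_, fun hlt => ?_⟩
      · simp [Op.apply, hf₂.reg 12 rfl, hf₂.reg 2 rfl, f12, f2]
      · simpa [Op.apply] using h3 hlt
  · rintro s₁ hf ⟨f12, -⟩
    simp only [Test.Holds, f12, hf.reg 0 rfl, e0]
    omega
  rintro s₁ hf₁ ⟨-, f3⟩
  have hc₁ : MainContext I pos s₁ := ⟨(hf₁.reg 0 rfl).trans e0, (hf₁.reg 2 rfl).trans e2,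
    f3 hpos, (hf₁.reg 18 rfl).trans e18, (hf₁.num 0 rfl).trans g0, (hf₁.num 8 rfl).trans g8,
    (hf₁.num 9 rfl).trans g9⟩
  have e4 : s₁.reg 4 = 0 := (hf₁.reg 4 rfl).trans e4
  have g1 : s₁.num 1 = 0 := (hf₁.num 1 rfl).trans g1
  refine Reach.seq (T₁ := N * (N * (98 * N ^ 2 + 12) + 4) + 1) (T₂ := 1)
    (reach_loop_const (fun a s' => s'.reg 4 = a ∧ s'.num 1 = partialGain I pos a 0) N
      (N * (98 * N ^ 2 + 12) + 3) ⟨e4, by simp [g1, partialGain]⟩ ?_ ?_) ?_ le_rfl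
  · rintro a ha s₂ hf₂ ⟨f4, f1⟩
    refine ⟨by simp only [Test.Holds, f4, hf₂.reg 0 rfl, hc₁.size]; omega, ?_⟩
    refine reach_cons (T := N * (98 * N ^ 2 + 12) + 2) trivial ?_
    have hle : (N - (a + 1)) * (98 * N ^ 2 + 12) ≤ N * (98 * N ^ 2 + 12) :=
      Nat.mul_le_mul_right _ (Nat.sub_le _ _)
    refine Reach.seq (T₁ := (N - (a + 1)) * (98 * N ^ 2 + 12) + 1) (T₂ := 1)
      (reach_loop_const (fun j s' => s'.reg 5 = a + 1 + j ∧
        s'.num 1 = partialGain I pos a (a + 1 + j)) (N - (a + 1)) (98 * N ^ 2 + 11)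
        ⟨?_, ?_⟩ ?_ ?_) ?_ (by omega)
    · simp [Op.apply, f4, hf₂.reg 2 rfl, hc₁.one]
    · simp only [Op.apply]
      rw [f1]
      simp [partialGain]
    · rintro j hj s₃ hf₃ ⟨h5, h1⟩
      have hc₃ : MainContext I pos s₃ := by
        constructor
        · rw [hf₃.reg 0 rfl]; simp [Op.apply, hf₂.reg 0 rfl, hc₁.size]
        · rw [hf₃.reg 2 rfl]; simp [Op.apply, hf₂.reg 2 rfl, hc₁.one]
        · rw [hf₃.reg 3 rfl]; simp [Op.apply, hf₂.reg 3 rfl, hc₁.pos]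
        · rw [hf₃.reg 18 rfl]; simp [Op.apply, hf₂.reg 18 rfl, hc₁.zero]
        · rw [hf₃.num 0 rfl]; simp [Op.apply, hf₂.num 0 rfl, hc₁.eps]
        · rw [hf₃.num 8 rfl]; simp [Op.apply, hf₂.num 8 rfl, hc₁.numZero]
        · rw [hf₃.num 9 rfl]; simp [Op.apply, hf₂.num 9 rfl, hc₁.numOne]
      refine ⟨by simp only [Test.Holds, h5, hc₃.size]; omega, ?_⟩
      exact reach_pairProg (a := a) (b := a + 1 + j) hpos hg hc₃ (by omega) (by omega)
        (by rw [hf₃.reg 4 rfl]; simp [Op.apply, f4]) h5 h1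
    · rintro s₃ hf₃ ⟨h5, -⟩
      have h0 : s₃.reg 0 = N := by
        rw [hf₃.reg 0 rfl]; simp [Op.apply, hf₂.reg 0 rfl, hc₁.size, hN]
      simp only [Test.Holds, h5, h0]
      omega
    · rintro s₃ hf₃ ⟨-, h1⟩
      refine reach_op trivial le_rfl ⟨?_, ?_⟩
      · simp [Op.apply, hf₃.reg 4 rfl, hf₃.reg 2 rfl, f4, hf₂.reg 2 rfl, hc₁.one]
      · simp only [Op.apply, h1]
        rw [show a + 1 + (N - (a + 1)) = N by omega, partialGain, partialGain,
          Finset.sum_range_succ, Finset.Ico_eq_empty (by omega : ¬ a + 1 + 1 < 0),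
          Finset.sum_empty, add_zero]
  · rintro s₂ hf₂ ⟨f4, -⟩
    simp only [Test.Holds, f4, hf₂.reg 0 rfl, hc₁.size]
    omega
  · rintro s₂ hf₂ ⟨-, f1⟩
    have f0 : s₂.num 0 = I.eps := (hf₂.num 0 rfl).trans hc₁.eps
    refine reach_op ?_ le_rfl ?_
    · simpa [Op.Fine, f0, f1] using hg.result
    · simp [Op.apply, f0, f1]

end General

/-! ### The output of the program for arbitrary matrices -/

lemma sum_pairs_eq_sum_range {R : Type*} [AddCommMonoid R] {N : ℕ} (g : ℕ → ℕ → R) :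
    ∑ a : Fin N, ∑ b ∈ Finset.univ.filter (fun b => a < b), g a b =
      ∑ a ∈ Finset.range N, ∑ b ∈ Finset.Ico (a + 1) N, g a b := by
  rw [← Fin.sum_univ_eq_sum_range (fun a => ∑ b ∈ Finset.Ico (a + 1) N, g a b)]
  refine Finset.sum_congr rfl fun a _ => ?_
  have h : Finset.Ico ((a : ℕ) + 1) N = (Finset.range N).filter fun b => (a : ℕ) < b := by
    ext b
    simp only [Finset.mem_Ico, Finset.mem_filter, Finset.mem_range]
    omega
  rw [h, Finset.sum_filter, Finset.sum_filter,
    ← Fin.sum_univ_eq_sum_range (fun b => if (a : ℕ) < b then g a b else 0)]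
  simp only [Fin.lt_def]

lemma leaf_lt {F : Type} (I : Instance F) (p : ℕ) : I.leaf p < 2 ^ I.n := by
  unfold Instance.leaf
  split_ifs
  · exact Fin.is_lt _
  · exact Nat.two_pow_pos _

lemma entry_leaf {F : Type} [CommRing F] (I : Instance F) {p q : ℕ} (hp : p < 2 ^ I.n)
    (hq : q < 2 ^ I.n) : I.entry (I.leaf p) (I.leaf q) = byPosition I.mat I.draw p q := by
  rw [Instance.entry, dif_pos ⟨leaf_lt I p, leaf_lt I q⟩, byPosition]
  have h : ∀ r < 2 ^ I.n, ∀ h : I.leaf r < 2 ^ I.n,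
      (⟨I.leaf r, h⟩ : Fin (2 ^ I.n)) = I.draw (Fin.ofNat (2 ^ I.n) r) := by
    intro r hr h
    rw [Fin.ext_iff]
    dsimp only
    rw [leaf_eq_iff I hr, Equiv.symm_apply_apply, val_ofNat hr]
  rw [h p hp, h q hq]

lemma modifiedEntry_eq {F : Type} [CommRing F] (I : Instance F) (a b : Fin (2 ^ I.n)) (x : F)
    {p q : ℕ} (hp : p < 2 ^ I.n) (hq : q < 2 ^ I.n) :
    modifiedEntry I a b x p q =
      replaceMatch (byPosition I.mat I.draw) (I.draw.symm a) (I.draw.symm b) x p q := by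
  simp only [modifiedEntry, replaceMatch, leaf_eq_iff I hp, leaf_eq_iff I hq, entry_leaf I hp hq]

lemma instanceSlope_eq {F : Type} [CommRing F] (I : Instance F) (a b : Fin (2 ^ I.n)) :
    instanceSlope I (I.draw.symm I.player) a b = playerSlope I.player I.mat I.draw a b := by
  have h : ∀ x, positionWin (modifiedEntry I a b x) I.n (I.draw.symm I.player) =
      blockValue (replaceMatch (byPosition I.mat I.draw) (I.draw.symm a) (I.draw.symm b) x) I.n 0
        (pointMass F (I.draw.symm I.player)) := by
    intro x
    rw [positionWin_top _ (Fin.is_lt _), blockValue_pointMass, if_pos (by simp)]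
    refine blockWin_congr _ _ (fun p hp q hq _ => ?_) _ (by simp)
    simp only [Finset.mem_Ico, zero_add] at hp hq
    exact modifiedEntry_eq I a b x hp.2 hq.2
  rw [instanceSlope, h, h, playerSlope, slope]

lemma partialGain_eq {F : Type} [CommRing F] [LinearOrder F] (I : Instance F) :
    partialGain I (I.draw.symm I.player) (2 ^ I.n) 0 =
      ∑ a, ∑ b ∈ Finset.univ.filter (fun b => a < b),
        gain (I.mat a b) (playerSlope I.player I.mat I.draw a b) := by
  rw [partialGain, Finset.Ico_eq_empty (Nat.not_lt_zero _), Finset.sum_empty, add_zero,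
    ← sum_pairs_eq_sum_range]
  refine Finset.sum_congr rfl fun a _ => Finset.sum_congr rfl fun b _ => ?_
  rw [instanceSlope_eq, Instance.entry, dif_pos ⟨a.2, b.2⟩]

lemma gain_eq_matchDrop {p : ℝ} (h0 : 0 ≤ p) (h1 : p ≤ 1) (α : ℝ) : gain p α = matchDrop p α := by
  unfold gain matchDrop
  rcases h0.eq_or_lt with rfl | h0
  · rcases lt_or_ge 0 α with h | h
    · simp [h, h.le]
    · simp [h, h.not_gt]
  · rcases h1.eq_or_lt with rfl | h1
    · rcases lt_or_ge 0 α with h | h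
      · simp [h, h.le]
      · simp [h, h.not_gt]
    · rcases lt_or_ge 0 α with h | h
      · simp [h, h0, h0.ne', h1.ne, abs_of_pos h]
      · simp [h.not_gt, h0.ne', h1, h1.ne, abs_of_nonpos h]

lemma firstOrderDrop_eq_gain {n : ℕ} {P : Matrix (Fin (2 ^ n)) (Fin (2 ^ n)) ℝ}
    (hP : IsComparison P) (σ : Equiv.Perm (Fin (2 ^ n))) (i : Fin (2 ^ n)) (ε : ℝ) :
    firstOrderDrop i P σ ε = ε * ∑ a, ∑ b ∈ Finset.univ.filter (fun b => a < b),
      gain (P a b) (playerSlope i P σ a b) := by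
  rw [firstOrderDrop_eq_sum hP, mul_comm]
  congr 1
  refine Finset.sum_congr rfl fun a _ => Finset.sum_congr rfl fun b hb => ?_
  have h := hP a b (ne_of_lt (Finset.mem_filter.1 hb).2)
  rw [gain_eq_matchDrop h.1 h.2.1]

lemma goodDrop_true {F : Type} [CommRing F] [LinearOrder F] (I : Instance F) (pos : ℕ) :
    GoodDrop (fun _ => True) I pos := by
  constructor <;> intros <;> first | trivial | (constructor <;> intros <;> trivial)

lemma outputs_generalProg_unitCost {n : ℕ} {P : Matrix (Fin (2 ^ n)) (Fin (2 ^ n)) ℝ}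
    (hP : IsComparison P) (i : Fin (2 ^ n)) (σ : Equiv.Perm (Fin (2 ^ n))) (ε : ℝ) :
    Outputs (unitCost ℝ) generalProg ⟨n, i, P, σ, ε⟩ (firstOrderDrop i P σ ε)
      (200 * (2 ^ n) ^ 4) := by
  obtain ⟨s, t, he, ht, hv⟩ := reach_generalProg (goodDrop_true ⟨n, i, P, σ, ε⟩ _)
  refine ⟨s, t, he.run, ?_, ht⟩
  rw [hv, partialGain_eq, firstOrderDrop_eq_gain hP]

lemma cast_playerSlope {n : ℕ} (P : Matrix (Fin (2 ^ n)) (Fin (2 ^ n)) ℚ)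
    (σ : Equiv.Perm (Fin (2 ^ n))) (i a b : Fin (2 ^ n)) :
    ((playerSlope i P σ a b : ℚ) : ℝ) =
      playerSlope i (P.map fun q : ℚ => (q : ℝ)) σ a b := by
  have h := slope_map (Rat.castHom ℝ) (byPosition P σ) n 0 (pointMass ℚ (σ.symm i))
    (σ.symm a) (σ.symm b)
  rw [playerSlope, playerSlope]
  refine (h.trans ?_)
  congr 1
  funext p
  simp [pointMass, apply_ite]

lemma cast_gain (p α : ℚ) : ((gain p α : ℚ) : ℝ) = gain (p : ℝ) (α : ℝ) := by
  unfold gain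
  have h1 : (0 : ℝ) < α ↔ 0 < α := by exact_mod_cast Iff.rfl
  have h2 : (0 : ℝ) < p ↔ 0 < p := by exact_mod_cast Iff.rfl
  have h3 : (p : ℝ) < 1 ↔ p < 1 := by exact_mod_cast Iff.rfl
  simp only [h1, h2, h3]
  split_ifs <;> simp

/-! ### Bit cost -/

/-- A literal of the program is larger than `1`. -/
def Op.largeConst : Op → Bool
  | .const _ c => decide (1 < c)
  | _ => false

lemma ratBits_intCast (c : ℤ) : c.natAbs.size ≤ ratBits (c : ℚ) := by
  simp [ratBits]

/-- One step at most doubles the natural numbers in the machine, so over `t` steps their bit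
lengths grow by `t` at most; the bit lengths of the numbers are bounded by assumption. -/
lemma Exec.run_bitCost {good : ℚ → Prop} {I : Instance ℚ} {S : ℕ}
    (hS : ∀ q, good q → ratBits q ≤ S) (hentry : ∀ a b, good (I.entry a b))
    {p : Program} {s s' : State ℚ} {t : ℕ} (h : Exec good I p s s' t) :
    p.any Op.largeConst = false → ∀ B, 1 ≤ B → I.n ≤ B →
      (∀ k, s.reg k < 2 ^ B) → (∀ k, s.mem k < 2 ^ B) →
      (∀ k, good (s.num k)) → (∀ k, good (s.numMem k)) →
      ∃ t', Run bitCost I p s s' t' ∧ t' ≤ t * (2 * (B + t) + 2 * S + 1) ∧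
        (∀ k, s'.reg k < 2 ^ (B + t)) ∧ (∀ k, s'.mem k < 2 ^ (B + t)) ∧
        (∀ k, good (s'.num k)) ∧ (∀ k, good (s'.numMem k)) := by
  have htest : ∀ (s : State ℚ) (c : Test) (B : ℕ), (∀ k, s.reg k < 2 ^ B) →
      (∀ k, good (s.num k)) → bitCost.test s c ≤ 2 * B + 2 * S + 1 := by
    intro s c B hr hn
    have hr' : ∀ k, (s.reg k).size ≤ B := fun k => Nat.size_le.2 (hr k)
    have hn' : ∀ k, ratBits (s.num k) ≤ S := fun k => hS _ (hn k)
    cases c with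
    | lt a b => have := hr' a; have := hr' b; simp only [bitCost]; omega
    | eq a b => have := hr' a; have := hr' b; simp only [bitCost]; omega
    | numLt a b => have := hn' a; have := hn' b; simp only [bitCost]; omega
  have hmono : ∀ {x t B B' : ℕ}, x ≤ t * (2 * B + 2 * S + 1) → B ≤ B' →
      x ≤ t * (2 * B' + 2 * S + 1) := fun h hB =>
    h.trans (Nat.mul_le_mul_left _ (by omega))
  induction h with
  | op o s hf =>
    intro hconst B hB hnB hr hm hn hM
    have hr' : ∀ k, (s.reg k).size ≤ B := fun k => Nat.size_le.2 (hr k)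
    have hm' : ∀ k, (s.mem k).size ≤ B := fun k => Nat.size_le.2 (hm k)
    have hn' : ∀ k, ratBits (s.num k) ≤ S := fun k => hS _ (hn k)
    have hM' : ∀ k, ratBits (s.numMem k) ≤ S := fun k => hS _ (hM k)
    have hl : ∀ p, I.leaf p < 2 ^ B := fun p =>
      (leaf_lt I p).trans_le (Nat.pow_le_pow_right (by norm_num) hnB)
    have hl' : ∀ p, (I.leaf p).size ≤ B := fun p => Nat.size_le.2 (hl p)
    have hle : 2 ^ B ≤ 2 ^ (B + 1) := Nat.pow_le_pow_right (by norm_num) (by omega)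
    have hpow : 2 ^ (B + 1) = 2 ^ B + 2 ^ B := by rw [pow_succ]; ring
    have hup : ∀ (f : ℕ → ℕ) (d v : ℕ), (∀ k, f k < 2 ^ B) → v < 2 ^ (B + 1) →
        ∀ k, Function.update f d v k < 2 ^ (B + 1) := by
      intro f d v hf hv k
      rw [Function.update_apply]
      split_ifs
      exacts [hv, (hf k).trans_le hle]
    have hup' : ∀ (f : ℕ → ℚ) (d : ℕ) (v : ℚ), (∀ k, good (f k)) → good v →
        ∀ k, good (Function.update f d v k) := by
      intro f d v hf hv k
      rw [Function.update_apply]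
      split_ifs
      exacts [hv, hf k]
    have h1 : 1 < 2 ^ (B + 1) := Nat.one_lt_two_pow (by omega)
    have hrr : ∀ k, s.reg k < 2 ^ (B + 1) := fun k => (hr k).trans_le hle
    have hmm : ∀ k, s.mem k < 2 ^ (B + 1) := fun k => (hm k).trans_le hle
    refine ⟨_, Run.op o s, ?_⟩
    cases o with
    | const d c =>
      have hc : c ≤ 1 := by simpa [Program.any, Op.largeConst] using hconst
      have hc' : c.size ≤ 1 := Nat.size_le.2 (by omega)
      exact ⟨by simp only [bitCost]; omega, hup _ _ _ hr (by omega), hmm, hn, hM⟩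
    | add d a b =>
      have := hr' a; have := hr' b; have := hr a; have := hr b
      exact ⟨by simp only [bitCost]; omega, hup _ _ _ hr (by omega), hmm, hn, hM⟩
    | sub d a b =>
      have := hr' a; have := hr' b; have := hrr a
      exact ⟨by simp only [bitCost]; omega, hup _ _ _ hr (by omega), hmm, hn, hM⟩
    | half d a =>
      have := hr' a; have := hrr a
      exact ⟨by simp only [bitCost]; omega, hup _ _ _ hr (by omega), hmm, hn, hM⟩
    | load d a =>
      have := hr' a; have := hm' (s.reg a)
      exact ⟨by simp only [bitCost]; omega, hup _ _ _ hr (hmm _), hmm, hn, hM⟩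
    | store a b =>
      have := hr' a; have := hr' b
      exact ⟨by simp only [bitCost]; omega, hrr, hup _ _ _ hm (hrr _), hn, hM⟩
    | readDraw d a =>
      have := hr' a; have := hl' (s.reg a)
      exact ⟨by simp only [bitCost]; omega, hup _ _ _ hr ((hl _).trans_le hle), hmm, hn, hM⟩
    | numConst d c =>
      have := (ratBits_intCast c).trans (hS _ hf)
      exact ⟨by simp only [bitCost]; omega, hrr, hmm, hup' _ _ _ hn hf, hM⟩
    | numAdd d a b =>
      have := hn' a; have := hn' b
      exact ⟨by simp only [bitCost]; omega, hrr, hmm, hup' _ _ _ hn hf, hM⟩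
    | numSub d a b =>
      have := hn' a; have := hn' b
      exact ⟨by simp only [bitCost]; omega, hrr, hmm, hup' _ _ _ hn hf, hM⟩
    | numMul d a b =>
      have := hn' a; have := hn' b
      exact ⟨by simp only [bitCost]; omega, hrr, hmm, hup' _ _ _ hn hf, hM⟩
    | numLoad d a =>
      have := hr' a; have := hM' (s.reg a)
      exact ⟨by simp only [bitCost]; omega, hrr, hmm, hup' _ _ _ hn (hM _), hM⟩
    | numStore a b =>
      have := hr' a; have := hn' b
      exact ⟨by simp only [bitCost]; omega, hrr, hmm, hn, hup' _ _ _ hM (hn _)⟩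
    | readEntry d a b =>
      have := hr' a; have := hr' b; have := hS _ (hentry (s.reg a) (s.reg b))
      exact ⟨by simp only [bitCost]; omega, hrr, hmm, hup' _ _ _ hn (hentry _ _), hM⟩
  | @seq p q s₀ s₁ s₂ t₁ t₂ _ _ ih ih' =>
    intro hconst B hB hnB hr hm hn hM
    have hc : p.any Op.largeConst = false ∧ q.any Op.largeConst = false :=
      Bool.or_eq_false_iff.1 hconst
    obtain ⟨u, hu, hut, hr, hm, hn, hM⟩ := ih hc.1 B hB hnB hr hm hn hM
    obtain ⟨u', hu', hut', hr, hm, hn, hM⟩ := ih' hc.2 (B + t₁) (by omega) (by omega) hr hm hn hM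
    rw [show B + t₁ + t₂ = B + (t₁ + t₂) by omega] at hut' hr hm
    refine ⟨u + u', hu.seq hu', ?_, hr, hm, hn, hM⟩
    have := hmono hut (show B + t₁ ≤ B + (t₁ + t₂) by omega)
    rw [add_mul]
    omega
  | @branchTrue c p q s₀ s₁ t₁ hcond _ ih =>
    intro hconst B hB hnB hr hm hn hM
    have hc : p.any Op.largeConst = false ∧ q.any Op.largeConst = false :=
      Bool.or_eq_false_iff.1 hconst
    have h1 := htest _ c B hr hn
    obtain ⟨u, hu, hut, hr, hm, hn, hM⟩ := ih hc.1 B hB hnB hr hm hn hM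
    have hle : 2 ^ (B + t₁) ≤ 2 ^ (B + (1 + t₁)) := Nat.pow_le_pow_right (by norm_num) (by omega)
    refine ⟨_, Run.branchTrue hcond hu, ?_, fun k => (hr k).trans_le hle,
      fun k => (hm k).trans_le hle, hn, hM⟩
    have := hmono hut (show B + t₁ ≤ B + (1 + t₁) by omega)
    rw [add_mul, one_mul]
    omega
  | @branchFalse c p q s₀ s₁ t₁ hcond _ ih =>
    intro hconst B hB hnB hr hm hn hM
    have hc : p.any Op.largeConst = false ∧ q.any Op.largeConst = false :=
      Bool.or_eq_false_iff.1 hconst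
    have h1 := htest _ c B hr hn
    obtain ⟨u, hu, hut, hr, hm, hn, hM⟩ := ih hc.2 B hB hnB hr hm hn hM
    have hle : 2 ^ (B + t₁) ≤ 2 ^ (B + (1 + t₁)) := Nat.pow_le_pow_right (by norm_num) (by omega)
    refine ⟨_, Run.branchFalse hcond hu, ?_, fun k => (hr k).trans_le hle,
      fun k => (hm k).trans_le hle, hn, hM⟩
    have := hmono hut (show B + t₁ ≤ B + (1 + t₁) by omega)
    rw [add_mul, one_mul]
    omega
  | @loopEnd c p s₀ hcond =>
    intro hconst B hB hnB hr hm hn hM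
    have h1 := htest _ c B hr hn
    have hle : 2 ^ B ≤ 2 ^ (B + 1) := Nat.pow_le_pow_right (by norm_num) (by omega)
    exact ⟨_, Run.loopEnd hcond, by omega, fun k => (hr k).trans_le hle,
      fun k => (hm k).trans_le hle, hn, hM⟩
  | @loopStep c p s₀ s₁ s₂ t₁ t₂ hcond _ _ ih ih' =>
    intro hconst B hB hnB hr hm hn hM
    have h1 := htest _ c B hr hn
    obtain ⟨u, hu, hut, hr, hm, hn, hM⟩ := ih hconst B hB hnB hr hm hn hM
    obtain ⟨u', hu', hut', hr, hm, hn, hM⟩ := ih' hconst (B + t₁) (by omega) (by omega) hr hm hn hM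
    rw [show B + t₁ + t₂ = B + (t₁ + t₂) by omega] at hut' hr hm
    have hle : 2 ^ (B + (t₁ + t₂)) ≤ 2 ^ (B + (1 + t₁ + t₂)) :=
      Nat.pow_le_pow_right (by norm_num) (by omega)
    refine ⟨_, Run.loopStep hcond hu hu', ?_, fun k => (hr k).trans_le hle,
      fun k => (hm k).trans_le hle, hn, hM⟩
    have h2 := hmono hut (show B + t₁ ≤ B + (1 + t₁ + t₂) by omega)
    have h3 := hmono hut' (show B + (t₁ + t₂) ≤ B + (1 + t₁ + t₂) by omega)
    rw [add_mul, add_mul, one_mul]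
    omega

/-! ### The size of the numbers in a rational computation -/

section Bounds

variable {R : Type*} [CommRing R] [LinearOrder R] [IsStrictOrderedRing R] {Q : ℕ → ℕ → R}

lemma blockWin_nonneg (k : ℕ) : ∀ m,
    (∀ p ∈ Finset.Ico m (m + 2 ^ k), ∀ q ∈ Finset.Ico m (m + 2 ^ k), p ≠ q → 0 ≤ Q p q) →
    ∀ p ∈ Finset.Ico m (m + 2 ^ k), 0 ≤ blockWin Q k m p := by
  induction k with
  | zero => intros; exact zero_le_one
  | succ k ih =>
    intro m h p hp
    simp only [Finset.mem_Ico, pow_succ, mul_two] at h hp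
    have hL := ih m fun p hp q hq => by
      simp only [Finset.mem_Ico] at hp hq
      exact h p (by omega) q (by omega)
    have hR := ih (m + 2 ^ k) fun p hp q hq => by
      simp only [Finset.mem_Ico] at hp hq
      exact h p (by omega) q (by omega)
    simp only [Finset.mem_Ico] at hL hR
    unfold blockWin
    split_ifs with hc
    · refine mul_nonneg (hL p (by omega)) (Finset.sum_nonneg fun q hq => ?_)
      simp only [Finset.mem_Ico] at hq
      exact mul_nonneg (hR q hq) (h p (by omega) q (by omega) (by omega))
    · refine mul_nonneg (hR p (by omega)) (Finset.sum_nonneg fun q hq => ?_)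
      simp only [Finset.mem_Ico] at hq
      exact mul_nonneg (hL q hq) (h p (by omega) q (by omega) (by omega))

/-- Some player of the block wins. -/
lemma sum_blockWin {R : Type*} [CommRing R] {Q : ℕ → ℕ → R} (k : ℕ) : ∀ m,
    (∀ p ∈ Finset.Ico m (m + 2 ^ k), ∀ q ∈ Finset.Ico m (m + 2 ^ k), p ≠ q →
      Q p q + Q q p = 1) →
    ∑ p ∈ Finset.Ico m (m + 2 ^ k), blockWin Q k m p = 1 := by
  induction k with
  | zero => intro m _; simp [blockWin]
  | succ k ih =>
    intro m h
    have h1 := blockValue_succ Q k m fun _ => 1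
    simp only [blockValue, mul_one] at h1
    rw [h1]
    simp only [Finset.mem_Ico, pow_succ, mul_two] at h
    rw [Finset.sum_congr rfl fun p hp => Finset.sum_congr rfl fun q hq => by
      simp only [Finset.mem_Ico] at hp hq
      rw [h p (by omega) q (by omega) (by omega), mul_one]]
    have hL := ih m fun p hp q hq => by
      simp only [Finset.mem_Ico] at hp hq
      exact h p (by omega) q (by omega)
    have hR := ih (m + 2 ^ k) fun p hp q hq => by
      simp only [Finset.mem_Ico] at hp hq
      exact h p (by omega) q (by omega)
    rw [← Finset.sum_mul_sum, hL, hR, one_mul]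

lemma div_pow_mul_pow_add_le {n k p : ℕ} (hk : k ≤ n) (hp : p < 2 ^ n) :
    p / 2 ^ k * 2 ^ k + 2 ^ k ≤ 2 ^ n := by
  obtain ⟨d, rfl⟩ := Nat.exists_eq_add_of_le hk
  rw [pow_add] at hp ⊢
  have h : p / 2 ^ k < 2 ^ d := Nat.div_lt_of_lt_mul hp
  calc p / 2 ^ k * 2 ^ k + 2 ^ k = (p / 2 ^ k + 1) * 2 ^ k := by ring
    _ ≤ 2 ^ d * 2 ^ k := Nat.mul_le_mul_right _ h
    _ = 2 ^ k * 2 ^ d := mul_comm _ _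

lemma positionWin_mem {n : ℕ}
    (hQ : ∀ p < 2 ^ n, ∀ q < 2 ^ n, p ≠ q → 0 ≤ Q p q ∧ Q p q + Q q p = 1) {k p : ℕ}
    (hk : k ≤ n) (hp : p < 2 ^ n) : 0 ≤ positionWin Q k p ∧ positionWin Q k p ≤ 1 := by
  have hle := div_pow_mul_pow_add_le hk hp
  set m := p / 2 ^ k * 2 ^ k with hm
  have hpm : p ∈ Finset.Ico m (m + 2 ^ k) := by
    rw [Finset.mem_Ico]
    have h1 := Nat.div_add_mod' p (2 ^ k)
    have h2 := Nat.mod_lt p (Nat.two_pow_pos k)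
    omega
  have h0 := blockWin_nonneg (Q := Q) k m fun p hp q hq hpq => by
    simp only [Finset.mem_Ico] at hp hq
    exact (hQ p (by omega) q (by omega) hpq).1
  have h1 := sum_blockWin (Q := Q) k m fun p hp q hq hpq => by
    simp only [Finset.mem_Ico] at hp hq
    exact (hQ p (by omega) q (by omega) hpq).2
  refine ⟨h0 p hpm, ?_⟩
  rw [← h1]
  exact Finset.single_le_sum (f := fun p => blockWin Q k m p) h0 hpm

end Bounds

/-- The denominator of `q` divides `D ^ e`. -/
def HasDenom (D e : ℕ) (q : ℚ) : Prop := ∃ z : ℤ, q * (D : ℚ) ^ e = z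

lemma HasDenom.mono {D e e' : ℕ} {q : ℚ} (h : HasDenom D e q) (he : e ≤ e') :
    HasDenom D e' q := by
  obtain ⟨z, hz⟩ := h
  obtain ⟨d, rfl⟩ := Nat.exists_eq_add_of_le he
  exact ⟨z * D ^ d, by rw [pow_add, ← mul_assoc, hz]; push_cast; ring⟩

lemma HasDenom.mul {D e e' : ℕ} {q q' : ℚ} (h : HasDenom D e q) (h' : HasDenom D e' q') :
    HasDenom D (e + e') (q * q') := by
  obtain ⟨z, hz⟩ := h
  obtain ⟨z', hz'⟩ := h'
  exact ⟨z * z', by push_cast; rw [← hz, ← hz', pow_add]; ring⟩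

lemma HasDenom.add {D e : ℕ} {q q' : ℚ} (h : HasDenom D e q) (h' : HasDenom D e q') :
    HasDenom D e (q + q') := by
  obtain ⟨z, hz⟩ := h
  obtain ⟨z', hz'⟩ := h'
  exact ⟨z + z', by push_cast; rw [← hz, ← hz']; ring⟩

lemma HasDenom.neg {D e : ℕ} {q : ℚ} (h : HasDenom D e q) : HasDenom D e (-q) := by
  obtain ⟨z, hz⟩ := h
  exact ⟨-z, by push_cast; rw [← hz]; ring⟩

lemma hasDenom_intCast (D e : ℕ) (z : ℤ) : HasDenom D e z :=
  ⟨z * D ^ e, by push_cast; ring⟩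

lemma HasDenom.sum {ι : Type*} {D e : ℕ} {s : Finset ι} {f : ι → ℚ}
    (h : ∀ j ∈ s, HasDenom D e (f j)) : HasDenom D e (∑ j ∈ s, f j) := by
  classical
  induction s using Finset.induction_on with
  | empty => simpa using hasDenom_intCast D e 0
  | insert a s ha ih =>
    rw [Finset.sum_insert ha]
    exact (h a (Finset.mem_insert_self a s)).add
      (ih fun j hj => h j (Finset.mem_insert_of_mem hj))

/-- A block of height `k` contains `2 ^ k - 1` matches, each of which contributes one factor to
the denominator. -/
lemma hasDenom_blockWin {D : ℕ} {Q : ℕ → ℕ → ℚ} (hQ : ∀ p q, HasDenom D 1 (Q p q)) (k : ℕ) :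
    ∀ m p, HasDenom D (2 ^ k - 1) (blockWin Q k m p) := by
  induction k with
  | zero => intro m p; simpa [blockWin] using hasDenom_intCast D 0 1
  | succ k ih =>
    intro m p
    have hk := Nat.one_le_two_pow (n := k)
    have he : 2 ^ k - 1 + (2 ^ k - 1 + 1) = 2 ^ (k + 1) - 1 := by rw [pow_succ]; omega
    unfold blockWin
    rw [← he]
    split_ifs
    · exact (ih _ _).mul (HasDenom.sum fun q _ => (ih _ _).mul (hQ p q))
    · exact (ih _ _).mul (HasDenom.sum fun q _ => (ih _ _).mul (hQ p q))

lemma hasDenom_of_den_dvd {D : ℕ} {q : ℚ} (h : q.den ∣ D) : HasDenom D 1 q := by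
  obtain ⟨c, rfl⟩ := h
  refine ⟨q.num * c, ?_⟩
  push_cast
  rw [pow_one, ← mul_assoc, Rat.mul_den_eq_num]

/-- A common denominator of the entries of an instance. -/
def commonDenom (I : Instance ℚ) : ℕ := ∏ a, ∏ b, (I.mat a b).den

/-- A common denominator of all numbers that come up on an instance: the winning probabilities are
sums of products of at most `2 ^ n - 1` entries. -/
def fullDenom (I : Instance ℚ) : ℕ := commonDenom I ^ 2 ^ I.n * I.eps.den

/-- A bound for the absolute value of all numbers that come up on an instance. -/
def fullBound (I : Instance ℚ) : ℕ :=
  (2 ^ I.n) ^ 2 + I.eps.num.natAbs * (2 ^ I.n) ^ 2 + I.eps.num.natAbs +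
    ∑ a, ∑ b, (I.mat a b).num.natAbs

/-- The numbers that may come up on an instance: `fullDenom I` is a denominator and `fullBound I` a
bound for the absolute value. -/
def IsBounded (I : Instance ℚ) (q : ℚ) : Prop :=
  (∃ z : ℤ, q * fullDenom I = z) ∧ |q| ≤ fullBound I

lemma abs_le_natAbs_num (q : ℚ) : |q| ≤ (q.num.natAbs : ℚ) := by
  have h1 : (1 : ℚ) ≤ q.den := by exact_mod_cast q.den_pos
  have h2 : |q| * q.den = (q.num.natAbs : ℚ) := by
    rw [← abs_of_pos (lt_of_lt_of_le one_pos h1), ← abs_mul, Rat.mul_den_eq_num, Nat.cast_natAbs,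
      Int.cast_abs]
  rw [← h2]
  exact le_mul_of_one_le_right (abs_nonneg q) h1

lemma commonDenom_pos (I : Instance ℚ) : 0 < commonDenom I :=
  Finset.prod_pos fun a _ => Finset.prod_pos fun b _ => (I.mat a b).den_pos

lemma fullDenom_pos (I : Instance ℚ) : 0 < fullDenom I :=
  Nat.mul_pos (Nat.pow_pos (commonDenom_pos I)) I.eps.den_pos

lemma isBounded_of_hasDenom {I : Instance ℚ} {q : ℚ}
    (h : HasDenom (commonDenom I) (2 ^ I.n) q) (hq : |q| ≤ (fullBound I : ℚ)) :
    IsBounded I q := by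
  obtain ⟨z, hz⟩ := h
  refine ⟨⟨z * I.eps.den, ?_⟩, hq⟩
  rw [fullDenom]
  push_cast
  rw [← mul_assoc, hz]

lemma sq_le_fullBound (I : Instance ℚ) : (((2 ^ I.n) ^ 2 : ℕ) : ℚ) ≤ fullBound I := by
  exact_mod_cast (by unfold fullBound; omega : (2 ^ I.n) ^ 2 ≤ fullBound I)

lemma isBounded_eps (I : Instance ℚ) : IsBounded I I.eps := by
  refine ⟨⟨I.eps.num * commonDenom I ^ 2 ^ I.n, ?_⟩, (abs_le_natAbs_num _).trans ?_⟩
  · rw [fullDenom]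
    push_cast
    rw [← Rat.mul_den_eq_num]
    ring
  · exact_mod_cast (by unfold fullBound; omega : I.eps.num.natAbs ≤ fullBound I)

lemma hasDenom_entry (I : Instance ℚ) (a b : ℕ) : HasDenom (commonDenom I) 1 (I.entry a b) := by
  unfold Instance.entry
  split_ifs with h
  · refine hasDenom_of_den_dvd ?_
    exact (Finset.dvd_prod_of_mem (fun b => (I.mat ⟨a, h.1⟩ b).den) (Finset.mem_univ _)).trans
      (Finset.dvd_prod_of_mem (fun a => ∏ b, (I.mat a b).den) (Finset.mem_univ _))
  · simpa using hasDenom_intCast _ 1 0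

lemma isBounded_entry (I : Instance ℚ) (a b : ℕ) : IsBounded I (I.entry a b) := by
  refine isBounded_of_hasDenom ((hasDenom_entry I a b).mono Nat.one_le_two_pow) ?_
  unfold Instance.entry
  split_ifs with h
  · refine (abs_le_natAbs_num _).trans ?_
    have h1 : (I.mat ⟨a, h.1⟩ ⟨b, h.2⟩).num.natAbs ≤ ∑ a, ∑ b, (I.mat a b).num.natAbs :=
      (Finset.single_le_sum (f := fun b => (I.mat ⟨a, h.1⟩ b).num.natAbs)
        (fun _ _ => Nat.zero_le _) (Finset.mem_univ _)).trans
      (Finset.single_le_sum (f := fun a => ∑ b, (I.mat a b).num.natAbs)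
        (fun _ _ => Nat.zero_le _) (Finset.mem_univ _))
    exact_mod_cast (by unfold fullBound; omega :
      (I.mat ⟨a, h.1⟩ ⟨b, h.2⟩).num.natAbs ≤ fullBound I)
  · simp

lemma hasDenom_modifiedEntry (I : Instance ℚ) (a b : ℕ) {x : ℚ} (hx : x = 0 ∨ x = 1) (p q : ℕ) :
    HasDenom (commonDenom I) 1 (modifiedEntry I a b x p q) := by
  have h0 := hasDenom_intCast (commonDenom I) 1 0
  have h1 := hasDenom_intCast (commonDenom I) 1 1
  simp only [Int.cast_zero, Int.cast_one] at h0 h1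
  unfold modifiedEntry replaceMatch
  split_ifs
  · rcases hx with rfl | rfl
    exacts [h0, h1]
  · rcases hx with rfl | rfl
    exacts [by simpa using h1, by simpa using h0]
  · exact hasDenom_entry I _ _

lemma hasDenom_positionWin (I : Instance ℚ) (a b : ℕ) {x : ℚ} (hx : x = 0 ∨ x = 1) (k p : ℕ) :
    HasDenom (commonDenom I) (2 ^ k - 1) (positionWin (modifiedEntry I a b x) k p) :=
  hasDenom_blockWin (hasDenom_modifiedEntry I a b hx) k _ p

lemma modifiedEntry_mem {I : Instance ℚ}
    (hP : ∀ a b, a ≠ b → 0 ≤ I.mat a b ∧ I.mat a b + I.mat b a = 1) (a b : Fin (2 ^ I.n))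
    (hab : a ≠ b) {x : ℚ} (hx : x = 0 ∨ x = 1) :
    ∀ p < 2 ^ I.n, ∀ q < 2 ^ I.n, p ≠ q → 0 ≤ modifiedEntry I a b x p q ∧
      modifiedEntry I a b x p q + modifiedEntry I a b x q p = 1 := by
  intro p hp q hq hpq
  have hne : (I.draw.symm a : ℕ) ≠ I.draw.symm b := by
    rwa [Ne, ← Fin.ext_iff, I.draw.symm.injective.eq_iff]
  have h := hP (I.draw (Fin.ofNat (2 ^ I.n) p)) (I.draw (Fin.ofNat (2 ^ I.n) q)) (by
    rw [I.draw.injective.ne_iff, Ne, Fin.ext_iff, val_ofNat hp, val_ofNat hq]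
    exact hpq)
  have hx0 : 0 ≤ x := by rcases hx with rfl | rfl <;> norm_num
  have hx1 : x ≤ 1 := by rcases hx with rfl | rfl <;> norm_num
  rw [modifiedEntry_eq I a b x hp hq, modifiedEntry_eq I a b x hq hp]
  by_cases c1 : p = I.draw.symm a ∧ q = I.draw.symm b
  · rw [c1.1, c1.2, replaceMatch_left, replaceMatch_right _ hne]
    exact ⟨hx0, by ring⟩
  by_cases c2 : p = I.draw.symm b ∧ q = I.draw.symm a
  · rw [c2.1, c2.2, replaceMatch_left, replaceMatch_right _ hne]
    exact ⟨by linarith, by ring⟩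
  · rw [replaceMatch_of_not _ _ c1 c2, replaceMatch_of_not _ _ (fun e => c2 e.symm)
      (fun e => c1 e.symm)]
    exact h

lemma abs_gain_le (p α : ℚ) : |gain p α| ≤ |α| := by
  unfold gain
  split_ifs <;> simp

lemma hasDenom_gain {D e : ℕ} (p : ℚ) {α : ℚ} (h : HasDenom D e α) : HasDenom D e (gain p α) := by
  have h0 := hasDenom_intCast D e 0
  rw [Int.cast_zero] at h0
  unfold gain
  split_ifs
  exacts [h, h0, h.neg, h0]

lemma isBounded_natCast_le {I : Instance ℚ} {q : ℚ} {e c : ℕ} (h : HasDenom (commonDenom I) e q)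
    (he : e ≤ 2 ^ I.n) (hq : |q| ≤ (c : ℚ)) (hc : c ≤ (2 ^ I.n) ^ 2) : IsBounded I q :=
  isBounded_of_hasDenom (h.mono he)
    (hq.trans ((by exact_mod_cast hc : (c : ℚ) ≤ ((2 ^ I.n) ^ 2 : ℕ)).trans (sq_le_fullBound I)))

lemma goodEval_isBounded {I : Instance ℚ}
    (hP : ∀ a b, a ≠ b → 0 ≤ I.mat a b ∧ I.mat a b + I.mat b a = 1) (a b : Fin (2 ^ I.n))
    (hab : a ≠ b) {x : ℚ} (hx : x = 0 ∨ x = 1) :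
    GoodEval (IsBounded I) I.n (modifiedEntry I a b x) := by
  have hQ := modifiedEntry_mem hP a b hab hx
  set Q := modifiedEntry I a b x with hQdef
  have hN := Nat.one_le_two_pow (n := I.n)
  have hN2 : 2 ^ I.n ≤ (2 ^ I.n) ^ 2 := by nlinarith
  have hden : ∀ k < I.n, ∀ p q, HasDenom (commonDenom I) (2 ^ k) (positionWin Q k q * Q p q) := by
    intro k _ p q
    have := (hasDenom_positionWin I a b hx k q).mul (hasDenom_modifiedEntry I a b hx p q)
    rwa [Nat.sub_add_cancel Nat.one_le_two_pow] at this
  have hterm : ∀ k < I.n, ∀ p < 2 ^ I.n, ∀ q < 2 ^ I.n, p ≠ q →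
      0 ≤ positionWin Q k q * Q p q ∧ positionWin Q k q * Q p q ≤ 1 := by
    intro k hk p hp q hq hpq
    have h1 := positionWin_mem hQ hk.le hq
    have h2 := hQ p hp q hq hpq
    have h3 := hQ q hq p hp hpq.symm
    exact ⟨mul_nonneg h1.1 h2.1, mul_le_one₀ h1.2 h2.1 (by linarith)⟩
  have hkn : ∀ k < I.n, 2 ^ k ≤ 2 ^ I.n := fun k hk => Nat.pow_le_pow_right (by norm_num) hk.le
  constructor
  · exact isBounded_natCast_le (e := 0) (c := 0) (by simpa using hasDenom_intCast _ 0 0)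
      (Nat.zero_le _) (by simp) (Nat.zero_le _)
  · intro k hk p hp q hq hpq
    have h := hterm k hk p hp q hq hpq
    refine isBounded_natCast_le (c := 1) (hden k hk p q) (hkn k hk) ?_ (by omega)
    rw [abs_of_nonneg h.1]
    simpa using h.2
  · intro k hk p hp u v hv hpu
    have h : ∀ q ∈ Finset.Ico u v, 0 ≤ positionWin Q k q * Q p q ∧
        positionWin Q k q * Q p q ≤ 1 := by
      intro q hq
      refine hterm k hk p hp q ((Finset.mem_Ico.1 hq).2.trans_le hv) ?_
      rintro rfl
      exact hpu hq
    refine isBounded_natCast_le (c := 2 ^ I.n) (HasDenom.sum fun q _ => hden k hk p q) (hkn k hk)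
      ?_ hN2
    rw [abs_of_nonneg (Finset.sum_nonneg fun q hq => (h q hq).1)]
    refine (Finset.sum_le_card_nsmul _ _ 1 fun q hq => (h q hq).2).trans ?_
    rw [nsmul_eq_mul, mul_one, Nat.card_Ico]
    exact_mod_cast (Nat.sub_le v u).trans hv
  · intro k hk p hp
    have h := positionWin_mem hQ hk hp
    have hkn : 2 ^ k ≤ 2 ^ I.n := Nat.pow_le_pow_right (by norm_num) hk
    refine isBounded_natCast_le (c := 1) (hasDenom_positionWin I a b hx k p)
      ((Nat.sub_le _ _).trans hkn) ?_ (by omega)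
    rw [abs_of_nonneg h.1]
    simpa using h.2

lemma instanceSlope_bounds {I : Instance ℚ}
    (hP : ∀ a b, a ≠ b → 0 ≤ I.mat a b ∧ I.mat a b + I.mat b a = 1) {pos : ℕ}
    (hpos : pos < 2 ^ I.n) (a b : Fin (2 ^ I.n)) (hab : a ≠ b) :
    HasDenom (commonDenom I) (2 ^ I.n) (instanceSlope I pos a b) ∧
      |instanceSlope I pos a b| ≤ 1 := by
  have h1 := positionWin_mem (modifiedEntry_mem hP a b hab (Or.inr rfl)) le_rfl hpos
  have h0 := positionWin_mem (modifiedEntry_mem hP a b hab (Or.inl rfl)) le_rfl hpos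
  constructor
  · have := (hasDenom_positionWin I a b (Or.inr rfl) I.n pos).add
      (hasDenom_positionWin I a b (Or.inl rfl) I.n pos).neg
    rw [← sub_eq_add_neg] at this
    exact this.mono (Nat.sub_le _ _)
  · rw [instanceSlope, abs_le]
    constructor <;> linarith

lemma partialGain_bounds {I : Instance ℚ}
    (hP : ∀ a b, a ≠ b → 0 ≤ I.mat a b ∧ I.mat a b + I.mat b a = 1) {pos : ℕ}
    (hpos : pos < 2 ^ I.n) {a e : ℕ} (ha : a < 2 ^ I.n ∨ a = 2 ^ I.n ∧ e = 0)
    (he : e ≤ 2 ^ I.n) :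
    HasDenom (commonDenom I) (2 ^ I.n) (partialGain I pos a e) ∧
      |partialGain I pos a e| ≤ (((2 ^ I.n) ^ 2 : ℕ) : ℚ) := by
  set N := 2 ^ I.n with hN
  have hg : ∀ c d, c < d → d < N → HasDenom (commonDenom I) N
      (gain (I.entry c d) (instanceSlope I pos c d)) ∧
      |gain (I.entry c d) (instanceSlope I pos c d)| ≤ 1 := by
    intro c d hcd hd
    have h := instanceSlope_bounds hP hpos ⟨c, hcd.trans hd⟩ ⟨d, hd⟩ (by
      rw [Ne, Fin.ext_iff]; exact hcd.ne)
    exact ⟨hasDenom_gain _ h.1, (abs_gain_le _ _).trans h.2⟩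
  have hrow : ∀ c e, e ≤ N → HasDenom (commonDenom I) N
      (∑ b ∈ Finset.Ico (c + 1) e, gain (I.entry c b) (instanceSlope I pos c b)) ∧
      |∑ b ∈ Finset.Ico (c + 1) e, gain (I.entry c b) (instanceSlope I pos c b)| ≤ (N : ℚ) := by
    intro c e he
    have h : ∀ b ∈ Finset.Ico (c + 1) e, _ := fun b hb =>
      hg c b (by rw [Finset.mem_Ico] at hb; omega) (by rw [Finset.mem_Ico] at hb; omega)
    refine ⟨HasDenom.sum fun b hb => (h b hb).1, ?_⟩
    refine (Finset.abs_sum_le_sum_abs _ _).trans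
      ((Finset.sum_le_card_nsmul _ _ 1 fun b hb => (h b hb).2).trans ?_)
    rw [nsmul_eq_mul, mul_one, Nat.card_Ico]
    exact_mod_cast (Nat.sub_le _ _).trans he
  have hrows : |∑ c ∈ Finset.range a, ∑ b ∈ Finset.Ico (c + 1) N,
      gain (I.entry c b) (instanceSlope I pos c b)| ≤ (a * N : ℚ) := by
    refine (Finset.abs_sum_le_sum_abs _ _).trans
      ((Finset.sum_le_card_nsmul _ _ (N : ℚ) fun c _ => (hrow c N le_rfl).2).trans ?_)
    rw [nsmul_eq_mul, Finset.card_range]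
  refine ⟨(HasDenom.sum fun c _ => (hrow c N le_rfl).1).add (hrow a e he).1, ?_⟩
  refine (abs_add_le _ _).trans ?_
  push_cast
  rcases ha with ha | ⟨rfl, rfl⟩
  · have h1 : (a : ℚ) + 1 ≤ N := by exact_mod_cast ha
    have h0 : (0 : ℚ) ≤ N := Nat.cast_nonneg _
    have := (hrow a e he).2
    nlinarith
  · rw [Finset.Ico_eq_empty (Nat.not_lt_zero _), Finset.sum_empty, abs_zero, add_zero, sq]
    exact hrows

lemma goodDrop_isBounded {I : Instance ℚ}
    (hP : ∀ a b, a ≠ b → 0 ≤ I.mat a b ∧ I.mat a b + I.mat b a = 1) {pos : ℕ}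
    (hpos : pos < 2 ^ I.n) : GoodDrop (IsBounded I) I pos := by
  have hN := Nat.one_le_two_pow (n := I.n)
  have hN2 : 2 ^ I.n ≤ (2 ^ I.n) ^ 2 := by nlinarith
  constructor
  · exact isBounded_natCast_le (e := 0) (c := 0) (by simpa using hasDenom_intCast _ 0 0)
      (Nat.zero_le _) (by simp) (Nat.zero_le _)
  · exact isBounded_natCast_le (e := 0) (c := 1) (by simpa using hasDenom_intCast _ 0 1)
      (Nat.zero_le _) (by simp) (by omega)
  · intro a b hab hb x hx
    exact goodEval_isBounded hP ⟨a, hab.trans hb⟩ ⟨b, hb⟩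
      (by rw [Ne, Fin.ext_iff]; exact hab.ne) hx
  · intro a b hab hb
    have h := instanceSlope_bounds hP hpos ⟨a, hab.trans hb⟩ ⟨b, hb⟩
      (by rw [Ne, Fin.ext_iff]; exact hab.ne)
    exact isBounded_natCast_le (c := 1) h.1 le_rfl (by simpa using h.2) (by omega)
  · intro a ha e he
    have h := partialGain_bounds hP hpos (Or.inl ha) he
    exact isBounded_natCast_le h.1 le_rfl h.2 le_rfl
  · obtain ⟨⟨z, hz⟩, h⟩ := partialGain_bounds hP hpos (Or.inr ⟨rfl, rfl⟩) (Nat.zero_le _)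
    refine ⟨⟨I.eps.num * z, ?_⟩, ?_⟩
    · rw [fullDenom]
      push_cast
      rw [← hz, ← Rat.mul_den_eq_num]
      ring
    · rw [abs_mul]
      refine (mul_le_mul (abs_le_natAbs_num _) h (abs_nonneg _) (Nat.cast_nonneg _)).trans ?_
      exact_mod_cast (by unfold fullBound; omega :
        I.eps.num.natAbs * (2 ^ I.n) ^ 2 ≤ fullBound I)

lemma ratBits_le_of_isBounded {I : Instance ℚ} {q : ℚ} (h : IsBounded I q) :
    ratBits q ≤ (fullBound I * fullDenom I).size + (fullDenom I).size := by
  obtain ⟨⟨z, hz⟩, hq⟩ := h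
  have hpos := fullDenom_pos I
  have hden : q.den ∣ fullDenom I := by
    have h1 : q = Rat.divInt z (fullDenom I) := by
      rw [Rat.divInt_eq_div, ← hz]
      push_cast
      rw [mul_div_assoc, div_self, mul_one]
      exact_mod_cast hpos.ne'
    have := Rat.den_dvd z (fullDenom I)
    rw [← h1] at this
    exact_mod_cast this
  have hdle := Nat.le_of_dvd hpos hden
  refine add_le_add (Nat.size_le_size ?_) (Nat.size_le_size hdle)
  have h2 : (q.num.natAbs : ℚ) = |q| * q.den := by
    have h3 : (0 : ℚ) < q.den := by exact_mod_cast q.den_pos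
    rw [← abs_of_pos h3, ← abs_mul, Rat.mul_den_eq_num, Nat.cast_natAbs, Int.cast_abs]
  have h4 : (q.num.natAbs : ℚ) ≤ (fullBound I * fullDenom I : ℕ) := by
    rw [h2]
    push_cast
    exact mul_le_mul hq (by exact_mod_cast hdle) (Nat.cast_nonneg _) (Nat.cast_nonneg _)
  exact_mod_cast h4

lemma one_le_ratBits (q : ℚ) : 1 ≤ ratBits q := by
  have : 0 < q.den.size := Nat.size_pos.2 q.den_pos
  unfold ratBits
  omega

lemma sq_lt_inputBits {N : ℕ} (P : Matrix (Fin N) (Fin N) ℚ) (ε : ℚ) :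
    N ^ 2 < inputBits P ε := by
  have h1 : ∑ _a : Fin N, ∑ _b : Fin N, 1 ≤ ∑ a, ∑ b, ratBits (P a b) :=
    Finset.sum_le_sum fun a _ => Finset.sum_le_sum fun b _ => one_le_ratBits _
  have h2 := one_le_ratBits ε
  simp only [Finset.sum_const, Finset.card_univ, Fintype.card_fin, smul_eq_mul, mul_one] at h1
  unfold inputBits
  rw [sq]
  omega

lemma commonDenom_le {n : ℕ} (i : Fin (2 ^ n)) (P : Matrix (Fin (2 ^ n)) (Fin (2 ^ n)) ℚ)
    (σ : Equiv.Perm (Fin (2 ^ n))) (ε : ℚ) :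
    commonDenom ⟨n, i, P, σ, ε⟩ ≤ 2 ^ inputBits P ε := by
  have h1 : commonDenom ⟨n, i, P, σ, ε⟩ ≤ 2 ^ ∑ a, ∑ b, ratBits (P a b) := by
    unfold commonDenom
    rw [← Finset.prod_pow_eq_pow_sum]
    refine Finset.prod_le_prod' fun a _ => ?_
    rw [← Finset.prod_pow_eq_pow_sum]
    refine Finset.prod_le_prod' fun b _ => ?_
    exact (Nat.lt_size_self _).le.trans
      (Nat.pow_le_pow_right (by norm_num) (Nat.le_add_left _ _))
  exact h1.trans (Nat.pow_le_pow_right (by norm_num) (Nat.le_add_right _ _))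

lemma fullDenom_le {n : ℕ} (i : Fin (2 ^ n)) (P : Matrix (Fin (2 ^ n)) (Fin (2 ^ n)) ℚ)
    (σ : Equiv.Perm (Fin (2 ^ n))) (ε : ℚ) :
    fullDenom ⟨n, i, P, σ, ε⟩ ≤ 2 ^ (inputBits P ε ^ 2 + inputBits P ε) := by
  set B := inputBits P ε with hB
  have hNB : 2 ^ n ≤ B := by
    have := sq_lt_inputBits P ε
    have := Nat.one_le_two_pow (n := n)
    nlinarith
  have h1 : ε.den ≤ 2 ^ B := by
    refine (Nat.lt_size_self _).le.trans (Nat.pow_le_pow_right (by norm_num) ?_)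
    have : ratBits ε = ε.num.natAbs.size + ε.den.size := rfl
    rw [hB, inputBits]
    omega
  rw [pow_add]
  refine Nat.mul_le_mul ?_ h1
  refine (Nat.pow_le_pow_left (commonDenom_le i P σ ε) _).trans ?_
  rw [← pow_mul, sq]
  exact Nat.pow_le_pow_right (by norm_num) (Nat.mul_le_mul_left _ hNB)

lemma natAbs_num_le {N : ℕ} (P : Matrix (Fin N) (Fin N) ℚ) (ε : ℚ) (a b : Fin N) :
    (P a b).num.natAbs ≤ 2 ^ inputBits P ε := by
  refine (Nat.lt_size_self _).le.trans (Nat.pow_le_pow_right (by norm_num) ?_)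
  have h1 : ratBits (P a b) ≤ ∑ a, ∑ b, ratBits (P a b) :=
    (Finset.single_le_sum (f := fun b => ratBits (P a b))
      (fun _ _ => Nat.zero_le _) (Finset.mem_univ _)).trans
    (Finset.single_le_sum (f := fun a => ∑ b, ratBits (P a b))
      (fun _ _ => Nat.zero_le _) (Finset.mem_univ _))
  unfold inputBits
  unfold ratBits at h1 ⊢
  omega

lemma fullBound_le {n : ℕ} (i : Fin (2 ^ n)) (P : Matrix (Fin (2 ^ n)) (Fin (2 ^ n)) ℚ)
    (σ : Equiv.Perm (Fin (2 ^ n))) (ε : ℚ) :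
    fullBound ⟨n, i, P, σ, ε⟩ ≤ 2 ^ (2 * inputBits P ε + 2) := by
  set B := inputBits P ε with hB
  have hNB : (2 ^ n) ^ 2 ≤ 2 ^ B := ((sq_lt_inputBits P ε).trans Nat.lt_two_pow_self).le
  have h1 : ε.num.natAbs ≤ 2 ^ B := by
    refine (Nat.lt_size_self _).le.trans (Nat.pow_le_pow_right (by norm_num) ?_)
    have : ratBits ε = ε.num.natAbs.size + ε.den.size := rfl
    rw [hB, inputBits]
    omega
  have h2 : ∑ a, ∑ b, (P a b).num.natAbs ≤ (2 ^ n) ^ 2 * 2 ^ B := by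
    refine (Finset.sum_le_sum fun a _ => Finset.sum_le_sum fun b _ =>
      natAbs_num_le P ε a b).trans (le_of_eq ?_)
    simp only [Finset.sum_const, Finset.card_univ, Fintype.card_fin, smul_eq_mul]
    rw [sq, mul_assoc, hB]
  have h3 : 1 ≤ 2 ^ B := Nat.one_le_two_pow
  have h4 : 2 ^ (2 * B + 2) = 4 * (2 ^ B * 2 ^ B) := by
    rw [pow_add, two_mul, pow_add]; ring
  rw [h4]
  unfold fullBound
  dsimp only
  have h5 : ε.num.natAbs * (2 ^ n) ^ 2 ≤ 2 ^ B * 2 ^ B := Nat.mul_le_mul h1 hNB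
  have h6 : (2 ^ n) ^ 2 * 2 ^ B ≤ 2 ^ B * 2 ^ B := Nat.mul_le_mul_right _ hNB
  have h7 : 2 ^ B ≤ 2 ^ B * 2 ^ B := by nlinarith
  omega

/-- The bit cost of the program is polynomial, as it takes polynomially many steps and the bit
lengths of all numbers are polynomially bounded. -/
lemma outputs_generalProg_bitCost {n : ℕ} {P : Matrix (Fin (2 ^ n)) (Fin (2 ^ n)) ℚ}
    (hP : IsComparison (P.map fun q : ℚ => (q : ℝ))) (i : Fin (2 ^ n))
    (σ : Equiv.Perm (Fin (2 ^ n))) (ε : ℚ) :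
    ∃ v : ℚ, (v : ℝ) = firstOrderDrop i (P.map fun q : ℚ => (q : ℝ)) σ (ε : ℝ) ∧
      Outputs bitCost generalProg ⟨n, i, P, σ, ε⟩ v (100000 * inputBits P ε ^ 4) := by
  set I : Instance ℚ := ⟨n, i, P, σ, ε⟩ with hI
  set B := inputBits P ε with hB
  have hP' : ∀ a b, a ≠ b → 0 ≤ I.mat a b ∧ I.mat a b + I.mat b a = 1 := by
    intro a b hab
    have h := hP a b hab
    simp only [Matrix.map_apply] at h
    exact ⟨by exact_mod_cast h.1, by exact_mod_cast h.2.2⟩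
  have hpos : ((I.draw.symm I.player : Fin (2 ^ I.n)) : ℕ) < 2 ^ I.n := Fin.is_lt _
  obtain ⟨s, t, he, ht, hv⟩ := reach_generalProg (goodDrop_isBounded hP' hpos)
  have hsq : (2 ^ n) ^ 2 < B := sq_lt_inputBits P ε
  have hn : n < 2 ^ n := Nat.lt_two_pow_self
  have hN1 := Nat.one_le_two_pow (n := n)
  have hNB : 2 ^ n ≤ (2 ^ n) ^ 2 := by nlinarith
  have hB2 : 2 ≤ B := by omega
  have hS : ∀ q, IsBounded I q → ratBits q ≤ 8 * B ^ 2 := by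
    intro q hq
    have hd := fullDenom_le i P σ ε
    have hb := fullBound_le i P σ ε
    rw [← hB] at hd hb
    have h1 : (fullDenom I).size ≤ B ^ 2 + B + 1 :=
      Nat.size_le.2 (hd.trans_lt (Nat.pow_lt_pow_right (by norm_num) (by omega)))
    have h2 : (fullBound I * fullDenom I).size ≤ 2 * B + 2 + (B ^ 2 + B) + 1 := by
      refine Nat.size_le.2 ((Nat.mul_le_mul hb hd).trans_lt ?_)
      rw [← pow_add]
      exact Nat.pow_lt_pow_right (by norm_num) (by omega)
    have := ratBits_le_of_isBounded hq
    nlinarith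
  have hzero : IsBounded I 0 := (goodDrop_isBounded hP' hpos).zero
  have hi : (i : ℕ) < 2 ^ n := i.2
  have hlt : 2 ^ n < 2 ^ B := Nat.pow_lt_pow_right (by norm_num) (by omega)
  obtain ⟨t', hrun, ht', -⟩ := Exec.run_bitCost hS (isBounded_entry I) he rfl B (by omega)
    (show n ≤ B by omega)
    (fun k => by
      simp only [Instance.init]
      split_ifs
      exacts [hlt, hi.trans hlt, by omega])
    (fun k => by simp [Instance.init])
    (fun k => by
      simp only [Instance.init]
      split_ifs
      exacts [isBounded_eps I, hzero])
    (fun k => hzero)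
  refine ⟨_, ?_, s, t', hrun, hv, ht'.trans ?_⟩
  · rw [partialGain_eq, firstOrderDrop_eq_gain hP]
    push_cast
    congr 1
    refine Finset.sum_congr rfl fun a _ => Finset.sum_congr rfl fun b _ => ?_
    rw [cast_gain, cast_playerSlope]
    rfl
  · have h4 : ((2 ^ n) ^ 2) ^ 2 ≤ B ^ 2 := Nat.pow_le_pow_left hsq.le 2
    have ht2 : t ≤ 200 * B ^ 2 := by
      refine ht.trans (Nat.mul_le_mul_left _ ?_)
      rw [show (2 ^ I.n) ^ 4 = ((2 ^ n) ^ 2) ^ 2 from (pow_mul (2 ^ n) 2 2)]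
      exact h4
    calc t * (2 * (B + t) + 2 * (8 * B ^ 2) + 1)
        ≤ 200 * B ^ 2 * (2 * (B + 200 * B ^ 2) + 2 * (8 * B ^ 2) + 1) :=
          Nat.mul_le_mul ht2 (by omega)
      _ ≤ 200 * B ^ 2 * (420 * B ^ 2) := Nat.mul_le_mul_left _ (by nlinarith)
      _ = 84000 * B ^ 4 := by ring
      _ ≤ 100000 * B ^ 4 := Nat.mul_le_mul_right _ (by norm_num)

/-! ### Reversed matches in a deterministic tournament -/

/-- The matches between distinct positions below `N` have certain outcomes. -/
def IsCertain (Q : ℕ → ℕ → ℝ) (N : ℕ) : Prop :=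
  ∀ p < N, ∀ q < N, p ≠ q → (Q p q = 0 ∧ Q q p = 1) ∨ (Q p q = 1 ∧ Q q p = 0)

lemma IsCertain.matchWinner_comm {Q : ℕ → ℕ → ℝ} {N : ℕ} (hQ : IsCertain Q N) {p q : ℕ}
    (hp : p < N) (hq : q < N) : matchWinner Q p q = matchWinner Q q p := by
  by_cases hpq : p = q
  · rw [hpq]
  · rcases hQ p hp q hq hpq with ⟨h1, h2⟩ | ⟨h1, h2⟩ <;> simp [matchWinner, h1, h2]

lemma IsCertain.value_matchWinner {Q : ℕ → ℕ → ℝ} {N : ℕ} (hQ : IsCertain Q N) {p q : ℕ}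
    (hp : p < N) (hq : q < N) (hpq : p ≠ q) (W : ℕ → ℝ) :
    Q p q * W p + Q q p * W q = W (matchWinner Q p q) := by
  rcases hQ p hp q hq hpq with ⟨h1, h2⟩ | ⟨h1, h2⟩ <;> simp [matchWinner, h1, h2]

/-- The nodes of the tree are numbered such that the children of `j` are `2 * j` and `2 * j + 1`
and the root is `1`. This is the winner at the node `j`, where `1 ≤ j < 2 ^ (n + 1)`. -/
def heapWinner (Q : ℕ → ℕ → ℝ) (n j : ℕ) : ℕ :=
  blockWinner Q (n - Nat.log 2 j) (j * 2 ^ (n - Nat.log 2 j) - 2 ^ n)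

/-- The node `j` has height `k` and its block starts at the position `m`. -/
def IsNode (n j k m : ℕ) : Prop := j * 2 ^ k = 2 ^ n + m ∧ m + 2 ^ k ≤ 2 ^ n

lemma IsNode.height_le {n j k m : ℕ} (h : IsNode n j k m) : k ≤ n :=
  (Nat.pow_le_pow_iff_right (by norm_num : 1 < 2)).1 (le_trans (Nat.le_add_left _ _) h.2)

lemma IsNode.log_eq {n j k m : ℕ} (h : IsNode n j k m) : Nat.log 2 j = n - k := by
  have hk := h.height_le
  obtain ⟨d, rfl⟩ := Nat.exists_eq_add_of_le hk
  obtain ⟨h1, h2⟩ := h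
  have hpos := Nat.two_pow_pos k
  have hp : 2 ^ (k + d) = 2 ^ d * 2 ^ k := by rw [pow_add, mul_comm]
  rw [Nat.add_sub_cancel_left]
  refine Nat.log_eq_of_pow_le_of_lt_pow ?_ ?_
  · refine Nat.le_of_mul_le_mul_right ?_ hpos
    omega
  · refine Nat.lt_of_mul_lt_mul_right (a := 2 ^ k) ?_
    rw [pow_succ, mul_right_comm]
    omega

lemma IsNode.heapWinner_eq {n j k m : ℕ} (h : IsNode n j k m) (Q : ℕ → ℕ → ℝ) :
    heapWinner Q n j = blockWinner Q k m := by
  have hk := h.height_le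
  rw [heapWinner, h.log_eq, Nat.sub_sub_self hk, h.1, Nat.add_sub_cancel_left]

lemma IsNode.pos {n j k m : ℕ} (h : IsNode n j k m) : 1 ≤ j := by
  rcases Nat.eq_zero_or_pos j with rfl | hj
  · have := h.1
    have := Nat.two_pow_pos n
    omega
  · exact hj

lemma IsNode.left {n j k m : ℕ} (h : IsNode n j (k + 1) m) : IsNode n (2 * j) k m := by
  obtain ⟨h1, h2⟩ := h
  rw [pow_succ] at h1 h2
  refine ⟨?_, by omega⟩
  rw [← h1]; ring

lemma IsNode.right {n j k m : ℕ} (h : IsNode n j (k + 1) m) :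
    IsNode n (2 * j + 1) k (m + 2 ^ k) := by
  obtain ⟨h1, h2⟩ := h
  rw [pow_succ] at h1 h2
  refine ⟨?_, by omega⟩
  rw [← add_assoc, ← h1]; ring

lemma isNode_root (n : ℕ) : IsNode n 1 n 0 := ⟨by ring, by omega⟩

lemma isNode_leaf {n p : ℕ} (hp : p < 2 ^ n) : IsNode n (2 ^ n + p) 0 p :=
  ⟨by ring, by omega⟩

lemma exists_isNode_succ {n j : ℕ} (hj : 1 ≤ j) (hjn : j < 2 ^ n) :
    ∃ k m, IsNode n j (k + 1) m := by
  have hlog : Nat.log 2 j < n := Nat.log_lt_of_lt_pow (by omega) hjn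
  obtain ⟨d, hd⟩ := Nat.exists_eq_add_of_lt hlog
  have h1 : 2 ^ Nat.log 2 j ≤ j := Nat.pow_log_le_self 2 (by omega)
  have h2 : j < 2 ^ (Nat.log 2 j + 1) := Nat.lt_pow_succ_log_self (by norm_num) j
  have e1 : 2 ^ n = 2 ^ Nat.log 2 j * 2 ^ (d + 1) := by rw [← pow_add]; congr 1
  have e2 : (j + 1) * 2 ^ (d + 1) ≤ 2 ^ (Nat.log 2 j + 1) * 2 ^ (d + 1) :=
    Nat.mul_le_mul_right _ h2
  have e3 : 2 ^ Nat.log 2 j * 2 ^ (d + 1) ≤ j * 2 ^ (d + 1) := Nat.mul_le_mul_right _ h1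
  rw [pow_succ 2 (Nat.log 2 j), mul_right_comm, ← e1, add_mul, one_mul] at e2
  rw [← e1] at e3
  exact ⟨d, j * 2 ^ (d + 1) - 2 ^ n, by omega, by omega⟩

lemma heapWinner_leaf (Q : ℕ → ℕ → ℝ) {n p : ℕ} (hp : p < 2 ^ n) :
    heapWinner Q n (2 ^ n + p) = p := (isNode_leaf hp).heapWinner_eq Q

lemma heapWinner_eq_matchWinner (Q : ℕ → ℕ → ℝ) {n j : ℕ} (hj : 1 ≤ j) (hjn : j < 2 ^ n) :
    heapWinner Q n j = matchWinner Q (heapWinner Q n (2 * j)) (heapWinner Q n (2 * j + 1)) := by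
  obtain ⟨k, m, h⟩ := exists_isNode_succ hj hjn
  rw [h.heapWinner_eq, h.left.heapWinner_eq, h.right.heapWinner_eq, blockWinner]

lemma heapWinner_children_lt (Q : ℕ → ℕ → ℝ) {n j : ℕ} (hj : 1 ≤ j) (hjn : j < 2 ^ n) :
    heapWinner Q n (2 * j) < heapWinner Q n (2 * j + 1) ∧ heapWinner Q n (2 * j + 1) < 2 ^ n := by
  obtain ⟨k, m, h⟩ := exists_isNode_succ hj hjn
  have h1 := Finset.mem_Ico.1 (blockWinner_mem Q k m)
  have h2 := Finset.mem_Ico.1 (blockWinner_mem Q k (m + 2 ^ k))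
  have h3 := h.right.2
  rw [h.left.heapWinner_eq, h.right.heapWinner_eq]
  omega

/-- The winner of the tournament if the position `c` wins at the node `v`: it climbs the tree
and meets the winners `w` of the sibling nodes. The sibling of `v` is `4 * (v / 2) + 1 - v`. -/
def climb (Q : ℕ → ℕ → ℝ) (w : ℕ → ℕ) (v c : ℕ) : ℕ :=
  if 1 < v then climb Q w (v / 2) (matchWinner Q c (w (4 * (v / 2) + 1 - v))) else c
termination_by v
decreasing_by omega

lemma climb_one (Q : ℕ → ℕ → ℝ) (w : ℕ → ℕ) (c : ℕ) : climb Q w 1 c = c := by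
  rw [climb, if_neg (by omega)]

lemma climb_left (Q : ℕ → ℕ → ℝ) (w : ℕ → ℕ) {j : ℕ} (hj : 1 ≤ j) (c : ℕ) :
    climb Q w (2 * j) c = climb Q w j (matchWinner Q c (w (2 * j + 1))) := by
  rw [climb, if_pos (by omega), show 2 * j / 2 = j by omega,
    show 4 * j + 1 - 2 * j = 2 * j + 1 by omega]

lemma climb_right (Q : ℕ → ℕ → ℝ) (w : ℕ → ℕ) {j : ℕ} (hj : 1 ≤ j) (c : ℕ) :
    climb Q w (2 * j + 1) c = climb Q w j (matchWinner Q c (w (2 * j))) := by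
  rw [climb, if_pos (by omega), show (2 * j + 1) / 2 = j by omega,
    show 4 * j + 1 - (2 * j + 1) = 2 * j by omega]

lemma climb_heapWinner {Q : ℕ → ℕ → ℝ} {n : ℕ} (hQ : IsCertain Q (2 ^ n)) (j : ℕ) (hj : 1 ≤ j)
    (hjn : j < 2 ^ (n + 1)) :
    climb Q (heapWinner Q n) j (heapWinner Q n j) = heapWinner Q n 1 := by
  induction j using Nat.strong_induction_on with
  | _ j ih =>
    rw [pow_succ] at hjn
    rcases Nat.lt_or_ge 1 j with hj1 | hj1
    · have hc := heapWinner_children_lt Q (n := n) (j := j / 2) (by omega) (by omega)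
      have hw := heapWinner_eq_matchWinner Q (n := n) (j := j / 2) (by omega) (by omega)
      have := ih (j / 2) (by omega) (by omega) (by rw [pow_succ]; omega)
      rw [hw] at this
      obtain ⟨l, rfl | rfl⟩ := Nat.even_or_odd' j
      · rw [climb_left _ _ (by omega)]
        rwa [show 2 * l / 2 = l by omega] at this
      · rw [show (2 * l + 1) / 2 = l by omega] at this hc
        rw [climb_right _ _ (by omega), hQ.matchWinner_comm (by omega) (by omega)]
        exact this
    · obtain rfl : j = 1 := by omega
      exact climb_one _ _ _

/-- The loser of the match at the node `j`. -/
def heapLoser (Q : ℕ → ℕ → ℝ) (n j : ℕ) : ℕ :=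
  heapWinner Q n (2 * j) + heapWinner Q n (2 * j + 1) - heapWinner Q n j

/-- `1` if `i` wins the tournament and reversing the match at the node `j` makes `i` lose,
else `0`. -/
def flipValue (Q : ℕ → ℕ → ℝ) (n i j : ℕ) : ℝ :=
  if heapWinner Q n 1 = i ∧ climb Q (heapWinner Q n) j (heapLoser Q n j) ≠ i then 1 else 0

/-- The sum of `f` over the subtree of height `k` with the root `j`, without the leaves. -/
def subtreeSum (f : ℕ → ℝ) : ℕ → ℕ → ℝ
  | 0, _ => 0
  | k + 1, j => f j + subtreeSum f k (2 * j) + subtreeSum f k (2 * j + 1)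

lemma subtreeSum_eq (f : ℕ → ℝ) (k : ℕ) : ∀ j, subtreeSum f k j =
    ∑ d ∈ Finset.range k, ∑ t ∈ Finset.range (2 ^ d), f (j * 2 ^ d + t) := by
  induction k with
  | zero => intro j; simp [subtreeSum]
  | succ k ih =>
    intro j
    rw [subtreeSum, ih, ih, Finset.sum_range_succ', add_assoc, ← Finset.sum_add_distrib, add_comm]
    congr 1
    · refine Finset.sum_congr rfl fun d _ => ?_
      rw [pow_succ, mul_two, Finset.sum_range_add]
      congr 1
      · exact Finset.sum_congr rfl fun t _ => by congr 1; ring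
      · exact Finset.sum_congr rfl fun t _ => by congr 1; ring
    · simp

lemma subtreeSum_root (f : ℕ → ℝ) (n : ℕ) :
    subtreeSum f n 1 = ∑ j ∈ Finset.Ico 1 (2 ^ n), f j := by
  rw [subtreeSum_eq]
  induction n with
  | zero => simp
  | succ n ih =>
    have h := Nat.one_le_two_pow (n := n)
    rw [Finset.sum_range_succ, ih, ← Finset.sum_Ico_consecutive f h
      (show 2 ^ n ≤ 2 ^ (n + 1) by rw [pow_succ]; omega), Finset.sum_Ico_eq_sum_range f (2 ^ n)]
    congr 1
    rw [pow_succ, show 2 ^ n * 2 - 2 ^ n = 2 ^ n by omega]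
    exact Finset.sum_congr rfl fun t _ => by rw [one_mul]

lemma sum_pairs_split (g : ℕ → ℕ → ℝ) {a b c : ℕ} (hab : a ≤ b) (hbc : b ≤ c) :
    ∑ p ∈ Finset.Ico a c, ∑ q ∈ Finset.Ico (p + 1) c, g p q =
      ∑ p ∈ Finset.Ico a b, ∑ q ∈ Finset.Ico b c, g p q +
      ∑ p ∈ Finset.Ico a b, ∑ q ∈ Finset.Ico (p + 1) b, g p q +
      ∑ p ∈ Finset.Ico b c, ∑ q ∈ Finset.Ico (p + 1) c, g p q := by
  rw [← Finset.sum_Ico_consecutive _ hab hbc, ← Finset.sum_add_distrib]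
  congr 1
  refine Finset.sum_congr rfl fun p hp => ?_
  rw [Finset.mem_Ico] at hp
  rw [← Finset.sum_Ico_consecutive (g p) (show p + 1 ≤ b by omega) hbc, add_comm]

lemma slope_congr_value {Q : ℕ → ℕ → ℝ} {k m : ℕ} {W W' : ℕ → ℝ}
    (h : ∀ p ∈ Finset.Ico m (m + 2 ^ k), W p = W' p) (a b : ℕ) :
    slope Q k m W a b = slope Q k m W' a b := by
  rw [slope, slope, blockValue_congr (fun _ _ _ _ _ => rfl) h,
    blockValue_congr (fun _ _ _ _ _ => rfl) h]

/-- In a deterministic tournament only the matches that take place contribute to the drop, and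
they contribute `1` if reversing them makes the winner lose. The reversed match is followed up
the tree by `climb`. -/
lemma sum_matchDrop_eq_subtreeSum {Q : ℕ → ℕ → ℝ} {n : ℕ} (hQ : IsCertain Q (2 ^ n)) (i k : ℕ) :
    ∀ j m, IsNode n j k m →
      ∑ p ∈ Finset.Ico m (m + 2 ^ k), ∑ q ∈ Finset.Ico (p + 1) (m + 2 ^ k), matchDrop (Q p q)
        (slope Q k m (fun c => pointMass ℝ i (climb Q (heapWinner Q n) j c)) p q) =
      subtreeSum (flipValue Q n i) k j := by
  induction k with
  | zero => intro j m _; simp [subtreeSum]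
  | succ k ih =>
    intro j m hnode
    set W : ℕ → ℝ := fun c => pointMass ℝ i (climb Q (heapWinner Q n) j c) with hW
    have hj := hnode.pos
    have hle := hnode.2
    rw [pow_succ, mul_two, ← add_assoc] at hle
    rw [pow_succ, mul_two, ← add_assoc, sum_pairs_split _ (Nat.le_add_right m (2 ^ k))
      (Nat.le_add_right (m + 2 ^ k) (2 ^ k)), subtreeSum]
    have hu := blockWinner_mem Q k m
    have hv := blockWinner_mem Q k (m + 2 ^ k)
    have hVL := blockWin_eq_pointMass (Q := Q) k m fun p hp q hq hpq => by
      simp only [Finset.mem_Ico] at hp hq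
      exact hQ p (by omega) q (by omega) hpq
    have hVR := blockWin_eq_pointMass (Q := Q) k (m + 2 ^ k) fun p hp q hq hpq => by
      simp only [Finset.mem_Ico] at hp hq
      exact hQ p (by omega) q (by omega) hpq
    have hwL := hnode.left.heapWinner_eq Q
    have hwR := hnode.right.heapWinner_eq Q
    have hjn : j < 2 ^ n := by
      have h1 := hnode.1
      have h2 := hnode.2
      have h3 := Nat.two_pow_pos k
      rw [pow_succ] at h1 h2
      nlinarith
    have hw := heapWinner_eq_matchWinner Q hj hjn
    have hclimb := climb_heapWinner hQ j hj (by rw [pow_succ]; omega)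
    rw [hwL, hwR] at hw
    have hu' := Finset.mem_Ico.1 hu
    have hv' := Finset.mem_Ico.1 hv
    congr 1
    · congr 1
      · -- Only the winners of the two halves meet.
        have hterm : ∀ p ∈ Finset.Ico m (m + 2 ^ k),
            ∀ q ∈ Finset.Ico (m + 2 ^ k) (m + 2 ^ k + 2 ^ k),
            matchDrop (Q p q) (slope Q (k + 1) m W p q) =
              matchDrop (Q p q) (pointMass ℝ (blockWinner Q k m) p *
                pointMass ℝ (blockWinner Q k (m + 2 ^ k)) q * (W p - W q)) := by
          intro p hp q hq
          rw [slope_cross Q hp hq, hVL p hp, hVR q hq]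
        have hzero : ∀ x : ℝ, matchDrop x 0 = 0 := by intro x; simp [matchDrop]
        rw [Finset.sum_congr rfl fun p hp => Finset.sum_congr rfl fun q hq => hterm p hp q hq,
          Finset.sum_eq_single_of_mem _ hu fun p hp hne => Finset.sum_eq_zero fun q hq => by
            simp [pointMass, hne, hzero],
          Finset.sum_eq_single_of_mem _ hv fun q hq hne => by simp [pointMass, hne, hzero]]
        rw [flipValue, heapLoser, hwL, hwR, ← hclimb, hw]
        set u := blockWinner Q k m
        set v := blockWinner Q k (m + 2 ^ k)
        simp only [hW, pointMass, if_true, one_mul]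
        rcases hQ u (by omega) v (by omega) (by omega) with ⟨h1, -⟩ | ⟨h1, -⟩
        · simp only [matchWinner, h1, lt_irrefl, if_false, Nat.add_sub_cancel, matchDrop,
            if_true]
          by_cases c1 : climb Q (heapWinner Q n) j v = i <;>
            by_cases c2 : climb Q (heapWinner Q n) j u = i <;> simp [c1, c2]
        · simp only [matchWinner, h1, zero_lt_one, if_true, Nat.add_sub_cancel_left, matchDrop,
            one_ne_zero, if_false]
          by_cases c1 : climb Q (heapWinner Q n) j v = i <;>
            by_cases c2 : climb Q (heapWinner Q n) j u = i <;> simp [c1, c2]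
      · rw [← ih (2 * j) m hnode.left]
        refine Finset.sum_congr rfl fun p hp => Finset.sum_congr rfl fun q hq => ?_
        rw [Finset.mem_Ico] at hp hq
        rw [slope_left Q (Finset.mem_Ico.2 hp) (Finset.mem_Ico.2 ⟨by omega, hq.2⟩)]
        congr 1
        refine slope_congr_value (fun c hc => ?_) p q
        rw [Finset.mem_Ico] at hc
        rw [leftValue, Finset.sum_eq_single_of_mem _ hv fun d hd hne => by
          rw [hVR d hd]; simp [pointMass, hne], hVR _ hv, pointMass, if_pos rfl, one_mul,
          hQ.value_matchWinner (by omega) (by omega) (by omega)]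
        simp only [hW]
        rw [climb_left Q _ hj, hwR]
    · rw [← ih (2 * j + 1) (m + 2 ^ k) hnode.right]
      refine Finset.sum_congr rfl fun p hp => Finset.sum_congr rfl fun q hq => ?_
      rw [Finset.mem_Ico] at hp hq
      rw [slope_right Q (Finset.mem_Ico.2 hp) (Finset.mem_Ico.2 ⟨by omega, hq.2⟩)]
      congr 1
      refine slope_congr_value (fun c hc => ?_) p q
      rw [Finset.mem_Ico] at hc
      rw [rightValue, Finset.sum_eq_single_of_mem _ hu fun d hd hne => by
        rw [hVL d hd]; simp [pointMass, hne], hVL _ hu, pointMass, if_pos rfl, one_mul,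
        hQ.value_matchWinner (by omega) (by omega) (by omega)]
      simp only [hW]
      rw [climb_right Q _ hj, hwL, hQ.matchWinner_comm (by omega) (by omega)]

/-- The entries of an instance, indexed by positions. -/
def positionEntry {F : Type} [Zero F] (I : Instance F) (p q : ℕ) : F :=
  I.entry (I.leaf p) (I.leaf q)

lemma isCertain_positionEntry {I : Instance ℝ} (hP : IsComparison I.mat)
    (hd : IsDeterministic I.mat) : IsCertain (positionEntry I) (2 ^ I.n) := by
  intro p hp q hq hpq
  rw [positionEntry, positionEntry, entry_leaf I hp hq, entry_leaf I hq hp]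
  exact byPosition_deterministic hP hd I.draw hp hq hpq

lemma firstOrderDrop_eq_sum_flipValue {I : Instance ℝ} (hP : IsComparison I.mat)
    (hd : IsDeterministic I.mat) (ε : ℝ) :
    firstOrderDrop I.player I.mat I.draw ε = (∑ j ∈ Finset.Ico 1 (2 ^ I.n),
      flipValue (positionEntry I) I.n (I.draw.symm I.player) j) * ε := by
  have h := sum_matchDrop_eq_subtreeSum (isCertain_positionEntry hP hd) (I.draw.symm I.player) I.n
    1 0 (isNode_root I.n)
  rw [firstOrderDrop_eq_sum_pairsBelow hP, ← subtreeSum_root, ← h, ← sum_pairs_eq_sum_pairsBelow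
    (fun p q => matchDrop (byPosition I.mat I.draw p q)
      (slope (byPosition I.mat I.draw) I.n 0 (pointMass ℝ (I.draw.symm I.player)) p q)),
    sum_pairs_eq_sum_range (fun p q => matchDrop (byPosition I.mat I.draw p q)
      (slope (byPosition I.mat I.draw) I.n 0 (pointMass ℝ (I.draw.symm I.player)) p q)),
    Finset.range_eq_Ico, zero_add]
  congr 1
  refine Finset.sum_congr rfl fun p hp => Finset.sum_congr rfl fun q hq => ?_
  rw [Finset.mem_Ico] at hp hq
  rw [positionEntry, entry_leaf I hp.2 hq.2]
  congr 1
  have hval : ∀ x, blockValue (replaceMatch (byPosition I.mat I.draw) p q x) I.n 0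
      (pointMass ℝ (I.draw.symm I.player)) =
      blockValue (replaceMatch (positionEntry I) p q x) I.n 0 (fun c => pointMass ℝ
        (I.draw.symm I.player) (climb (positionEntry I) (heapWinner (positionEntry I) I.n) 1 c)) := by
    intro x
    refine blockValue_congr (fun c hc d hd _ => ?_) fun c _ => by rw [climb_one]
    simp only [Finset.mem_Ico, zero_add] at hc hd
    simp only [replaceMatch, positionEntry, entry_leaf I hc.2 hd.2]
  rw [slope, slope, hval, hval]

/-! ### The program for deterministic matrices -/

lemma heapWinner_lt (Q : ℕ → ℕ → ℝ) {n j : ℕ} (hj : 1 ≤ j) (hjn : j < 2 ^ n + 2 ^ n) :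
    heapWinner Q n j < 2 ^ n := by
  rcases Nat.lt_or_ge j (2 ^ n) with h | h
  · obtain ⟨k, m, hnode⟩ := exists_isNode_succ hj h
    have := Finset.mem_Ico.1 (blockWinner_mem Q (k + 1) m)
    rw [hnode.heapWinner_eq]
    exact this.2.trans_le hnode.2
  · obtain ⟨p, rfl⟩ := Nat.exists_eq_add_of_le h
    rw [heapWinner_leaf Q (by omega)]
    omega

lemma matchWinner_lt {Q : ℕ → ℕ → ℝ} {N p q : ℕ} (hp : p < N) (hq : q < N) :
    matchWinner Q p q < N := by
  rw [matchWinner]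
  split_ifs <;> assumption

lemma heapLoser_lt (Q : ℕ → ℕ → ℝ) {n j : ℕ} (hj : 1 ≤ j) (hjn : j < 2 ^ n) :
    heapLoser Q n j < 2 ^ n := by
  have h1 := heapWinner_lt Q (n := n) (j := 2 * j) (by omega) (by omega)
  have h2 := heapWinner_lt Q (n := n) (j := 2 * j + 1) (by omega) (by omega)
  rw [heapLoser, heapWinner_eq_matchWinner Q hj hjn, matchWinner]
  split_ifs <;> omega

lemma climb_lt (Q : ℕ → ℕ → ℝ) {n : ℕ} (v c : ℕ) (hv : v < 2 ^ n + 2 ^ n) (hc : c < 2 ^ n) :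
    climb Q (heapWinner Q n) v c < 2 ^ n := by
  induction v using Nat.strong_induction_on generalizing c with
  | _ v ih =>
    rw [climb]
    split_ifs with h
    · exact ih _ (by omega) _ (by omega)
        (matchWinner_lt hc (heapWinner_lt Q (by omega) (by omega)))
    · exact hc

/-- The registers that keep their values after the initialization. -/
structure HeapContext (I : Instance ℝ) (s : State ℝ) : Prop where
  size : s.reg 0 = 2 ^ I.n
  player : s.reg 1 = I.player
  one : s.reg 2 = 1
  zero : s.reg 18 = 0
  eps : s.num 0 = I.eps
  numZero : s.num 2 = 0

/-- The program writes none of the registers of the heap context. -/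
def Program.keepsHeapContext (p : Program) : Bool :=
  [0, 1, 2, 18].all (fun k => !p.any (Op.setsReg k)) &&
    [0, 2].all (fun k => !p.any (Op.setsNum k))

lemma HeapContext.of_frame {I : Instance ℝ} {s s' : State ℝ} {p : Program}
    (h : HeapContext I s) (hf : Frame p s s') (hp : p.keepsHeapContext = true) :
    HeapContext I s' := by
  simp only [Program.keepsHeapContext, List.all_cons, List.all_nil, Bool.and_true,
    Bool.and_eq_true, Bool.not_eq_true'] at hp
  obtain ⟨⟨h0, h1, h2, h18⟩, g0, g2⟩ := hp
  exact ⟨(hf.reg _ h0).trans h.size, (hf.reg _ h1).trans h.player, (hf.reg _ h2).trans h.one,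
    (hf.reg _ h18).trans h.zero, (hf.num _ g0).trans h.eps, (hf.num _ g2).trans h.numZero⟩

section HeapProgram

variable {I : Instance ℝ}

/-- Register 11 becomes the winner among the positions in the registers 8 and 9. The entry of the
match is compared with number register 2, which is never written and thus `0`. -/
def beatProg : Program :=
  .op (.readDraw 13 8) ;; .op (.readDraw 14 9) ;; .op (.readEntry 1 13 14) ;;
  .branch (.numLt 2 1) (.op (.add 11 8 18)) (.op (.add 11 9 18))

lemma reach_beatProg {s : State ℝ} (hc : HeapContext I s) :
    Reach (fun _ => True) I beatProg s 5 (fun s' =>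
      s'.reg 11 = matchWinner (positionEntry I) (s.reg 8) (s.reg 9)) := by
  have h18 := hc.zero
  have g2 := hc.numZero
  refine reach_cons trivial (reach_cons trivial (reach_cons trivial (reach_branch
    (fun h => reach_op trivial le_rfl ?_) (fun h => reach_op trivial le_rfl ?_))))
  all_goals simp [Test.Holds, Op.apply, g2] at h
  · simp [Op.apply, h18, matchWinner, positionEntry, h]
  · simp [Op.apply, h18, matchWinner, positionEntry, h.not_gt]

/-- The memory at the node in register 6 becomes the winner at this node, and register 6 is
decreased by one. -/
def winnerProg : Program :=
  .op (.add 7 6 6) ;; .op (.load 8 7) ;; .op (.add 7 7 2) ;; .op (.load 9 7) ;; beatProg ;;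
  .op (.store 6 11) ;; .op (.sub 6 6 2)

lemma reach_winnerProg {s : State ℝ} (hc : HeapContext I s) {j : ℕ} (hj : 1 ≤ j)
    (hjn : j < 2 ^ I.n) (h6 : s.reg 6 = j) (hmem : ∀ v, j < v → v < 2 ^ I.n + 2 ^ I.n →
      s.mem v = heapWinner (positionEntry I) I.n v) :
    Reach (fun _ => True) I winnerProg s 11 (fun s' => s'.reg 6 = j - 1 ∧
      ∀ v, j ≤ v → v < 2 ^ I.n + 2 ^ I.n → s'.mem v = heapWinner (positionEntry I) I.n v) := by
  refine reach_cons trivial (reach_cons trivial (reach_cons trivial (reach_cons trivial ?_)))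
  set s₁ := Op.apply I (Op.apply I (Op.apply I (Op.apply I s (.add 7 6 6)) (.load 8 7))
    (.add 7 7 2)) (.load 9 7) with hs₁
  have hc₁ : HeapContext I s₁ := hc.of_frame ((frame_op I (.add 7 6 6) s).seq
    ((frame_op I (.load 8 7) _).seq ((frame_op I (.add 7 7 2) _).seq
      (frame_op I (.load 9 7) _)))) rfl
  have e8 : s₁.reg 8 = heapWinner (positionEntry I) I.n (2 * j) := by
    rw [← hmem (2 * j) (by omega) (by omega)]
    simp [hs₁, Op.apply, h6, two_mul]
  have e9 : s₁.reg 9 = heapWinner (positionEntry I) I.n (2 * j + 1) := by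
    rw [← hmem (2 * j + 1) (by omega) (by omega)]
    simp [hs₁, Op.apply, h6, hc.one, two_mul]
  have e6 : s₁.reg 6 = j := by simp [hs₁, Op.apply, h6]
  have em : s₁.mem = s.mem := rfl
  refine Reach.seq (T₁ := 5) (T₂ := 2) (reach_beatProg hc₁) ?_ le_rfl
  intro s₂ hf₂ h11
  rw [e8, e9, ← heapWinner_eq_matchWinner _ hj hjn] at h11
  have f6 : s₂.reg 6 = j := (hf₂.reg 6 rfl).trans e6
  refine reach_cons trivial (reach_op trivial le_rfl ⟨?_, fun v hv hvn => ?_⟩)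
  · simp [Op.apply, f6, hf₂.reg 2 rfl, hc₁.one]
  · rcases Nat.eq_or_lt_of_le hv with rfl | hv
    · simp [Op.apply, f6, h11]
    · simp only [Op.apply, f6]
      rw [Function.update_of_ne (by omega), hf₂.mem rfl, em, hmem v hv hvn]

/-- One step up the tree: the position in register 8 at the node in register 12 meets the winner
at the sibling node. -/
def climbProg : Program :=
  .op (.half 15 12) ;; .op (.add 16 15 15) ;; .op (.add 16 16 16) ;; .op (.add 16 16 2) ;;
  .op (.sub 16 16 12) ;; .op (.load 9 16) ;; beatProg ;; .op (.add 8 11 18) ;;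
  .op (.add 12 15 18)

lemma reach_climbProg {s : State ℝ} (hc : HeapContext I s) :
    Reach (fun _ => True) I climbProg s 13 (fun s' => s'.reg 12 = s.reg 12 / 2 ∧
      s'.reg 8 = matchWinner (positionEntry I) (s.reg 8)
        (s.mem (4 * (s.reg 12 / 2) + 1 - s.reg 12))) := by
  refine reach_cons trivial (reach_cons trivial (reach_cons trivial (reach_cons trivial
    (reach_cons trivial (reach_cons trivial ?_)))))
  set s₁ := Op.apply I (Op.apply I (Op.apply I (Op.apply I (Op.apply I (Op.apply I s
    (.half 15 12)) (.add 16 15 15)) (.add 16 16 16)) (.add 16 16 2)) (.sub 16 16 12))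
    (.load 9 16) with hs₁
  have hc₁ : HeapContext I s₁ := hc.of_frame ((frame_op I (.half 15 12) s).seq
    ((frame_op I (.add 16 15 15) _).seq ((frame_op I (.add 16 16 16) _).seq
      ((frame_op I (.add 16 16 2) _).seq ((frame_op I (.sub 16 16 12) _).seq
        (frame_op I (.load 9 16) _)))))) rfl
  have e8 : s₁.reg 8 = s.reg 8 := by simp [hs₁, Op.apply]
  have e9 : s₁.reg 9 = s.mem (4 * (s.reg 12 / 2) + 1 - s.reg 12) := by
    rw [show 4 * (s.reg 12 / 2) = s.reg 12 / 2 + s.reg 12 / 2 + (s.reg 12 / 2 + s.reg 12 / 2) by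
      ring]
    simp [hs₁, Op.apply, hc.one]
  have e15 : s₁.reg 15 = s.reg 12 / 2 := by simp [hs₁, Op.apply]
  refine Reach.seq (T₁ := 5) (T₂ := 2) (reach_beatProg hc₁) ?_ le_rfl
  intro s₂ hf₂ h11
  rw [e8, e9] at h11
  refine reach_cons trivial (reach_op trivial le_rfl ⟨?_, ?_⟩)
  · simp [Op.apply, hf₂.reg 15 rfl, hf₂.reg 18 rfl, e15, hc₁.zero]
  · simp [Op.apply, h11, hf₂.reg 18 rfl, hc₁.zero]

lemma reach_climbLoop {s : State ℝ} (hc : HeapContext I s) {j c : ℕ} (hj : 1 ≤ j)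
    (hjn : j < 2 ^ I.n) (h12 : s.reg 12 = j) (h8 : s.reg 8 = c)
    (hmem : ∀ v, 1 ≤ v → v < 2 ^ I.n + 2 ^ I.n →
      s.mem v = heapWinner (positionEntry I) I.n v) :
    Reach (fun _ => True) I (.loop (.lt 2 12) climbProg) s (14 * I.n + 1) (fun s' =>
      s'.reg 8 = climb (positionEntry I) (heapWinner (positionEntry I) I.n) j c) := by
  set w := heapWinner (positionEntry I) I.n with hw
  have hlog : Nat.log 2 j < I.n := Nat.log_lt_of_lt_pow (by omega) hjn
  have hlast : j / 2 ^ Nat.log 2 j = 1 := by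
    refine Nat.div_eq_of_lt_le ?_ ?_
    · rw [one_mul]; exact Nat.pow_log_le_self 2 (by omega)
    · have := Nat.lt_pow_succ_log_self (by norm_num : 1 < 2) j
      rw [pow_succ] at this
      omega
  refine (reach_loop_const (fun t s' => s'.reg 12 = j / 2 ^ t ∧
    climb (positionEntry I) w (j / 2 ^ t) (s'.reg 8) = climb (positionEntry I) w j c)
    (Nat.log 2 j) 13 ⟨by simp [h12], by simp [h8]⟩ ?_ ?_).mono (by omega) ?_
  · rintro t ht s₁ hf ⟨e12, e8⟩
    have hc₁ := hc.of_frame hf rfl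
    have hv : 1 < j / 2 ^ t := by
      have h1 : 2 ^ (t + 1) ≤ j := (Nat.pow_le_pow_right (by norm_num) ht).trans
        (Nat.pow_log_le_self 2 (by omega))
      rw [pow_succ, mul_comm] at h1
      exact (Nat.le_div_iff_mul_le (Nat.two_pow_pos t)).2 h1
    have hvj : j / 2 ^ t ≤ j := Nat.div_le_self _ _
    have hhalf : j / 2 ^ (t + 1) = j / 2 ^ t / 2 := by rw [pow_succ, Nat.div_div_eq_div_mul]
    refine ⟨by simp only [Test.Holds, e12, hc₁.one]; exact hv, ?_⟩
    refine (reach_climbProg hc₁).mono le_rfl ?_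
    rintro s₂ - ⟨f12, f8⟩
    rw [e12] at f12
    refine ⟨by rw [f12, hhalf], ?_⟩
    rw [← e8, hhalf, climb.eq_def _ _ (j / 2 ^ t), if_pos hv, f8, e12, hf.mem rfl,
      hmem _ (by omega) (by omega)]
  · rintro s₁ hf ⟨e12, -⟩
    have hc₁ := hc.of_frame hf rfl
    simp [Test.Holds, e12, hc₁.one, hlast]
  · rintro s₁ - ⟨-, h⟩
    rwa [hlast, climb_one] at h

/-- The match at the node in register 6 is reversed. If the distinguished player does not win
after that, then `ε` is added to number register 3. Register 6 is increased by one. -/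
def flipProg : Program :=
  .op (.add 7 6 6) ;; .op (.load 8 7) ;; .op (.add 7 7 2) ;; .op (.load 9 7) ;;
  .op (.load 10 6) ;; .op (.add 8 8 9) ;; .op (.sub 8 8 10) ;; .op (.add 12 6 18) ;;
  .loop (.lt 2 12) climbProg ;; .op (.readDraw 10 8) ;;
  .branch (.eq 10 1) skip (.op (.numAdd 3 3 0)) ;; .op (.add 6 6 2)

lemma reach_flipProg {s : State ℝ} (hc : HeapContext I s) {j : ℕ} (hj : 1 ≤ j)
    (hjn : j < 2 ^ I.n) (h6 : s.reg 6 = j)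
    (hwin : heapWinner (positionEntry I) I.n 1 = I.draw.symm I.player)
    (hmem : ∀ v, 1 ≤ v → v < 2 ^ I.n + 2 ^ I.n →
      s.mem v = heapWinner (positionEntry I) I.n v) :
    Reach (fun _ => True) I flipProg s (14 * I.n + 13) (fun s' => s'.reg 6 = j + 1 ∧
      s'.num 3 = s.num 3 +
        flipValue (positionEntry I) I.n (I.draw.symm I.player) j * I.eps) := by
  refine reach_cons (T := 14 * I.n + 12) trivial (reach_cons (T := 14 * I.n + 11) trivial
    (reach_cons (T := 14 * I.n + 10) trivial (reach_cons (T := 14 * I.n + 9) trivial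
      (reach_cons (T := 14 * I.n + 8) trivial (reach_cons (T := 14 * I.n + 7) trivial
        (reach_cons (T := 14 * I.n + 6) trivial (reach_cons (T := 14 * I.n + 5) trivial ?_)))))))
  set s₁ := Op.apply I (Op.apply I (Op.apply I (Op.apply I (Op.apply I (Op.apply I (Op.apply I
    (Op.apply I s (.add 7 6 6)) (.load 8 7)) (.add 7 7 2)) (.load 9 7)) (.load 10 6))
    (.add 8 8 9)) (.sub 8 8 10)) (.add 12 6 18) with hs₁
  have hc₁ : HeapContext I s₁ := hc.of_frame ((frame_op I (.add 7 6 6) s).seq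
    ((frame_op I (.load 8 7) _).seq ((frame_op I (.add 7 7 2) _).seq
      ((frame_op I (.load 9 7) _).seq ((frame_op I (.load 10 6) _).seq
        ((frame_op I (.add 8 8 9) _).seq ((frame_op I (.sub 8 8 10) _).seq
          (frame_op I (.add 12 6 18) _)))))))) rfl
  have e8 : s₁.reg 8 = heapLoser (positionEntry I) I.n j := by
    rw [heapLoser, ← hmem (2 * j) (by omega) (by omega),
      ← hmem (2 * j + 1) (by omega) (by omega), ← hmem j hj (by omega)]
    simp [hs₁, Op.apply, h6, hc.one, two_mul]
  have e12 : s₁.reg 12 = j := by simp [hs₁, Op.apply, h6, hc.zero]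
  have e6 : s₁.reg 6 = j := by simp [hs₁, Op.apply, h6]
  have e3 : s₁.num 3 = s.num 3 := rfl
  refine Reach.seq (T₁ := 14 * I.n + 1) (T₂ := 4) (reach_climbLoop hc₁ hj hjn e12 e8 hmem) ?_
    le_rfl
  intro s₂ hf₂ h8
  have hc₂ := hc₁.of_frame hf₂ rfl
  have hlt := climb_lt (positionEntry I) (n := I.n) j (heapLoser (positionEntry I) I.n j)
    (by omega) (heapLoser_lt _ hj hjn)
  have hleaf := leaf_eq_iff I hlt I.player
  rw [← h8] at hlt hleaf
  have f6 : s₂.reg 6 = j := (hf₂.reg 6 rfl).trans e6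
  have f3 : s₂.num 3 = s.num 3 := (hf₂.num 3 rfl).trans e3
  refine reach_cons trivial (Reach.seq (T₁ := 2) (T₂ := 1) (Q₁ := fun s' => s'.num 3 = s.num 3 +
    flipValue (positionEntry I) I.n (I.draw.symm I.player) j * I.eps)
    (reach_branch (fun h => reach_skip ?_) fun h => reach_op trivial le_rfl ?_) ?_ le_rfl)
  · simp only [Test.Holds, Op.apply] at h
    simp [hc₂.player, hleaf] at h
    rw [h8] at h
    simp [Op.apply, flipValue, hwin, h, f3]
  · simp only [Test.Holds, Op.apply] at h
    simp [hc₂.player, hleaf] at h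
    rw [h8] at h
    simp [Op.apply, flipValue, hwin, h, f3, hc₂.eps]
  · intro s₃ hf₃ h3
    refine reach_op trivial le_rfl ⟨?_, h3⟩
    simp [Op.apply, hf₃.reg 6 rfl, hf₃.reg 2 rfl, f6, hc₂.one]

/-- The memory at the leaf `2 ^ n + p` becomes its position `p`. -/
def leavesProg : Program :=
  .loop (.lt 3 0) (.op (.add 5 0 3) ;; .op (.store 5 3) ;; .op (.add 3 3 2))

lemma reach_leavesProg {s : State ℝ} (hc : HeapContext I s) (h3 : s.reg 3 = 0) :
    Reach (fun _ => True) I leavesProg s (2 ^ I.n * 4 + 1) (fun s' =>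
      ∀ p < 2 ^ I.n, s'.mem (2 ^ I.n + p) = p) := by
  refine (reach_loop_const (fun t s' => s'.reg 3 = t ∧ ∀ p < t, s'.mem (2 ^ I.n + p) = p)
    (2 ^ I.n) 3 ⟨h3, by simp⟩ ?_ ?_).mono le_rfl fun _ _ h => h.2
  · rintro t ht s₁ hf ⟨e3, em⟩
    have hc₁ := hc.of_frame hf rfl
    refine ⟨by simpa only [Test.Holds, e3, hc₁.size] using ht, ?_⟩
    refine reach_cons trivial (reach_cons trivial (reach_op trivial le_rfl ⟨?_, ?_⟩))
    · simp [Op.apply, e3, hc₁.one]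
    · intro p hp
      rcases Nat.lt_succ_iff_lt_or_eq.1 hp with hp | rfl
      · simp only [Op.apply]
        rw [Function.update_of_ne, em p hp]
        simp [e3, hc₁.size]
        omega
      · simp [Op.apply, e3, hc₁.size]
  · rintro s₁ hf ⟨e3, -⟩
    have hc₁ := hc.of_frame hf rfl
    simp [Test.Holds, e3, hc₁.size]

/-- For deterministic matrices: the winners at all nodes are computed from the leaves up. If the
distinguished player wins, then each match that takes place is reversed and the loser is followed
up the tree. -/
def deterministicProg : Program :=
  .op (.const 2 1) ;; leavesProg ;; .op (.sub 6 0 2) ;; .loop (.lt 18 6) winnerProg ;;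
  .op (.load 10 2) ;; .op (.readDraw 10 10) ;;
  .branch (.eq 10 1) (.op (.const 6 1) ;; .loop (.lt 6 0) flipProg) skip ;;
  .op (.numAdd 0 3 2)

lemma reach_deterministicProg : Reach (fun _ => True) I deterministicProg I.init
    (100 * (2 ^ I.n * I.n + 1)) (fun s' => s'.num 0 = (∑ j ∈ Finset.Ico 1 (2 ^ I.n),
      flipValue (positionEntry I) I.n (I.draw.symm I.player) j) * I.eps) := by
  set w := heapWinner (positionEntry I) I.n with hw
  have hN1 := Nat.one_le_two_pow (n := I.n)
  set N := 2 ^ I.n with hN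
  set C := 14 * I.n + 13 with hC
  refine Reach.mono (T := (N * 4 + 1 + (1 + (((N - 1) * 12 + 1) +
    (2 + ((1 + (1 + ((N - 1) * (C + 1) + 1))) + 1))))) + 1) ?_ ?_ fun _ _ h => h
  swap
  · rcases Nat.eq_zero_or_pos I.n with h0 | h0
    · simp [hN, hC, h0]
    · have h1 : N ≤ N * I.n := Nat.le_mul_of_pos_right _ h0
      have h2 : (N - 1) * (C + 1) ≤ N * (C + 1) := Nat.mul_le_mul_right _ (Nat.sub_le _ _)
      have h3 : N * (C + 1) = 14 * (N * I.n) + 14 * N := by rw [hC]; ring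
      rw [← hN]
      omega
  refine reach_cons (T := N * 4 + 1 + (1 + (((N - 1) * 12 + 1) +
    (2 + ((1 + (1 + ((N - 1) * (C + 1) + 1))) + 1))))) trivial ?_
  set s₀ := Op.apply I I.init (.const 2 1) with hs₀
  have hc₀ : HeapContext I s₀ := by
    constructor <;> simp [hs₀, Op.apply, Instance.init]
  have g3 : s₀.num 3 = 0 := by simp [hs₀, Op.apply, Instance.init]
  refine Reach.seq (reach_leavesProg hc₀ (by simp [hs₀, Op.apply, Instance.init])) ?_ le_rfl
  intro s₁ hf₁ hleaves
  have hc₁ := hc₀.of_frame hf₁ rfl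
  rw [add_comm 1]
  refine reach_cons (T := ((N - 1) * 12 + 1) +
    (2 + ((1 + (1 + ((N - 1) * (C + 1) + 1))) + 1))) trivial ?_
  set s₂ := Op.apply I s₁ (.sub 6 0 2) with hs₂
  have hf₂ := frame_op I (.sub 6 0 2) s₁
  rw [← hs₂] at hf₂
  have hc₂ := hc₁.of_frame hf₂ rfl
  refine Reach.seq (reach_loop_const (fun t s' => s'.reg 6 = N - 1 - t ∧
    ∀ v, N - 1 - t < v → v < N + N → s'.mem v = w v) (N - 1) 11 ⟨?_, ?_⟩ ?_ ?_) ?_ le_rfl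
  · simp [hs₂, Op.apply, hc₁.size, hc₁.one, hN]
  · intro v hv hvn
    obtain ⟨p, rfl⟩ := Nat.exists_eq_add_of_le (show N ≤ v by omega)
    rw [hf₂.mem rfl, hleaves p (by omega), hw, heapWinner_leaf _ (by omega)]
  · rintro t ht s₃ hf₃ ⟨e6, em⟩
    have hc₃ := hc₂.of_frame hf₃ rfl
    refine ⟨by simp only [Test.Holds, e6, hc₃.zero]; omega, ?_⟩
    refine (reach_winnerProg hc₃ (j := N - 1 - t) (by omega) (by omega) e6 em).mono le_rfl ?_
    rintro s₄ - ⟨f6, fm⟩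
    exact ⟨by omega, fun v hv hvn => fm v (by omega) hvn⟩
  · rintro s₃ hf₃ ⟨e6, -⟩
    have hc₃ := hc₂.of_frame hf₃ rfl
    simp only [Test.Holds, e6, hc₃.zero]
    omega
  rintro s₃ hf₃ ⟨-, hmem⟩
  have hc₃ := hc₂.of_frame hf₃ rfl
  have h3 : s₃.num 3 = 0 := by
    rw [hf₃.num 3 rfl, hf₂.num 3 rfl, hf₁.num 3 rfl, g3]
  rw [Nat.sub_self] at hmem
  rw [add_comm 2]
  refine reach_cons (T := (1 + (1 + ((N - 1) * (C + 1) + 1))) + 1 + 1) trivial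
    (reach_cons (T := (1 + (1 + ((N - 1) * (C + 1) + 1))) + 1) trivial ?_)
  set s₄ := Op.apply I (Op.apply I s₃ (.load 10 2)) (.readDraw 10 10) with hs₄
  have hc₄ : HeapContext I s₄ :=
    hc₃.of_frame ((frame_op I (.load 10 2) s₃).seq (frame_op I (.readDraw 10 10) _)) rfl
  have h10 : s₄.reg 10 = I.leaf (w 1) := by
    rw [← hmem 1 (by omega) (by omega)]
    simp [hs₄, Op.apply, hc₃.one]
  have hleaf := leaf_eq_iff I (heapWinner_lt (positionEntry I) (n := I.n) le_rfl (by omega))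
    I.player
  have g3' : s₄.num 3 = 0 := h3
  refine Reach.seq (T₁ := 1 + (1 + ((N - 1) * (C + 1) + 1))) (T₂ := 1)
    (Q₁ := fun s' => s'.num 3 = (∑ j ∈ Finset.Ico 1 N,
      flipValue (positionEntry I) I.n (I.draw.symm I.player) j) * I.eps) ?_ ?_ le_rfl
  · rw [add_comm 1 (1 + _)]
    refine reach_branch (fun h => ?_) fun h => (reach_skip ?_).mono (by omega) fun _ _ h => h
    · simp only [Test.Holds, h10, hc₄.player] at h
      have hwin := hleaf.1 h
      rw [add_comm 1]
      refine reach_cons (T := (N - 1) * (C + 1) + 1) trivial ?_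
      refine (reach_loop_const (fun t s' => s'.reg 6 = 1 + t ∧
        s'.num 3 = (∑ j ∈ Finset.Ico 1 (1 + t),
          flipValue (positionEntry I) I.n (I.draw.symm I.player) j) * I.eps) (N - 1) C
        ⟨by simp [Op.apply], by simp [Op.apply, g3']⟩ ?_ ?_).mono le_rfl ?_
      · rintro t ht s₅ hf₅ ⟨e6, e3⟩
        have hc₅ := (hc₄.of_frame (frame_op I (.const 6 1) s₄) rfl).of_frame hf₅ rfl
        refine ⟨by simp only [Test.Holds, e6, hc₅.size]; omega, ?_⟩
        refine (reach_flipProg hc₅ (j := 1 + t) (by omega) (by omega) e6 hwin ?_).mono le_rfl ?_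
        · intro v hv hvn
          rw [hf₅.mem rfl]
          exact hmem v hv hvn
        · rintro s₆ - ⟨f6, f3⟩
          refine ⟨f6, ?_⟩
          rw [f3, e3, ← add_assoc, Finset.sum_Ico_succ_top (by omega), add_mul]
      · rintro s₅ hf₅ ⟨e6, -⟩
        have hc₅ := (hc₄.of_frame (frame_op I (.const 6 1) s₄) rfl).of_frame hf₅ rfl
        simp only [Test.Holds, e6, hc₅.size]
        omega
      · rintro s₅ - ⟨-, e3⟩
        rw [e3, Nat.add_sub_cancel' hN1]
    · simp only [Test.Holds, h10, hc₄.player] at h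
      have hwin := mt hleaf.2 h
      have hzero : ∀ j, flipValue (positionEntry I) I.n (I.draw.symm I.player) j = 0 := fun j =>
        if_neg fun hj => hwin hj.1
      simp [Op.apply, g3', hzero]
  · intro s₅ hf₅ e3
    have hc₅ := hc₄.of_frame hf₅ rfl
    exact reach_op trivial le_rfl (by simp [Op.apply, e3, hc₅.numZero, hN])

end HeapProgram

lemma outputs_deterministicProg {n : ℕ} {P : Matrix (Fin (2 ^ n)) (Fin (2 ^ n)) ℝ}
    (hP : IsComparison P) (hd : IsDeterministic P) (i : Fin (2 ^ n))
    (σ : Equiv.Perm (Fin (2 ^ n))) (ε : ℝ) :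
    Outputs (unitCost ℝ) deterministicProg ⟨n, i, P, σ, ε⟩ (firstOrderDrop i P σ ε)
      (100 * (2 ^ n * n + 1)) := by
  obtain ⟨s, t, he, ht, hv⟩ := reach_deterministicProg (I := ⟨n, i, P, σ, ε⟩)
  exact ⟨s, t, he.run, hv.trans (firstOrderDrop_eq_sum_flipValue (I := ⟨n, i, P, σ, ε⟩) hP hd
    ε).symm, ht⟩

end Knockout

end

theorem theorem1 :
    -- the drop is a polynomial for small `ε`, and the two formulas for its linear term
    (∀ (n : ℕ) (P : Matrix (Fin (2 ^ n)) (Fin (2 ^ n)) ℝ) (i : Fin (2 ^ n))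
        (σ : Equiv.Perm (Fin (2 ^ n))), Knockout.IsComparison P →
      (∃ p : ℝ[X], Knockout.IsDropPolynomial i P σ p ∧ p.coeff 0 = 0) ∧
      (Knockout.IsDeterministic P → Knockout.winProb i P σ = 1 → ∀ ε : ℝ, 0 < ε →
        Knockout.firstOrderDrop i P σ ε = ((Knockout.crucialMatches i P σ).ncard : ℝ) * ε) ∧
      (∃ α β : Fin (2 ^ n) → Fin (2 ^ n) → ℝ,
        (∀ a b, a ≠ b → ∀ x : ℝ, 0 ≤ x → x ≤ 1 →
          Knockout.winProb i (Knockout.setMatch P a b x) σ = α a b * x + β a b) ∧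
        (∀ ε : ℝ, 0 < ε → Knockout.firstOrderDrop i P σ ε =
          (∑ a, ∑ b ∈ Finset.univ.filter (fun b => a < b),
            Knockout.matchDrop (P a b) (α a b)) * ε) ∧
        ((∀ a b, a ≠ b → P a b ≠ 0 ∧ P a b ≠ 1) → ∀ ε : ℝ, 0 < ε →
          Knockout.firstOrderDrop i P σ ε =
            (∑ a, ∑ b ∈ Finset.univ.filter (fun b => a < b), |α a b|) * ε))) ∧
    -- deterministic matrices: `O(N log N)` steps
    (∃ (p : Knockout.Program) (K : ℕ), ∀ (n : ℕ) (P : Matrix (Fin (2 ^ n)) (Fin (2 ^ n)) ℝ)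
        (i : Fin (2 ^ n)) (σ : Equiv.Perm (Fin (2 ^ n))) (ε : ℝ),
      Knockout.IsComparison P → Knockout.IsDeterministic P → 0 < ε →
      Knockout.Outputs (Knockout.unitCost ℝ) p ⟨n, i, P, σ, ε⟩
        (Knockout.firstOrderDrop i P σ ε) (K * (2 ^ n * n + 1))) ∧
    -- arbitrary matrices: `O(N ^ 4)` steps, and polynomial bit cost on rational input
    (∃ p : Knockout.Program,
      (∃ K : ℕ, ∀ (n : ℕ) (P : Matrix (Fin (2 ^ n)) (Fin (2 ^ n)) ℝ)
          (i : Fin (2 ^ n)) (σ : Equiv.Perm (Fin (2 ^ n))) (ε : ℝ),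
        Knockout.IsComparison P → 0 < ε →
        Knockout.Outputs (Knockout.unitCost ℝ) p ⟨n, i, P, σ, ε⟩
          (Knockout.firstOrderDrop i P σ ε) (K * (2 ^ n) ^ 4)) ∧
      (∃ K d : ℕ, ∀ (n : ℕ) (P : Matrix (Fin (2 ^ n)) (Fin (2 ^ n)) ℚ)
          (i : Fin (2 ^ n)) (σ : Equiv.Perm (Fin (2 ^ n))) (ε : ℚ),
        Knockout.IsComparison (P.map (fun q : ℚ => (q : ℝ))) → 0 < ε →
        ∃ v : ℚ, (v : ℝ) = Knockout.firstOrderDrop i (P.map (fun q : ℚ => (q : ℝ))) σ (ε : ℝ) ∧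
          Knockout.Outputs Knockout.bitCost p ⟨n, i, P, σ, ε⟩ v
            (K * (Knockout.inputBits P ε) ^ d))) := by
  refine ⟨fun n P i σ hP => ⟨?_, ?_, ?_⟩, ⟨Knockout.deterministicProg, 100, ?_⟩,
    ⟨Knockout.generalProg, ⟨200, ?_⟩, ⟨100000, 4, ?_⟩⟩⟩
  · obtain ⟨p, hp, h0, -⟩ := Knockout.exists_isDropPolynomial hP σ i
    exact ⟨p, hp, h0⟩
  · exact fun hd hw ε _ => Knockout.firstOrderDrop_of_winProb_eq_one hP hd σ i hw ε
  · refine ⟨Knockout.playerSlope i P σ,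
      fun a b => Knockout.winProb i (Knockout.setMatch P a b 0) σ,
      fun a b hab x h0 h1 => Knockout.winProb_setMatch_eq hP σ i hab h0 h1,
      fun ε _ => Knockout.firstOrderDrop_eq_sum hP σ i ε, fun hne ε _ => ?_⟩
    rw [Knockout.firstOrderDrop_eq_sum hP σ i ε]
    congr 1
    refine Finset.sum_congr rfl fun a _ => Finset.sum_congr rfl fun b hb => ?_
    have hab := hne a b (Finset.mem_filter.1 hb).2.ne
    rw [Knockout.matchDrop, if_neg hab.1, if_neg hab.2]
  · exact fun n P i σ ε hP hd _ => Knockout.outputs_deterministicProg hP hd i σ ε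
  · exact fun n P i σ ε hP _ => Knockout.outputs_generalProg_unitCost hP i σ ε
  · exact fun n P i σ ε hP _ => Knockout.outputs_generalProg_bitCost hP i σ ε
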